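/- Let $G$ be a finite-dimensional real Lie group with Lie algebra $\mathfrak g$, and let $\langle\cdot,\cdot\rangle:\mathfrak g\times\mathfrak g\to\mathbb R$ be a symmetric non-degenerate bilinear form with $\langle[a,b],c\rangle+\langle b,[a,c]\rangle=0$ for all $a,b,c\in\mathfrak g$ (so $(\mathfrak g,\langle\cdot,\cdot\rangle)$ is a quadratic Lie algebra). Assume that $G$ is connected or, more generally, that $\langle\cdot,\cdot\rangle$ is invariant under the adjoint action $\mathrm{Ad}$ of $G$ (which is automatic if $G$ is connected). Let $NG_\bullet$ be the nerve of $G$: $NG_n=G^n$ with faces $d_0(g_1,\dots,g_n)=(g_2,\dots,g_n)$, $d_i(g_1,\dots,g_n)=(g_1,\dots,g_ig_{i+1},\dots,g_n)$ for $0<i<n$, $d_n(g_1,\dots,g_n)=(g_1,\dots,g_{n-1})$ and degeneracies $s_i$ inserting the unit $e$ after $g_i$. Let $\theta^l,\theta^r\in\Omega^1(G;\mathfrak g)$ be the left and right Maurer–Cartan forms, let $$\Omega=\langle d_2^*\theta^l,d_0^*\theta^r\rangle\in\Omega^2(G\times G),\qquad \Theta=\tfrac16\langle\theta^l,[\theta^l,\theta^l]\rangle\in\Omega^3(G)$$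 be the Brylinski–Weinstein $2$-form and the Cartan $3$-form, and put $\Omega_\bullet=\Omega-\Theta+0$, with components $\Omega$ on $NG_2$, $-\Theta$ on $NG_1$ and $0$ on $NG_0$. Then $(NG_\bullet,\Omega_\bullet)$ is a $2$-shifted symplectic Lie $1$-group, that is: 1. $NG_\bullet$ is a Lie $1$-group: a simplicial manifold with $NG_0=pt$ whose spaces of horns $\mathrm{Hom}(\Lambda[l,j],NG_\bullet)$ are manifolds and whose horn projections $p_{l,j}:NG_l\to\mathrm{Hom}(\Lambda[l,j],NG_\bullet)$ are surjective submersions for all $l\ge1$, $0\le j\le l$, and diffeomorphisms for all $l>1$. 2. $\Omega_\bullet$ is a closed normalized $2$-shifted $2$-form: $D\Omega_\bullet=0$ for $D=\delta+(-1)^pd$ on $\Omega^q(NG_p)$, where $\delta=\sum_i(-1)^id_i^*$, and $s_i^*\Omega_\bullet=0$ for all $i$. 3. $\Omega_\bullet$ is non-degenerate. Let $\mathcal T_l=\bigcap_{i<l}\ker Td_i\subset T_{(e,\dots,e)}NG_l$, with differential $\partial=(-1)^lTd_l$, be the tangent complex, and let $$\lambda(v,w)=\sum_{\sigma}(-1)^\sigma\,\Omega\bigl(T(s_{\sigma(1)}\cdots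 s_{\sigma(l)})v,\;T(s_{\sigma(l-1)}\cdots s_{\sigma(0)})w\bigr),\qquad v\in\mathcal T_l,\ w\in\mathcal T_{2-l},$$ be the IM-form of $\Omega_\bullet$, the sum being over the $(l,2-l)$-shuffles $\sigma$ of $\{0,1\}$ (an empty composition of degeneracies is the identity). Then $\lambda$ induces a non-degenerate pairing $H_l(\mathcal T)\times H_{2-l}(\mathcal T)\to\mathbb R$ for every integer $l$ (where $\mathcal T_l=0$ for $l<0$ and $\lambda=0$ if $l<0$ or $l>2$). Moreover $\mathcal T_1=T_eG=\mathfrak g$, and on $\mathcal T_1$ the IM-form is $\lambda(v,w)=2\langle v,w\rangle$. -/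

import Mathlib

open scoped Manifold ContDiff Topology

universe u v

noncomputable section

set_option linter.checkUnivs false

/-! ## Differential forms on smooth manifolds -/

section Forms

variable {E : Type*} [NormedAddCommGroup E] [NormedSpace ℝ E]
  {E' : Type*} [NormedAddCommGroup E'] [NormedSpace ℝ E']
  {M : Type*} [TopologicalSpace M] [ChartedSpace E M]
  {N : Type*} [TopologicalSpace N] [ChartedSpace E' N]

/-- (Not necessarily smooth) real differential forms of degree `k` on a manifold `M` modelled
on `E`: a continuous alternating `k`-linear form on each tangent space. -/
abbrev DForm (E : Type*) [NormedAddCommGroup E] [NormedSpace ℝ E]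
    (M : Type*) [TopologicalSpace M] [ChartedSpace E M] (k : ℕ) : Type _ :=
  ∀ x : M, TangentSpace 𝓘(ℝ, E) x [⋀^Fin k]→L[ℝ] ℝ

namespace DForm

variable {k : ℕ}

/-- The pullback `f^* η`. -/
def pullback (f : M → N) (η : DForm E' N k) : DForm E M k := fun x =>
  (η (f x)).compContinuousLinearMap (mfderiv 𝓘(ℝ, E) 𝓘(ℝ, E') f x)

/-- The expression of `η` in the preferred chart around `x₀`, i.e. its pullback under the inverse
of the chart. -/
def inChart (η : DForm E M k) (x₀ : M) : E → E [⋀^Fin k]→L[ℝ] ℝ := fun y =>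
  (η ((chartAt E x₀).symm y)).compContinuousLinearMap
    (mfderiv 𝓘(ℝ, E) 𝓘(ℝ, E) (chartAt E x₀).symm y)

/-- A form is smooth if its expressions in charts are smooth. -/
def IsSmooth (η : DForm E M k) : Prop :=
  ∀ x₀ : M, ContDiffOn ℝ ∞ (inChart η x₀) (chartAt E x₀).target

/-- The de Rham differential, computed at `x` in the preferred chart around `x`. -/
def d (η : DForm E M k) : DForm E M (k + 1) := fun x =>
  (extDeriv (inChart η x) (chartAt E x x)).compContinuousLinearMap
    (mfderiv 𝓘(ℝ, E) 𝓘(ℝ, E) (chartAt E x) x)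

end DForm

end Forms

/-! ## Simplicial manifolds -/

/-- A simplicial (Banach) manifold. -/
structure SimplicialManifold where
  /-- the model space in level `l` -/
  E : ℕ → Type v
  [normedAddCommGroup : ∀ l, NormedAddCommGroup (E l)]
  [normedSpace : ∀ l, NormedSpace ℝ (E l)]
  [completeSpace : ∀ l, CompleteSpace (E l)]
  /-- the manifold in level `l` -/
  X : ℕ → Type u
  [topologicalSpace : ∀ l, TopologicalSpace (X l)]
  [chartedSpace : ∀ l, ChartedSpace (E l) (X l)]
  [isManifold : ∀ l, IsManifold 𝓘(ℝ, E l) ∞ (X l)]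
  /-- the faces `d_i : X_{l+1} → X_l`, `0 ≤ i ≤ l + 1` -/
  face : ∀ l, Fin (l + 2) → X (l + 1) → X l
  /-- the degeneracies `s_i : X_l → X_{l+1}`, `0 ≤ i ≤ l` -/
  degen : ∀ l, Fin (l + 1) → X l → X (l + 1)
  contMDiff_face : ∀ l i, ContMDiff 𝓘(ℝ, E (l + 1)) 𝓘(ℝ, E l) ∞ (face l i)
  contMDiff_degen : ∀ l i, ContMDiff 𝓘(ℝ, E l) 𝓘(ℝ, E (l + 1)) ∞ (degen l i)
  face_face : ∀ l (i j : Fin (l + 2)) (x : X (l + 2)), i ≤ j →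
    face l i (face (l + 1) j.succ x) = face l j (face (l + 1) i.castSucc x)
  degen_degen : ∀ l (i j : Fin (l + 1)) (x : X l), i ≤ j →
    degen (l + 1) i.castSucc (degen l j x) = degen (l + 1) j.succ (degen l i x)
  face_degen_of_le : ∀ l (i : Fin (l + 2)) (j : Fin (l + 1)) (x : X (l + 1)), i ≤ j.castSucc →
    face (l + 1) i.castSucc (degen (l + 1) j.succ x) = degen l j (face l i x)
  face_degen_castSucc : ∀ l (j : Fin (l + 1)) (x : X l), face l j.castSucc (degen l j x) = x
  face_degen_succ : ∀ l (j : Fin (l + 1)) (x : X l), face l j.succ (degen l j x) = x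
  face_degen_of_gt : ∀ l (i : Fin (l + 2)) (j : Fin (l + 1)) (x : X (l + 1)), j.castSucc < i →
    face (l + 1) i.succ (degen (l + 1) j.castSucc x) = degen l j (face l i x)

namespace SimplicialManifold

attribute [instance] normedAddCommGroup normedSpace completeSpace topologicalSpace chartedSpace
  isManifold

variable (K : SimplicialManifold.{u, v})

/-! ### Horns and Lie `n`-groupoids -/

/-- The tuples `(y_i)_{i ≠ j}` of `l`-simplices with `d_i y_k = d_{k-1} y_i` for `i < k`; they are
the simplicial maps from the horn `Λ[l+1, j]` to `K`. For `l = 0` there is no condition. -/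
def hornSet : ∀ (l : ℕ) (j : Fin (l + 2)), Set ({i : Fin (l + 2) // i ≠ j} → K.X l)
  | 0, _ => Set.univ
  | l + 1, j => {y | ∀ (i k : Fin (l + 2)) (hi : i.castSucc ≠ j) (hk : k.succ ≠ j), i ≤ k →
      K.face l i (y ⟨k.succ, hk⟩) = K.face l k (y ⟨i.castSucc, hi⟩)}

/-- `Hom(Λ[l+1, j], K)`, with the topology as a subspace of a power of `K_l`. -/
abbrev Horn (l : ℕ) (j : Fin (l + 2)) : Type u := K.hornSet l j

/-- The horn projection `p_{l+1, j} : K_{l+1} → Hom(Λ[l+1, j], K)`. -/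
def hornProj (l : ℕ) (j : Fin (l + 2)) (x : K.X (l + 1)) : K.Horn l j :=
  ⟨fun i => K.face l i x, by
    cases l with
    | zero => trivial
    | succ l => exact fun i k _ _ hik => K.face_face l i k x hik⟩

/-- A structure of smooth manifold on the space `Hom(Λ[l+1, j], K)`, compatible with its subspace
topology, for which it is the limit in the category of manifolds: a map into the horn space is
smooth if and only if all its components are smooth. Such a structure is unique. -/
structure HornManifold (l : ℕ) (j : Fin (l + 2)) where
  /-- the model space -/
  F : Type v
  [normedAddCommGroup : NormedAddCommGroup F]
  [normedSpace : NormedSpace ℝ F]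
  [completeSpace : CompleteSpace F]
  [chartedSpace : ChartedSpace F (K.Horn l j)]
  [isManifold : IsManifold 𝓘(ℝ, F) ∞ (K.Horn l j)]
  contMDiff_component : ∀ i : {i : Fin (l + 2) // i ≠ j},
    ContMDiff 𝓘(ℝ, F) 𝓘(ℝ, K.E l) ∞ (fun y : K.Horn l j => y.1 i)
  contMDiff_lift : ∀ (V : Type v) [NormedAddCommGroup V] [NormedSpace ℝ V] [CompleteSpace V]
    (M : Type u) [TopologicalSpace M] [ChartedSpace V M] [IsManifold 𝓘(ℝ, V) ∞ M]
    (f : M → K.Horn l j),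
    (∀ i : {i : Fin (l + 2) // i ≠ j}, ContMDiff 𝓘(ℝ, V) 𝓘(ℝ, K.E l) ∞ (fun x => (f x).1 i)) →
    ContMDiff 𝓘(ℝ, V) 𝓘(ℝ, F) ∞ f

attribute [instance] HornManifold.normedAddCommGroup HornManifold.normedSpace
  HornManifold.completeSpace

/-- Lie `n`-groupoids: all horn spaces are manifolds, all horn projections `p_{l,j}`, `l ≥ 1`, are
surjective submersions, and they are diffeomorphisms for `l > n`. -/
def IsLieGroupoid (n : ℕ) : Prop :=
  ∀ (l : ℕ) (j : Fin (l + 2)), ∃ S : K.HornManifold l j,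
    letI := S.chartedSpace
    Function.Surjective (K.hornProj l j) ∧
    (∀ x, Manifold.IsSubmersionAt 𝓘(ℝ, K.E (l + 1)) 𝓘(ℝ, S.F) ∞ (K.hornProj l j) x) ∧
    (n < l + 1 → ∃ Φ : K.X (l + 1) ≃ₘ^∞⟮𝓘(ℝ, K.E (l + 1)), 𝓘(ℝ, S.F)⟯ K.Horn l j,
      ⇑Φ = K.hornProj l j)

/-- Lie `n`-groups: Lie `n`-groupoids with `K_0` a point. -/
def IsLieGroup (n : ℕ) : Prop :=
  K.IsLieGroupoid n ∧ Nonempty (K.X 0) ∧ Subsingleton (K.X 0)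

/-! ### The de Rham double complex and shifted forms -/

/-- Families of forms `α_{p,q}` of degree `q` on `K_p`. -/
abbrev Cochain : Type _ := ∀ p q : ℕ, DForm (K.E p) (K.X p) q

/-- The simplicial differential `δ = ∑ (-1)^i d_i^*`, from forms on `K_p` to forms
on `K_{p+1}`. -/
def δ {p q : ℕ} (η : DForm (K.E p) (K.X p) q) : DForm (K.E (p + 1)) (K.X (p + 1)) q :=
  ∑ i : Fin (p + 2), (-1 : ℝ) ^ (i : ℕ) • DForm.pullback (K.face p i) η

/-- The total differential `D = δ + (-1)^p d`; the summand `(-1)^p d` starts at forms on `K_p`. -/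
def D (α : K.Cochain) : K.Cochain
  | 0, 0 => 0
  | 0, q + 1 => DForm.d (α 0 q)
  | p + 1, 0 => K.δ (α p 0)
  | p + 1, q + 1 => K.δ (α p (q + 1)) + (-1 : ℝ) ^ (p + 1) • DForm.d (α (p + 1) q)

/-- `α` is normalized: all pullbacks under degeneracies vanish. -/
def IsNormalized (α : K.Cochain) : Prop :=
  ∀ (p q : ℕ) (i : Fin (p + 1)), DForm.pullback (E := K.E p) (K.degen p i) (α (p + 1) q) = 0

/-- `m`-shifted `k`-forms `α = ∑_{p ≤ m} α_p`, where `α_p` is a smooth normalized form of degree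
`k + m - p` on `K_p`. -/
structure IsShiftedForm (m k : ℕ) (α : K.Cochain) : Prop where
  eq_zero : ∀ p q : ℕ, ¬ (p ≤ m ∧ p + q = k + m) → α p q = 0
  isSmooth : ∀ p q : ℕ, DForm.IsSmooth (α p q)
  isNormalized : K.IsNormalized α

/-! ### The tangent complex -/

/-- The iterated degeneracy `s_{a(m-1)} ∘ ⋯ ∘ s_{a(l+1)} ∘ s_{a(l)} : K_l → K_m`. It is only used
with `a k ≤ k`, where the reduction `Fin.ofNat` does nothing. -/
def iterDegen (a : ℕ → ℕ) {l m : ℕ} (h : l ≤ m) : K.X l → K.X m :=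
  Nat.leRec (motive := fun k _ => K.X l → K.X k) id
    (fun k _ f x => K.degen k (Fin.ofNat (k + 1) (a k)) (f x)) h

/-- The embedding `s_0 ∘ ⋯ ∘ s_0 : K_0 → K_l`. -/
def base (l : ℕ) (x : K.X 0) : K.X l := K.iterDegen (fun _ => 0) (Nat.zero_le l) x

/-- The differential of the face `d_i : K_{l+1} → K_l` at (the image of) `x ∈ K_0`. It is a map
from the tangent space `K.E (l + 1)` of `K_{l+1}` at `x` to the tangent space `K.E l` of `K_l` at
`x`, see `face_base`. -/
def tangentFace (l : ℕ) (i : Fin (l + 2)) (x : K.X 0) : K.E (l + 1) →L[ℝ] K.E l :=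
  mfderiv 𝓘(ℝ, K.E (l + 1)) 𝓘(ℝ, K.E l) (K.face l i) (K.base (l + 1) x)

/-- The differential of an iterated degeneracy `K_l → K_m` at `x ∈ K_0`, a map from the tangent
space of `K_l` at `x` to the tangent space of `K_m` at `x`, see `iterDegen_base`. -/
def tangentDegen (a : ℕ → ℕ) {l m : ℕ} (h : l ≤ m) (x : K.X 0) : K.E l →L[ℝ] K.E m :=
  mfderiv 𝓘(ℝ, K.E l) 𝓘(ℝ, K.E m) (K.iterDegen a h) (K.base l x)

/-- The fibre at `x ∈ K_0` of the tangent complex in degree `l`: the kernel of the differential of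
the horn projection `p_{l,l}`, that is, the common kernel of the `T d_i` with `i < l`; the whole
tangent space for `l = 0`. -/
def tangentComplex (x : K.X 0) : ∀ l : ℕ, Submodule ℝ (K.E l)
  | 0 => ⊤
  | l + 1 => ⨅ i : Fin (l + 1), LinearMap.ker (K.tangentFace l i.castSucc x).toLinearMap

/-- The differential `∂ = (-1)^l T d_l` of the tangent complex out of degree `l = k + 1`. -/
def bdry (x : K.X 0) (k : ℕ) : K.E (k + 1) →ₗ[ℝ] K.E k :=
  (-1 : ℝ) ^ (k + 1) • (K.tangentFace k (Fin.last (k + 1)) x).toLinearMap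

/-- The cycles of the tangent complex at `x`. -/
def cycles (x : K.X 0) : ∀ l : ℕ, Submodule ℝ (K.E l)
  | 0 => K.tangentComplex x 0
  | l + 1 => K.tangentComplex x (l + 1) ⊓ LinearMap.ker (K.bdry x l)

/-- The boundaries of the tangent complex at `x`. -/
def boundaries (x : K.X 0) (l : ℕ) : Submodule ℝ (K.E l) :=
  (K.tangentComplex x (l + 1)).map (K.bdry x l)

/-- The homology of the tangent complex at `x`. -/
abbrev homology (x : K.X 0) (l : ℕ) : Type v :=
  K.cycles x l ⧸ (K.boundaries x l).submoduleOf (K.cycles x l)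

/-! ### The IM-form and shifted symplectic structures -/

/-- `(l, m - l)`-shuffles: permutations of `{0, …, m - 1}` that are increasing on
`{0, …, l - 1}` and on `{l, …, m - 1}`. -/
def IsShuffle (l : ℕ) {m : ℕ} (σ : Equiv.Perm (Fin m)) : Prop :=
  (∀ i j : Fin m, i < j → (j : ℕ) < l → σ i < σ j) ∧
  (∀ i j : Fin m, i < j → l ≤ (i : ℕ) → σ i < σ j)

open Classical in
/-- The IM-form
`λ_x(v, w) = ∑_σ (-1)^σ α_m(T(s_{σ(m-1)} ⋯ s_{σ(l)}) v, T(s_{σ(l-1)} ⋯ s_{σ(0)}) w)`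
of a `2`-form `α_m` on `K_m`, for `v` in degree `l` and `w` in degree `r = m - l` of the tangent
complex at `x`; the sum is over all `(l, m - l)`-shuffles. -/
def imForm {m : ℕ} (η : DForm (K.E m) (K.X m) 2) {l r : ℕ} (h : l + r = m) (x : K.X 0)
    (v : K.E l) (w : K.E r) : ℝ :=
  ∑ σ : Equiv.Perm (Fin m) with IsShuffle l σ, ((Equiv.Perm.sign σ : ℤ) : ℝ) *
    η (K.base m x) ![
      K.tangentDegen (fun k => if hk : k < m then (σ ⟨k, hk⟩ : ℕ) else 0)
        (show l ≤ m by omega) x v,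
      K.tangentDegen (fun k => if hk : k - r < m then (σ ⟨k - r, hk⟩ : ℕ) else 0)
        (show r ≤ m by omega) x w]

/-- Non-degeneracy of (an `m`-shifted `2`-form with leading term) `η` on `K_m`: at every point of
`K_0` the IM-form descends to a non-degenerate pairing between the homology in degree `l` and in
degree `m - l` of the tangent complex, for all integers `l`. As there is no homology in negative
degrees, this means for `l > m` that the homology in degree `l` vanishes. -/
def IsNondegenerate {m : ℕ} (η : DForm (K.E m) (K.X m) 2) : Prop :=
  ∀ x : K.X 0,
    (∀ (l r : ℕ) (h : l + r = m), ∃ B : K.homology x l →ₗ[ℝ] K.homology x r →ₗ[ℝ] ℝ,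
      (∀ (v : K.cycles x l) (w : K.cycles x r),
        B (Submodule.Quotient.mk v) (Submodule.Quotient.mk w) = K.imForm η h x v w) ∧
      B.Nondegenerate) ∧
    ∀ l : ℕ, m < l → Subsingleton (K.homology x l)

/-- `(K, α)` is an `m`-shifted symplectic Lie `n`-groupoid. -/
structure IsShiftedSymplectic (m n : ℕ) (α : K.Cochain) : Prop where
  isLieGroupoid : K.IsLieGroupoid n
  isShiftedForm : K.IsShiftedForm m 2 α
  closed : K.D α = 0
  nondegenerate : K.IsNondegenerate (α m 2)

/-! ### The base points of the tangent complex -/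

theorem iterDegen_succ (a : ℕ → ℕ) {l m : ℕ} (h : l ≤ m) (x : K.X l) :
    K.iterDegen a (Nat.le_succ_of_le h) x =
      K.degen m (Fin.ofNat (m + 1) (a m)) (K.iterDegen a h x) := by
  unfold iterDegen
  rw [Nat.leRec_succ]

theorem base_succ (l : ℕ) (x : K.X 0) : K.base (l + 1) x = K.degen l 0 (K.base l x) :=
  K.iterDegen_succ _ (Nat.zero_le l) x

theorem degen_base (l : ℕ) (i : Fin (l + 1)) (x : K.X 0) :
    K.degen l i (K.base l x) = K.base (l + 1) x := by
  induction l with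
  | zero => rw [base_succ, show i = 0 from Fin.ext (by omega)]
  | succ l ih =>
    rw [base_succ K (l + 1)]
    cases i using Fin.cases with
    | zero => rfl
    | succ i =>
      have := K.degen_degen l 0 i (K.base l x) (Fin.zero_le _)
      rw [ih i] at this
      rw [base_succ K l, ← this, Fin.castSucc_zero, base_succ K l]

theorem face_base (l : ℕ) (i : Fin (l + 2)) (x : K.X 0) :
    K.face l i (K.base (l + 1) x) = K.base l x := by
  cases i using Fin.cases with
  | zero => rw [base_succ]; exact K.face_degen_castSucc l 0 _
  | succ i => rw [← degen_base K l i]; exact K.face_degen_succ l i _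

theorem iterDegen_base (a : ℕ → ℕ) {l m : ℕ} (h : l ≤ m) (x : K.X 0) :
    K.iterDegen a h (K.base l x) = K.base m x := by
  induction m, h using Nat.le_induction with
  | base => simp [iterDegen]
  | succ m h ih => rw [K.iterDegen_succ a h, ih, degen_base]

end SimplicialManifold

/-! ## Finite powers of a manifold -/

section Powers

variable {E : Type*} [NormedAddCommGroup E] [NormedSpace ℝ E]
  {G : Type*} [TopologicalSpace G] [ChartedSpace E G]

/-- The product manifold structure on `G^n`, with charts the products of `n` charts of `G`. -/
abbrev powChartedSpace (E : Type*) [NormedAddCommGroup E] [NormedSpace ℝ E]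
    (G : Type*) [TopologicalSpace G] [ChartedSpace E G] (n : ℕ) :
    ChartedSpace (Fin n → E) (Fin n → G) :=
  piChartedSpace (fun _ : Fin n => E) (fun _ : Fin n => G)

attribute [local instance] powChartedSpace

theorem pow_chartAt_apply {n : ℕ} (x y : Fin n → G) (i : Fin n) :
    chartAt (Fin n → E) x y i = chartAt E (x i) (y i) := rfl

theorem pow_chartAt_symm_apply {n : ℕ} (x : Fin n → G) (y : Fin n → E) (i : Fin n) :
    (chartAt (Fin n → E) x).symm y i = (chartAt E (x i)).symm (y i) := rfl

theorem pow_mem_target {n : ℕ} (x : Fin n → G) (y : Fin n → E) :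
    y ∈ (chartAt (Fin n → E) x).target ↔ ∀ i, y i ∈ (chartAt E (x i)).target := by
  change y ∈ Set.univ.pi _ ↔ _
  simp

theorem pow_isManifold [IsManifold 𝓘(ℝ, E) ∞ G] (n : ℕ) :
    IsManifold 𝓘(ℝ, Fin n → E) ∞ (Fin n → G) := by
  apply isManifold_of_contDiffOn
  rintro _ _ ⟨f, hf, rfl⟩ ⟨f', hf', rfl⟩
  rw [contDiffOn_pi]
  intro i
  have h := (contDiffGroupoid ∞ 𝓘(ℝ, E)).compatible (hf i (Set.mem_univ i))
    (hf' i (Set.mem_univ i))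
  rw [contDiffGroupoid, mem_groupoid_of_pregroupoid] at h
  have h1 : ContDiffOn ℝ ∞ ((f i).symm ≫ₕ f' i) ((f i).symm ≫ₕ f' i).source := by
    simpa [contDiffPregroupoid] using h.1
  refine h1.comp (t := ((f i).symm ≫ₕ f' i).source)
    ((contDiff_apply ℝ E i).contDiffOn) (fun y hy => ?_)
  have hy' := hy.1
  have h2 := hy'.1 i (Set.mem_univ i)
  have h3 := hy'.2 i (Set.mem_univ i)
  exact ⟨h2, h3⟩

theorem contMDiff_pow_apply [IsManifold 𝓘(ℝ, E) ∞ G] {n : ℕ} (i : Fin n) :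
    ContMDiff 𝓘(ℝ, Fin n → E) 𝓘(ℝ, E) ∞ (fun x : Fin n → G => x i) := by
  intro x
  rw [contMDiffAt_iff]
  refine ⟨(continuous_apply i).continuousAt, ?_⟩
  have h : ContDiffWithinAt ℝ ∞ (fun y : Fin n → E => y i) (Set.range 𝓘(ℝ, Fin n → E))
      (extChartAt 𝓘(ℝ, Fin n → E) x x) := (contDiff_apply ℝ E i).contDiffWithinAt
  have hm := extChartAt_target_mem_nhdsWithin (I := 𝓘(ℝ, Fin n → E)) x
  refine h.congr_of_eventuallyEq ?_ ?_
  · filter_upwards [hm] with y hy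
    have hy' : y ∈ (chartAt (Fin n → E) x).target := by simpa using hy
    rw [pow_mem_target] at hy'
    exact (chartAt E (x i)).right_inv (hy' i)
  · have hy' : chartAt (Fin n → E) x x ∈ (chartAt (Fin n → E) x).target :=
      mem_chart_target _ x
    rw [pow_mem_target] at hy'
    exact (chartAt E (x i)).right_inv (hy' i)

theorem contMDiff_pow_iff {E' : Type*} [NormedAddCommGroup E'] [NormedSpace ℝ E']
    {M : Type*} [TopologicalSpace M] [ChartedSpace E' M] [IsManifold 𝓘(ℝ, E) ∞ G] {n : ℕ}
    (f : M → Fin n → G) (h : ∀ i, ContMDiff 𝓘(ℝ, E') 𝓘(ℝ, E) ∞ (fun x => f x i)) :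
    ContMDiff 𝓘(ℝ, E') 𝓘(ℝ, Fin n → E) ∞ f := by
  intro x
  rw [contMDiffAt_iff]
  refine ⟨continuousAt_pi.2 fun i => (h i x).continuousAt, ?_⟩
  rw [contDiffWithinAt_pi]
  exact fun i => (contMDiffAt_iff.1 (h i x)).2

end Powers

/-! ## The nerve of a Lie group -/

section Nerve

variable {G : Type u} [Group G]

/-- `d_i (g_1, …, g_{n+1})`: the product `g_i g_{i+1}` is formed for `0 < i < n + 1`, and the
first (last) entry is dropped for `i = 0` (for `i = n + 1`). -/
def nerveFace (G : Type u) [Group G] (n : ℕ) (i : Fin (n + 2)) (g : Fin (n + 1) → G) :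
    Fin n → G := fun k =>
  if (k : ℕ) + 1 < i then g k.castSucc
  else if (k : ℕ) + 1 = i then g k.castSucc * g k.succ
  else g k.succ

/-- `s_i (g_1, …, g_n) = (g_1, …, g_i, 1, g_{i+1}, …, g_n)`. -/
def nerveDegen (G : Type u) [Group G] (n : ℕ) (i : Fin (n + 1)) (g : Fin n → G) :
    Fin (n + 1) → G := fun k =>
  if h : (k : ℕ) < i then g ⟨k, by omega⟩
  else if h' : (k : ℕ) = i then 1
  else g ⟨k - 1, by omega⟩

theorem nerve_face_face (l : ℕ) (i j : Fin (l + 2)) (x : Fin (l + 2) → G) (hij : i ≤ j) :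
    nerveFace G l i (nerveFace G (l + 1) j.succ x) =
      nerveFace G l j (nerveFace G (l + 1) i.castSucc x) := by
  have hij' : (i : ℕ) ≤ j := hij
  funext k
  simp only [nerveFace, Fin.val_succ, Fin.val_castSucc, Fin.succ_castSucc]
  split_ifs <;> first | rfl | omega | simp only [mul_assoc]

theorem nerve_degen_degen (l : ℕ) (i j : Fin (l + 1)) (x : Fin l → G) (hij : i ≤ j) :
    nerveDegen G (l + 1) i.castSucc (nerveDegen G l j x) =
      nerveDegen G (l + 1) j.succ (nerveDegen G l i x) := by
  have hij' : (i : ℕ) ≤ j := hij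
  funext k
  simp only [nerveDegen, Fin.val_succ, Fin.val_castSucc]
  split_ifs <;> first | omega | with_reducible rfl

theorem nerve_face_degen_of_le (l : ℕ) (i : Fin (l + 2)) (j : Fin (l + 1)) (x : Fin (l + 1) → G)
    (hij : i ≤ j.castSucc) : nerveFace G (l + 1) i.castSucc (nerveDegen G (l + 1) j.succ x) =
      nerveDegen G l j (nerveFace G l i x) := by
  have hij' : (i : ℕ) ≤ j := hij
  funext k
  simp only [nerveFace, nerveDegen, Fin.val_succ, Fin.val_castSucc]
  split_ifs <;> first | omega | with_reducible rfl | simp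
  all_goals refine congrArg x (Fin.ext ?_)
  all_goals change (k : ℕ) = k - 1 + 1
  all_goals omega

theorem nerve_face_degen_castSucc (l : ℕ) (j : Fin (l + 1)) (x : Fin l → G) :
    nerveFace G l j.castSucc (nerveDegen G l j x) = x := by
  funext k
  simp only [nerveFace, nerveDegen, Fin.val_succ, Fin.val_castSucc]
  split_ifs <;> first | omega | simp

theorem nerve_face_degen_succ (l : ℕ) (j : Fin (l + 1)) (x : Fin l → G) :
    nerveFace G l j.succ (nerveDegen G l j x) = x := by
  funext k
  simp only [nerveFace, nerveDegen, Fin.val_succ, Fin.val_castSucc]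
  split_ifs <;> first | omega | simp

theorem nerve_face_degen_of_gt (l : ℕ) (i : Fin (l + 2)) (j : Fin (l + 1)) (x : Fin (l + 1) → G)
    (hij : j.castSucc < i) : nerveFace G (l + 1) i.succ (nerveDegen G (l + 1) j.castSucc x) =
      nerveDegen G l j (nerveFace G l i x) := by
  have hij' : (j : ℕ) < i := hij
  funext k
  simp only [nerveFace, nerveDegen, Fin.val_succ, Fin.val_castSucc]
  split_ifs <;> first | omega | with_reducible rfl | simp
  all_goals refine congrArg x (Fin.ext ?_)
  all_goals change (k : ℕ) = k - 1 + 1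
  all_goals omega

/-- The nerve `NG` of a Lie group `G`, with `NG_n = G^n`. -/
def nerve (E : Type v) [NormedAddCommGroup E] [NormedSpace ℝ E] [CompleteSpace E]
    (G : Type u) [TopologicalSpace G] [ChartedSpace E G] [Group G] [LieGroup 𝓘(ℝ, E) ∞ G] :
    SimplicialManifold.{u, v} where
  E n := Fin n → E
  X n := Fin n → G
  chartedSpace n := powChartedSpace E G n
  isManifold n := pow_isManifold n
  face := nerveFace G
  degen := nerveDegen G
  contMDiff_face n i := by
    let _ := powChartedSpace E G n
    let _ := powChartedSpace E G (n + 1)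
    refine contMDiff_pow_iff _ fun k => ?_
    unfold nerveFace
    split_ifs
    · exact contMDiff_pow_apply _
    · exact (contMDiff_pow_apply _).mul (contMDiff_pow_apply _)
    · exact contMDiff_pow_apply _
  contMDiff_degen n i := by
    let _ := powChartedSpace E G n
    let _ := powChartedSpace E G (n + 1)
    refine contMDiff_pow_iff _ fun k => ?_
    unfold nerveDegen
    split_ifs
    · exact contMDiff_pow_apply _
    · exact contMDiff_const
    · exact contMDiff_pow_apply _
  face_face := nerve_face_face
  degen_degen := nerve_degen_degen
  face_degen_of_le := nerve_face_degen_of_le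
  face_degen_castSucc := nerve_face_degen_castSucc
  face_degen_succ := nerve_face_degen_succ
  face_degen_of_gt := nerve_face_degen_of_gt

end Nerve

/-! ## Quadratic Lie algebras and forms on Lie groups -/

/-- `(L, B)` is a quadratic Lie algebra. -/
structure IsQuadratic {L : Type*} [LieRing L] [LieAlgebra ℝ L] (B : LinearMap.BilinForm ℝ L) :
    Prop where
  symm : ∀ a b : L, B a b = B b a
  nondegenerate : B.Nondegenerate
  invariant : ∀ a b c : L, B ⁅a, b⁆ c + B b ⁅a, c⁆ = 0

section LieGroupForms

variable {E : Type v} [NormedAddCommGroup E] [NormedSpace ℝ E]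
  {G : Type u} [TopologicalSpace G] [ChartedSpace E G] [Group G]

/-- With this instance, Mathlib provides the Lie algebra structure of `GroupLieAlgebra`. -/
instance lieGroup_minSmoothness [LieGroup 𝓘(ℝ, E) ∞ G] :
    LieGroup 𝓘(ℝ, E) (minSmoothness ℝ 3) G :=
  LieGroup.of_le (n := ∞) (by rw [minSmoothness_of_isRCLikeNormedField]; exact ENat.LEInfty.out)

/-- The left Maurer-Cartan form `θ^l`, at `g` the differential of `h ↦ g⁻¹ h`. -/
def leftMC (E : Type v) [NormedAddCommGroup E] [NormedSpace ℝ E]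
    {G : Type u} [TopologicalSpace G] [ChartedSpace E G] [Group G] (g : G) :
    TangentSpace 𝓘(ℝ, E) g →L[ℝ] GroupLieAlgebra 𝓘(ℝ, E) G :=
  (mfderiv 𝓘(ℝ, E) 𝓘(ℝ, E) (fun h : G => g⁻¹ * h) g : E →L[ℝ] E)

/-- The right Maurer-Cartan form `θ^r`, at `g` the differential of `h ↦ h g⁻¹`. -/
def rightMC (E : Type v) [NormedAddCommGroup E] [NormedSpace ℝ E]
    {G : Type u} [TopologicalSpace G] [ChartedSpace E G] [Group G] (g : G) :
    TangentSpace 𝓘(ℝ, E) g →L[ℝ] GroupLieAlgebra 𝓘(ℝ, E) G :=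
  (mfderiv 𝓘(ℝ, E) 𝓘(ℝ, E) (fun h : G => h * g⁻¹) g : E →L[ℝ] E)

/-- The adjoint action of `g`, the differential of `h ↦ g h g⁻¹` at `1`. -/
def adjointAction (E : Type v) [NormedAddCommGroup E] [NormedSpace ℝ E]
    {G : Type u} [TopologicalSpace G] [ChartedSpace E G] [Group G] (g : G) :
    GroupLieAlgebra 𝓘(ℝ, E) G →L[ℝ] GroupLieAlgebra 𝓘(ℝ, E) G :=
  (mfderiv 𝓘(ℝ, E) 𝓘(ℝ, E) (fun h : G => g * h * g⁻¹) 1 : E →L[ℝ] E)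

variable [FiniteDimensional ℝ E]

instance (g : G) : FiniteDimensional ℝ (TangentSpace 𝓘(ℝ, E) g) :=
  inferInstanceAs (FiniteDimensional ℝ E)

theorem continuous_bilin {V W : Type*} [NormedAddCommGroup V] [NormedSpace ℝ V]
    [FiniteDimensional ℝ V] [NormedAddCommGroup W] [NormedSpace ℝ W]
    (B : V →ₗ[ℝ] V →ₗ[ℝ] W) : Continuous fun p : V × V => B p.1 p.2 := by
  have h : Continuous fun p : V × V =>
      LinearMap.toContinuousLinearMap (LinearMap.toContinuousLinearMap.toLinearMap ∘ₗ B) p.1 p.2 :=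
    by fun_prop
  exact h

/-- The bilinear map `(u_0, u_1) ↦ ⟨a u_0, b u_1⟩`. -/
def pairingMultilinear {V : Type*} [AddCommGroup V] [Module ℝ V] [TopologicalSpace V]
    (B : LinearMap.BilinForm ℝ (GroupLieAlgebra 𝓘(ℝ, E) G))
    (a b : V →L[ℝ] GroupLieAlgebra 𝓘(ℝ, E) G) :
    ContinuousMultilinearMap ℝ (fun _ : Fin 2 => V) ℝ where
  toFun u := B (a (u 0)) (b (u 1))
  map_update_add' u i x y := by
    fin_cases i <;> simp [Function.update]
  map_update_smul' u i c x := by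
    fin_cases i <;> simp [Function.update]
  cont := (continuous_bilin (V := E) B).comp
    (((a.continuous.comp (continuous_apply 0)).prodMk (b.continuous.comp (continuous_apply 1))))

variable [LieGroup 𝓘(ℝ, E) ∞ G]

/-- The trilinear map `(u_0, u_1, u_2) ↦ ⟨a u_0, [a u_1, a u_2]⟩`. -/
def pairingBracketMultilinear {V : Type*} [AddCommGroup V] [Module ℝ V] [TopologicalSpace V]
    (B : LinearMap.BilinForm ℝ (GroupLieAlgebra 𝓘(ℝ, E) G))
    (a : V →L[ℝ] GroupLieAlgebra 𝓘(ℝ, E) G) :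
    ContinuousMultilinearMap ℝ (fun _ : Fin 3 => V) ℝ where
  toFun u := B (a (u 0)) ⁅a (u 1), a (u 2)⁆
  map_update_add' u i x y := by
    have h20 : (2 : Fin 3) ≠ 0 := by omega
    have h21 : (2 : Fin 3) ≠ 1 := by omega
    obtain rfl | rfl | rfl : i = 0 ∨ i = 1 ∨ i = 2 := by omega
    all_goals simp [h20, h20.symm, h21, h21.symm]
  map_update_smul' u i c x := by
    have h20 : (2 : Fin 3) ≠ 0 := by omega
    have h21 : (2 : Fin 3) ≠ 1 := by omega
    obtain rfl | rfl | rfl : i = 0 ∨ i = 1 ∨ i = 2 := by omega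
    all_goals simp [h20, h20.symm, h21, h21.symm]
  cont := by
    let br : GroupLieAlgebra 𝓘(ℝ, E) G →ₗ[ℝ] GroupLieAlgebra 𝓘(ℝ, E) G →ₗ[ℝ]
        GroupLieAlgebra 𝓘(ℝ, E) G :=
      LinearMap.mk₂ ℝ (fun a b => ⁅a, b⁆) add_lie smul_lie lie_add (fun c a b => lie_smul c a b)
    have h : Continuous fun p : E × E => (br p.1 p.2 : E) :=
      continuous_bilin (V := E) (W := E) br
    exact (continuous_bilin (V := E) B).comp
      ((a.continuous.comp (continuous_apply 0)).prodMk (h.comp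
        ((a.continuous.comp (continuous_apply 1)).prodMk
          (a.continuous.comp (continuous_apply 2)))))

/-- The Cartan `3`-form `Θ = 1/6 ⟨θ^l, [θ^l, θ^l]⟩` on `G`. As
`[θ^l, θ^l](v, w) = 2 [θ^l v, θ^l w]`, the `3`-form `⟨θ^l, [θ^l, θ^l]⟩` is the alternating sum of
`⟨θ^l u, [θ^l v, θ^l w]⟩` over all permutations of `(u, v, w)`. -/
def cartanForm (B : LinearMap.BilinForm ℝ (GroupLieAlgebra 𝓘(ℝ, E) G)) : DForm E G 3 := fun g =>
  (1 / 6 : ℝ) • (pairingBracketMultilinear B (leftMC E g)).alternatization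

/-- The Cartan form as a `3`-form `Θ` on `NG_1 = G^1`. -/
def nerveCartanForm (B : LinearMap.BilinForm ℝ (GroupLieAlgebra 𝓘(ℝ, E) G)) :
    DForm ((nerve E G).E 1) ((nerve E G).X 1) 3 :=
  DForm.pullback (fun x : (nerve E G).X 1 => (x : Fin 1 → G) 0) (cartanForm B)

/-- The pullback to `NG_2` of a `1`-form on `G = NG_1` with values in the Lie algebra
under the face `d_i`. -/
def pullbackFace (θ : ∀ g : G, TangentSpace 𝓘(ℝ, E) g →L[ℝ] GroupLieAlgebra 𝓘(ℝ, E) G)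
    (i : Fin 3) (x : (nerve E G).X 2) :
    TangentSpace 𝓘(ℝ, (nerve E G).E 2) x →L[ℝ] GroupLieAlgebra 𝓘(ℝ, E) G :=
  (θ (nerveFace G 1 i x 0)).comp
    (mfderiv 𝓘(ℝ, (nerve E G).E 2) 𝓘(ℝ, E)
      (fun y : (nerve E G).X 2 => nerveFace G 1 i y 0) x)

/-- The Brylinski-Weinstein `2`-form `Ω = ⟨d_2^* θ^l, d_0^* θ^r⟩` on `NG_2 = G × G`, that is,
`Ω(v, w) = ⟨d_2^* θ^l v, d_0^* θ^r w⟩ - ⟨d_2^* θ^l w, d_0^* θ^r v⟩`. -/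
def brylinskiWeinsteinForm (B : LinearMap.BilinForm ℝ (GroupLieAlgebra 𝓘(ℝ, E) G)) :
    DForm ((nerve E G).E 2) ((nerve E G).X 2) 2 := fun x =>
  (pairingMultilinear B (pullbackFace (leftMC E) 2 x)
    (pullbackFace (rightMC E) 0 x)).alternatization

/-- The identification of the tangent space of `NG_1 = G^1` at the point of `NG_0` with the Lie
algebra of `G`: the differential of `G^1 → G`. -/
def nerveTangent (E : Type v) [NormedAddCommGroup E] [NormedSpace ℝ E] [FiniteDimensional ℝ E]
    (G : Type u) [TopologicalSpace G] [ChartedSpace E G] [Group G] [LieGroup 𝓘(ℝ, E) ∞ G]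
    (pt : (nerve E G).X 0) : (nerve E G).E 1 →L[ℝ] GroupLieAlgebra 𝓘(ℝ, E) G :=
  (mfderiv 𝓘(ℝ, (nerve E G).E 1) 𝓘(ℝ, E) (fun x : (nerve E G).X 1 => (x : Fin 1 → G) 0)
    ((nerve E G).base 1 pt) : (nerve E G).E 1 →L[ℝ] E)

/-- `Ω_• = Ω - Θ + 0`. -/
def nerveForm (B : LinearMap.BilinForm ℝ (GroupLieAlgebra 𝓘(ℝ, E) G)) : (nerve E G).Cochain
  | 2, 2 => brylinskiWeinsteinForm B
  | 1, 3 => -nerveCartanForm B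
  | _, _ => 0

end LieGroupForms

end

/-! Write `θ^l_f`, `θ^r_f` for the pullbacks of the Maurer–Cartan forms along a map `f` into `G`. In
coordinates, `Ω = ⟨θ^l_{g₁}, θ^r_{g₂}⟩`, and `D Ω_• = 0` amounts to `δΩ = 0`, `dΩ = δΘ` and `dΘ =
0`. The product rules `θ^l_{fh} = Ad_{h⁻¹}(θ^l_f + θ^r_h)` and `θ^r_{fh} = θ^r_f + Ad_f θ^r_h`
(`thetaLeft_mul`, `thetaRight_mul_apply`) together with `Ad`-invariance of the pairing turn `δΩ = 0`
into a cancellation of bilinear terms. The other two relations need the Maurer–Cartan equations, the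
cyclicity of `⟨x, [y, z]⟩` and, for `dΘ = 0`, the Jacobi identity (`d_brylinskiWeinsteinForm`,
`d_triple_eq_zero`).

The Maurer–Cartan equations are second-order calculus in the chart at `1`. There the bracket is the
antisymmetrized mixed second derivative of the multiplication `μ` (`bracket_eq_mixedDeriv`). For `ψ
: V → G`, the form `ψ^*θ^l` at `x` is the derivative in `z`, at `z = x`, of `ψ(x)⁻¹ψ(z) =
(ψ(x)⁻¹ψ(y)) (ψ(y)⁻¹ψ(z))`. Near `y` this has the shape `μ(p x, q z)`, and differentiating once more
at `y` leaves only the mixed derivative of `μ` after antisymmetrization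
(`fderiv_diagonal_antisymm`). The same calculus applied to conjugation identifies the derivative of
`Ad` at `1` with the bracket (`hasFDerivAt_modelAd`), so that on a connected group `ad`-invariance
integrates to `Ad`-invariance.

For the horn conditions in dimension at least two, every horn contains a pair of faces (the first
two, the last two, or the first and the last) which determines a point of `G^n` through smooth
formulas. The remaining faces of the resulting filler are correct because two of their own faces
are. The horn space then inherits its manifold structure from `G^n`.

Finally, `Td_0` and `Td_1` have no common kernel in levels at least two, and `NG_0` is a point, so
the tangent complex is `𝔤` in degree one. The two `(1,1)`-shuffles contribute `⟨v, w⟩` each, and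
`2⟨·,·⟩` is non-degenerate. -/

noncomputable section

open Set Filter

/-! ### Second-order calculus of a multiplication with unit -/

section LocalCalculus

variable {E : Type*} [NormedAddCommGroup E] [NormedSpace ℝ E]
  {V : Type*} [NormedAddCommGroup V] [NormedSpace ℝ V]

/-- The mixed second derivative of `μ : E × E → E` at `(e, e)`. -/
def mixedDeriv (μ : E × E → E) (e : E) (v w : E) : E :=
  fderiv ℝ (fderiv ℝ μ) (e, e) (v, 0) (0, w)

theorem fderiv_fderiv_symm {μ : V → E} {e : V} (hμ : ContDiffAt ℝ ∞ μ e) (v w : V) :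
    fderiv ℝ (fderiv ℝ μ) e v w = fderiv ℝ (fderiv ℝ μ) e w v :=
  (hμ.isSymmSndFDerivAt (by simpa using ENat.LEInfty.out)).eq v w

/-- If `Λ x = D₂μ(p x, q x) ∘ Dq x` with `p y = q y = e` and `Dp y = - Dq y`, then the
antisymmetric part of the derivative of `Λ` at `y` is minus that of the mixed derivative
of `μ`. -/
theorem fderiv_maurerCartan {μ : E × E → E} {e : E} {p q : V → E} {y : V}
    (hμ : ContDiffAt ℝ ∞ μ (e, e)) (hp : ContDiffAt ℝ ∞ p y) (hq : ContDiffAt ℝ ∞ q y)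
    (hpy : p y = e) (hqy : q y = e) (hpq : fderiv ℝ p y = - fderiv ℝ q y) (u w : V) :
    let Λ : V → V →L[ℝ] E := fun x =>
      (fderiv ℝ μ (p x, q x)).comp ((ContinuousLinearMap.inr ℝ E E).comp (fderiv ℝ q x))
    fderiv ℝ Λ y u w - fderiv ℝ Λ y w u =
      mixedDeriv μ e (fderiv ℝ q y w) (fderiv ℝ q y u)
        - mixedDeriv μ e (fderiv ℝ q y u) (fderiv ℝ q y w) := by
  intro Λ
  have hp1 : HasFDerivAt p (fderiv ℝ p y) y := (hp.differentiableAt (by simp)).hasFDerivAt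
  have hq1 : HasFDerivAt q (fderiv ℝ q y) y := (hq.differentiableAt (by simp)).hasFDerivAt
  have hq2 : HasFDerivAt (fderiv ℝ q) (fderiv ℝ (fderiv ℝ q) y) y :=
    ((hq.fderiv_right (m := ∞) (by simp)).differentiableAt (by simp)).hasFDerivAt
  have hμ2 : HasFDerivAt (fderiv ℝ μ) (fderiv ℝ (fderiv ℝ μ) (e, e)) (p y, q y) := by
    rw [hpy, hqy]
    exact ((hμ.fderiv_right (m := ∞) (by simp)).differentiableAt (by simp)).hasFDerivAt
  have h1 := hμ2.comp y (hp1.prodMk hq1)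
  have h2 := (hasFDerivAt_const (ContinuousLinearMap.inr ℝ E E) y).clm_comp hq2
  have hΛ : ∀ a b, fderiv ℝ Λ y a b =
      fderiv ℝ (fderiv ℝ μ) (e, e) (-fderiv ℝ q y a, fderiv ℝ q y a) (0, fderiv ℝ q y b) +
      fderiv ℝ μ (e, e) (0, fderiv ℝ (fderiv ℝ q) y a b) := by
    intro a b
    rw [HasFDerivAt.fderiv (f := Λ) (h1.clm_comp h2)]
    simp [hpy, hqy, hpq]
    abel
  -- Splitting `(-a, a)` isolates the mixed derivative. The pure second-variable part is symmetric
  -- in `a` and `b`, as is the second derivative of `q`, so both disappear on antisymmetrizing.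
  have hs : ∀ a b : E, fderiv ℝ (fderiv ℝ μ) (e, e) (-a, a) (0, b) =
      - mixedDeriv μ e a b + fderiv ℝ (fderiv ℝ μ) (e, e) (0, a) (0, b) := by
    intro a b
    have : ((-a, a) : E × E) = -(a, 0) + (0, a) := by simp
    rw [this, map_add, map_neg]
    rfl
  rw [hΛ, hΛ, fderiv_fderiv_symm hq w u, hs, hs, fderiv_fderiv_symm hμ (0, fderiv ℝ q y w)]
  abel

/-- Passing to the opposite multiplication exchanges the arguments, hence reverses the bracket. This
accounts for the opposite signs in the equations for `θ^l` and `θ^r`. -/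
theorem mixedDeriv_swap {μ : E × E → E} {e : E} (hμ : ContDiffAt ℝ ∞ μ (e, e)) (v w : E) :
    mixedDeriv (fun p => μ (p.2, p.1)) e v w = mixedDeriv μ e w v := by
  let s : (E × E) ≃L[ℝ] (E × E) := ContinuousLinearEquiv.prodComm ℝ E E
  have h1 : fderiv ℝ (fun p : E × E => μ (p.2, p.1)) =
      fun p => (fderiv ℝ μ (s p)).comp (s : (E × E) →L[ℝ] (E × E)) := by
    funext p
    exact s.comp_right_fderiv (f := μ) (x := p)
  have h2 : HasFDerivAt (fderiv ℝ μ) (fderiv ℝ (fderiv ℝ μ) (e, e)) (s (e, e)) :=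
    ((hμ.fderiv_right (m := ∞) (by simp)).differentiableAt (by simp)).hasFDerivAt
  have h3 := (h2.comp (e, e) s.hasFDerivAt).clm_comp
    (hasFDerivAt_const (s : (E × E) →L[ℝ] (E × E)) (e, e))
  unfold mixedDeriv
  rw [h1, HasFDerivAt.fderiv (f := fun p => (fderiv ℝ μ (s p)).comp _) h3, fderiv_fderiv_symm hμ]
  simp [s]

/-- If `μ(c(x, z), x) = μ(x, z)` near `(e, e)`, the derivative at `e` of `x ↦ D₂c(x, e)` is the
antisymmetric part of the mixed derivative of `μ`. -/
theorem fderiv_conj {μ c : E × E → E} {e : E}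
    (hμ : ContDiffAt ℝ ∞ μ (e, e)) (hc : ContDiffAt ℝ ∞ c (e, e))
    (hμe : ∀ᶠ x in 𝓝 e, μ (x, e) = x)
    (hce : ∀ᶠ x in 𝓝 e, c (x, e) = e) (hec : ∀ᶠ x in 𝓝 e, c (e, x) = x)
    (hcμ : ∀ᶠ p in 𝓝 (e, e), μ (c p, p.1) = μ p) (v w : E) :
    fderiv ℝ (fun x => (fderiv ℝ c (x, e)).comp (ContinuousLinearMap.inr ℝ E E)) e v w =
      mixedDeriv μ e v w - mixedDeriv μ e w v := by
  have hce0 : c (e, e) = e := hce.self_of_nhds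
  set A : E → E →L[ℝ] E := fun x => (fderiv ℝ c (x, e)).comp (ContinuousLinearMap.inr ℝ E E)
    with hA
  have hxe : ContinuousAt (fun x : E => (x, e)) e := by fun_prop
  have hex : ContinuousAt (fun x : E => (e, x)) e := by fun_prop
  have hμd : ∀ᶠ p in 𝓝 (e, e), DifferentiableAt ℝ μ p := by
    filter_upwards [(hμ.of_le (m := 1) (by simp)).eventually (by simp)] with p hp using
      hp.differentiableAt (by simp)
  have hcd : ∀ᶠ p in 𝓝 (e, e), DifferentiableAt ℝ c p := by
    filter_upwards [(hc.of_le (m := 1) (by simp)).eventually (by simp)] with p hp using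
      hp.differentiableAt (by simp)
  -- Differentiate `μ(c(x, z), x) = μ(x, z)` in `z` at `z = e`.
  have key : ∀ᶠ x in 𝓝 e, (fderiv ℝ μ (e, x)).comp
      ((ContinuousLinearMap.inl ℝ E E).comp (A x)) =
      (fderiv ℝ μ (x, e)).comp (ContinuousLinearMap.inr ℝ E E) := by
    filter_upwards [hxe.eventually hμd, hex.eventually hμd, hxe.eventually hcd, hce,
      hxe.eventually hcμ.eventually_nhds] with x h1 h2 h3 h4 h5
    have hz : HasFDerivAt (fun z : E => (x, z)) (ContinuousLinearMap.inr ℝ E E) e :=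
      hasFDerivAt_prodMk_right x e
    have hcz := HasFDerivAt.comp e h3.hasFDerivAt hz
    have h2' : HasFDerivAt μ (fderiv ℝ μ (e, x)) (c (x, e), x) := by
      rw [h4]; exact h2.hasFDerivAt
    have hl := HasFDerivAt.comp e h2' (hcz.prodMk (hasFDerivAt_const x e))
    have hr := HasFDerivAt.comp e h1.hasFDerivAt hz
    have heq : (μ ∘ fun z => (x, z)) =ᶠ[𝓝 e]
        (μ ∘ fun z => ((c ∘ fun z => (x, z)) z, x)) := by
      have hc' : ContinuousAt (fun z : E => (x, z)) e := by fun_prop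
      filter_upwards [hc'.eventually h5] with z hz using hz.symm
    have := hl.unique (hr.congr_of_eventuallyEq heq.symm)
    rw [← this]
    ext a
    simp [hA]
  have hA1 : HasFDerivAt A (fderiv ℝ A e) e := by
    refine DifferentiableAt.hasFDerivAt ?_
    have h1 : DifferentiableAt ℝ (fderiv ℝ c) (e, e) :=
      (hc.fderiv_right (m := ∞) (by simp)).differentiableAt (by simp)
    have h2 : DifferentiableAt ℝ (fun x => fderiv ℝ c (x, e)) e :=
      DifferentiableAt.comp e h1 (by fun_prop)
    exact h2.clm_comp (differentiableAt_const _)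
  have hμ2 : HasFDerivAt (fderiv ℝ μ) (fderiv ℝ (fderiv ℝ μ) (e, e)) (e, e) :=
    ((hμ.fderiv_right (m := ∞) (by simp)).differentiableAt (by simp)).hasFDerivAt
  have hl := (HasFDerivAt.comp e hμ2 (hasFDerivAt_prodMk_right e e)).clm_comp
    ((hasFDerivAt_const (ContinuousLinearMap.inl ℝ E E) e).clm_comp hA1)
  have hr := (HasFDerivAt.comp (f := fun x : E => (x, e)) e hμ2
    (hasFDerivAt_prodMk_left e e)).clm_comp
    (hasFDerivAt_const (ContinuousLinearMap.inr ℝ E E) e)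
  -- Now differentiate in `x` at `e`. Since `D₁μ(e, e)` and `A e` are identities, the left side
  -- yields `DA` plus one mixed derivative and the right side yields the other.
  have h := hl.unique (hr.congr_of_eventuallyEq key)
  have hμl : (fderiv ℝ μ (e, e)).comp (ContinuousLinearMap.inl ℝ E E) =
      ContinuousLinearMap.id ℝ E := by
    have h1 := HasFDerivAt.comp (f := fun x : E => (x, e)) e
      (hμ.differentiableAt (by simp)).hasFDerivAt
      (hasFDerivAt_prodMk_left (𝕜 := ℝ) e e)
    exact h1.unique ((hasFDerivAt_id e).congr_of_eventuallyEq hμe)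
  have hAe : A e = ContinuousLinearMap.id ℝ E := by
    have h1 := HasFDerivAt.comp (f := fun x : E => (e, x)) e (hc.differentiableAt
      (by simp)).hasFDerivAt (hasFDerivAt_prodMk_right (𝕜 := ℝ) e e)
    exact h1.unique ((hasFDerivAt_id e).congr_of_eventuallyEq hec)
  have := DFunLike.congr_fun (DFunLike.congr_fun h v) w
  have hμl' : ∀ a, fderiv ℝ μ (e, e) (a, 0) = a := fun a => DFunLike.congr_fun hμl a
  simp [hAe, hμl'] at this
  rw [mixedDeriv, mixedDeriv, fderiv_fderiv_symm hμ (w, 0), ← this]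
  abel

end LocalCalculus

/-! ### Differentials read in preferred charts -/

section TangentMaps

variable {E₁ E₂ E₃ : Type*} [NormedAddCommGroup E₁] [NormedSpace ℝ E₁]
  [NormedAddCommGroup E₂] [NormedSpace ℝ E₂] [NormedAddCommGroup E₃] [NormedSpace ℝ E₃]
  {M₁ M₂ M₃ : Type*} [TopologicalSpace M₁] [ChartedSpace E₁ M₁]
  [TopologicalSpace M₂] [ChartedSpace E₂ M₂] [TopologicalSpace M₃] [ChartedSpace E₃ M₃]

/-- `f` maps `x` to `y` and its derivative at `x` is `L`, where tangent spaces are identified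
with the model spaces through the preferred charts at `x` and `y`. -/
def HasTangentMap (f : M₁ → M₂) (x : M₁) (y : M₂) (L : E₁ →L[ℝ] E₂) : Prop :=
  f x = y ∧ HasMFDerivAt 𝓘(ℝ, E₁) 𝓘(ℝ, E₂) f x L

namespace HasTangentMap

theorem comp {f : M₁ → M₂} {g : M₂ → M₃} {x : M₁} {y : M₂} {z : M₃} {L : E₁ →L[ℝ] E₂}
    {L' : E₂ →L[ℝ] E₃} (hg : HasTangentMap g y z L') (hf : HasTangentMap f x y L) :
    HasTangentMap (fun x => g (f x)) x z (L'.comp L) := by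
  obtain ⟨rfl, hf⟩ := hf
  exact ⟨hg.1, hg.2.comp x hf⟩

theorem comp_zero {f : M₁ → M₂} {g : M₂ → M₃} {x : M₁} {y : M₂} {z : M₃} {L : E₁ →L[ℝ] E₂}
    (hg : HasTangentMap g y z (0 : E₂ →L[ℝ] E₃)) (hf : HasTangentMap f x y L) :
    HasTangentMap (fun x => g (f x)) x z (0 : E₁ →L[ℝ] E₃) := by
  have h := hg.comp hf
  rwa [ContinuousLinearMap.zero_comp] at h

/-- This is the main tool for identities between differentials: two factorizations of one map are
differentiated separately and compared. The images `y` and `y'` may be written differently. -/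
theorem unique {f : M₁ → M₂} {x : M₁} {y y' : M₂} {L L' : E₁ →L[ℝ] E₂}
    (h : HasTangentMap f x y L) (h' : HasTangentMap f x y' L') : L = L' :=
  hasMFDerivAt_unique h.2 h'.2

theorem congr {f g : M₁ → M₂} {x : M₁} {y : M₂} {L : E₁ →L[ℝ] E₂}
    (h : HasTangentMap f x y L) (hfg : g =ᶠ[𝓝 x] f) : HasTangentMap g x y L :=
  ⟨hfg.self_of_nhds.trans h.1, h.2.congr_of_eventuallyEq hfg⟩

theorem mfderiv {f : M₁ → M₂} {x : M₁} {y : M₂} {L : E₁ →L[ℝ] E₂}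
    (h : HasTangentMap f x y L) : (mfderiv 𝓘(ℝ, E₁) 𝓘(ℝ, E₂) f x : E₁ →L[ℝ] E₂) = L :=
  h.2.mfderiv

theorem id (x : M₁) : HasTangentMap (fun x : M₁ => x) x x (ContinuousLinearMap.id ℝ E₁) :=
  ⟨rfl, hasMFDerivAt_id x⟩

theorem const (x : M₁) (y : M₂) : HasTangentMap (fun _ : M₁ => y) x y (0 : E₁ →L[ℝ] E₂) :=
  ⟨rfl, hasMFDerivAt_const y x⟩

end HasTangentMap

theorem MDifferentiableAt.hasTangentMap {f : M₁ → M₂} {x : M₁} {y : M₂}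
    (h : MDifferentiableAt 𝓘(ℝ, E₁) 𝓘(ℝ, E₂) f x) (hy : f x = y) :
    HasTangentMap (E₁ := E₁) (E₂ := E₂) f x y (mfderiv 𝓘(ℝ, E₁) 𝓘(ℝ, E₂) f x) :=
  ⟨hy, h.hasMFDerivAt⟩

theorem HasFDerivAt.hasTangentMap {f : E₁ → E₂} {x : E₁} {y : E₂} {L : E₁ →L[ℝ] E₂}
    (h : HasFDerivAt f L x) (hy : f x = y) : HasTangentMap f x y L :=
  ⟨hy, h.hasMFDerivAt⟩

theorem HasTangentMap.hasFDerivAt {f : E₁ → E₂} {x : E₁} {y : E₂} {L : E₁ →L[ℝ] E₂}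
    (h : HasTangentMap f x y L) : HasFDerivAt f L x :=
  h.2.hasFDerivAt

theorem contDiffAt_chart_comp [IsManifold 𝓘(ℝ, E₂) ∞ M₂] {f : E₁ → M₂} {y : E₁} {g : M₂}
    (hf : ContMDiffAt 𝓘(ℝ, E₁) 𝓘(ℝ, E₂) ∞ f y) (hy : f y ∈ (chartAt E₂ g).source) :
    ContDiffAt ℝ ∞ (fun z => chartAt E₂ g (f z)) y := by
  rw [← contMDiffAt_iff_contDiffAt]
  exact ((contMDiffOn_chart (I := 𝓘(ℝ, E₂)) (n := ∞)).contMDiffAt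
    ((chartAt E₂ g).open_source.mem_nhds hy)).comp y hf

theorem contMDiffAt_chart_symm [IsManifold 𝓘(ℝ, E₂) ∞ M₂] (g : M₂) {y : E₂}
    (hy : y ∈ (chartAt E₂ g).target) :
    ContMDiffAt 𝓘(ℝ, E₂) 𝓘(ℝ, E₂) ∞ (chartAt E₂ g).symm y :=
  (contMDiffOn_chart_symm (I := 𝓘(ℝ, E₂)) (n := ∞)).contMDiffAt
    ((chartAt E₂ g).open_target.mem_nhds hy)

/-- The tangent space at `g` is by definition the model space seen through the chart at `g`, so this
chart has identity differential there, but in general not at other points. -/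
theorem hasTangentMap_chartAt [IsManifold 𝓘(ℝ, E₂) ∞ M₂] (g : M₂) :
    HasTangentMap (chartAt E₂ g) g (chartAt E₂ g g) (ContinuousLinearMap.id ℝ E₂) := by
  have : IsManifold 𝓘(ℝ, E₂) 1 M₂ := IsManifold.of_le (n := ∞) (by simp)
  refine ⟨rfl, ?_⟩
  have h := hasMFDerivAt_extChartAt (I := 𝓘(ℝ, E₂)) (mem_chart_source E₂ g)
  have h2 := hasMFDerivAt_unique h h.mdifferentiableAt.hasMFDerivAt
  rw [mfderiv_extChartAt_self] at h2
  exact h2 ▸ h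

theorem hasTangentMap_chartAt_symm [IsManifold 𝓘(ℝ, E₂) ∞ M₂] (g : M₂) :
    HasTangentMap (chartAt E₂ g).symm (chartAt E₂ g g) g (ContinuousLinearMap.id ℝ E₂) := by
  have h := ((contMDiffAt_chart_symm g (mem_chart_target E₂ g)).mdifferentiableAt
    (by simp)).hasTangentMap (y := g) (by simp)
  have h2 := (hasTangentMap_chartAt (E₂ := E₂) g).comp h
  have h3 : (fun z => chartAt E₂ g ((chartAt E₂ g).symm z)) =ᶠ[𝓝 (chartAt E₂ g g)]
      (fun z => z) := by
    filter_upwards [(chartAt E₂ g).open_target.mem_nhds (mem_chart_target E₂ g)] with z hz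
    exact (chartAt E₂ g).right_inv hz
  have h4 := ((HasTangentMap.id (chartAt E₂ g g)).congr h3).unique h2
  rw [h4]
  exact h

theorem HasTangentMap.hasFDerivAt_chart [IsManifold 𝓘(ℝ, E₂) ∞ M₂] {f : E₁ → M₂} {x : E₁} {y : M₂}
    {L : E₁ →L[ℝ] E₂} (h : HasTangentMap f x y L) :
    HasFDerivAt (fun z => chartAt E₂ y (f z)) L x :=
  ((hasTangentMap_chartAt y).comp h).hasFDerivAt

end TangentMaps

/-! ### The Lie bracket in the chart at the unit -/

section LocalGroup

variable {E : Type*} [NormedAddCommGroup E] [NormedSpace ℝ E]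
  {G : Type*} [TopologicalSpace G] [ChartedSpace E G] [Group G]
  {V : Type*} [NormedAddCommGroup V] [NormedSpace ℝ V]

/-- The multiplication in the chart at `1`. -/
def localMul (E : Type*) [NormedAddCommGroup E] [NormedSpace ℝ E]
    (G : Type*) [TopologicalSpace G] [ChartedSpace E G] [Group G] (p : E × E) : E :=
  chartAt E (1 : G) ((chartAt E (1 : G)).symm p.1 * (chartAt E (1 : G)).symm p.2)

/-- The unit in the chart at `1`. -/
abbrev chartOne (E : Type*) [NormedAddCommGroup E] [NormedSpace ℝ E]
    (G : Type*) [TopologicalSpace G] [ChartedSpace E G] [Group G] : E :=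
  chartAt E (1 : G) (1 : G)

theorem chartOne_symm : (chartAt E (1 : G)).symm (chartOne E G) = 1 := by simp

theorem localMul_chart {g h : G} (hg : g ∈ (chartAt E (1 : G)).source)
    (hh : h ∈ (chartAt E (1 : G)).source) :
    localMul E G (chartAt E (1 : G) g, chartAt E (1 : G) h) = chartAt E (1 : G) (g * h) := by
  simp [localMul, hg, hh]

theorem localMul_chartOne_right {x : E} (hx : x ∈ (chartAt E (1 : G)).target) :
    localMul E G (x, chartOne E G) = x := by
  simp [localMul, hx]

theorem localMul_chartOne_left {x : E} (hx : x ∈ (chartAt E (1 : G)).target) :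
    localMul E G (chartOne E G, x) = x := by
  simp [localMul, hx]

variable [LieGroup 𝓘(ℝ, E) ∞ G]

theorem contDiffAt_localMul_of_mem {x y : E} (hx : x ∈ (chartAt E (1 : G)).target)
    (hy : y ∈ (chartAt E (1 : G)).target)
    (hxy : (chartAt E (1 : G)).symm x * (chartAt E (1 : G)).symm y ∈ (chartAt E (1 : G)).source) :
    ContDiffAt ℝ ∞ (localMul E G) (x, y) :=
  contDiffAt_chart_comp (ContMDiffAt.mul (n := ∞) (I := 𝓘(ℝ, E))
    ((contMDiffAt_chart_symm (1 : G) hx).comp (x, y) contDiff_fst.contMDiff.contMDiffAt)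
    ((contMDiffAt_chart_symm (1 : G) hy).comp (x, y) contDiff_snd.contMDiff.contMDiffAt)) hxy

theorem contDiffAt_localMul : ContDiffAt ℝ ∞ (localMul E G) (chartOne E G, chartOne E G) :=
  contDiffAt_localMul_of_mem (mem_chart_target E _) (mem_chart_target E _) (by simp)

/-- Both sides differentiate `z ↦ g * z` in the chart at `1`: once directly, once through `localMul`
followed by the inverse chart. They agree as long as the product stays in the chart domain. -/
theorem mfderiv_mul_left_eq_localMul {x : E} (hx : x ∈ (chartAt E (1 : G)).target) (v : E) :
    (mfderiv 𝓘(ℝ, E) 𝓘(ℝ, E) ((chartAt E (1 : G)).symm x * ·) (1 : G) : E →L[ℝ] E) v =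
      (mfderiv 𝓘(ℝ, E) 𝓘(ℝ, E) (chartAt E (1 : G)).symm x : E →L[ℝ] E)
        (fderiv ℝ (localMul E G) (x, chartOne E G) (0, v)) := by
  set g := (chartAt E (1 : G)).symm x with hg
  have hgs : g ∈ (chartAt E (1 : G)).source := (chartAt E (1 : G)).map_target hx
  have h1 : HasTangentMap (E₁ := E) (E₂ := E) (g * ·) (1 : G) g _ :=
    ((contMDiff_mul_left (I := 𝓘(ℝ, E)) (n := ∞) (a := g)).mdifferentiable
      (by simp) 1).hasTangentMap (mul_one g)
  have h2 := h1.comp (hasTangentMap_chartAt_symm (1 : G))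
  have h3 : HasTangentMap (chartAt E (1 : G)).symm x g _ :=
    ((contMDiffAt_chart_symm (1 : G) hx).mdifferentiableAt (by simp)).hasTangentMap rfl
  have hμ := ((contDiffAt_localMul_of_mem (G := G) hx (mem_chart_target E _)
    (by simpa using hgs)).differentiableAt (by simp)).hasFDerivAt
  have h4 := (HasFDerivAt.comp (chartOne E G) hμ
    (hasFDerivAt_prodMk_right (𝕜 := ℝ) x _)).hasTangentMap (y := x) (localMul_chartOne_right hx)
  have h5 := h3.comp h4
  have h6 : (fun z : E => g * (chartAt E (1 : G)).symm z) =ᶠ[𝓝 (chartOne E G)]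
      (fun z => (chartAt E (1 : G)).symm ((localMul E G ∘ fun z => (x, z)) z)) := by
    have hc : ContinuousAt (fun z : E => g * (chartAt E (1 : G)).symm z) (chartOne E G) :=
      h2.2.continuousAt
    have := hc.preimage_mem_nhds ((chartAt E (1 : G)).open_source.mem_nhds (by simpa using hgs))
    filter_upwards [this] with z hz
    exact ((chartAt E (1 : G)).left_inv hz).symm
  have h7 := (h5.congr h6).unique h2
  have h8 := DFunLike.congr_fun h7 v
  exact h8.symm

open VectorField

/-- The differential of the inverse chart is invertible on the target, so it can be cancelled from
the formula for left translation. -/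
theorem mpullback_mulInvariantVectorField_chart {x : E} (hx : x ∈ (chartAt E (1 : G)).target)
    (v : E) :
    (mpullbackWithin 𝓘(ℝ, E) 𝓘(ℝ, E) (extChartAt 𝓘(ℝ, E) (1 : G)).symm
      (mulInvariantVectorField (v : GroupLieAlgebra 𝓘(ℝ, E) G)) (range 𝓘(ℝ, E)) x : E) =
      fderiv ℝ (localMul E G) (x, chartOne E G) (0, v) := by
  have : IsManifold 𝓘(ℝ, E) 1 G := IsManifold.of_le (n := ∞) (by simp)
  have hinv := isInvertible_mfderivWithin_extChartAt_symm (I := 𝓘(ℝ, E)) (x := (1 : G)) (y := x)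
    (by simpa using hx)
  have h := mfderiv_mul_left_eq_localMul (G := G) hx v
  have hS : (mfderivWithin 𝓘(ℝ, E) 𝓘(ℝ, E) (extChartAt 𝓘(ℝ, E) (1 : G)).symm (range 𝓘(ℝ, E)) x :
      E →L[ℝ] E) = mfderiv 𝓘(ℝ, E) 𝓘(ℝ, E) (chartAt E (1 : G)).symm x := by
    simp
    rfl
  obtain ⟨S, hS'⟩ := hinv
  rw [mpullbackWithin, ← hS', ContinuousLinearMap.inverse_equiv]
  rw [← hS, ← hS'] at h
  exact (S.symm_apply_eq).2 h

/-- In the chart, the left-invariant field of `v` is `X_v(x) = D₂μ(x, e) v`. It satisfies `X_v(e) =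
v` and `DX_v(e) w = D₁D₂μ(w, v)`, and `[X_v, X_w](e) = DX_w(e) v - DX_v(e) w`. -/
theorem bracket_eq_mixedDeriv [CompleteSpace E] (v w : GroupLieAlgebra 𝓘(ℝ, E) G) :
    (⁅v, w⁆ : GroupLieAlgebra 𝓘(ℝ, E) G) =
      (mixedDeriv (localMul E G) (chartOne E G) v w - mixedDeriv (localMul E G) (chartOne E G) w v
        : E) := by
  have : IsManifold 𝓘(ℝ, E) 1 G := IsManifold.of_le (n := ∞) (by simp)
  have hV : ∀ v : E, (fun x => (mpullbackWithin 𝓘(ℝ, E) 𝓘(ℝ, E) (extChartAt 𝓘(ℝ, E) (1 : G)).symm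
      (mulInvariantVectorField (v : GroupLieAlgebra 𝓘(ℝ, E) G)) (range 𝓘(ℝ, E)) x : E))
      =ᶠ[𝓝 (chartOne E G)] fun x => fderiv ℝ (localMul E G) (x, chartOne E G) (0, v) := by
    intro v
    filter_upwards [(chartAt E (1 : G)).open_target.mem_nhds (mem_chart_target E (1 : G))] with x hx
    exact mpullback_mulInvariantVectorField_chart hx v
  have hD : ∀ v w : E, fderiv ℝ (fun x => fderiv ℝ (localMul E G) (x, chartOne E G) (0, v))
      (chartOne E G) w = mixedDeriv (localMul E G) (chartOne E G) w v := by
    intro v w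
    have h1 : HasFDerivAt (fderiv ℝ (localMul E G))
        (fderiv ℝ (fderiv ℝ (localMul E G)) (chartOne E G, chartOne E G))
        (chartOne E G, chartOne E G) :=
      ((contDiffAt_localMul.fderiv_right (m := ∞) (by simp)).differentiableAt
        (by simp)).hasFDerivAt
    have h2 := HasFDerivAt.comp (f := fun x : E => (x, chartOne E G)) (chartOne E G) h1
      (hasFDerivAt_prodMk_left (𝕜 := ℝ) _ _)
    have h3 := h2.clm_apply (hasFDerivAt_const ((0, v) : E × E) (chartOne E G))
    rw [HasFDerivAt.fderiv (f := fun x => fderiv ℝ (localMul E G) (x, chartOne E G) (0, v)) h3]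
    simp [mixedDeriv]
  have he : ∀ v : E, fderiv ℝ (localMul E G) (chartOne E G, chartOne E G) (0, v) = v := by
    intro v
    have h1 := HasFDerivAt.comp (f := fun x : E => (chartOne E G, x)) (chartOne E G)
      (contDiffAt_localMul.differentiableAt (by simp)).hasFDerivAt
      (hasFDerivAt_prodMk_right (𝕜 := ℝ) _ _)
    have h2 : (localMul E G ∘ fun x : E => (chartOne E G, x)) =ᶠ[𝓝 (chartOne E G)] id := by
      filter_upwards [(chartAt E (1 : G)).open_target.mem_nhds
        (mem_chart_target E (1 : G))] with x hx using localMul_chartOne_left hx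
    have h3 := h1.unique ((hasFDerivAt_id _).congr_of_eventuallyEq h2)
    exact DFunLike.congr_fun h3 v
  have hs : ((extChartAt 𝓘(ℝ, E) (1 : G)).symm ⁻¹' univ ∩ range 𝓘(ℝ, E)) = univ := by simp
  have hlb : ∀ (X X' Y Y' : E → E) (s : Set E), X =ᶠ[𝓝 (chartOne E G)] X' →
      Y =ᶠ[𝓝 (chartOne E G)] Y' → s = univ →
      lieBracketWithin ℝ X Y s (chartOne E G) = lieBracket ℝ X' Y' (chartOne E G) := by
    rintro X X' Y Y' _ hX hY rfl
    rw [lieBracketWithin_univ, hX.lieBracket_vectorField_eq hY]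
  have key : ∀ v w : E, lieBracket ℝ
      (fun x => fderiv ℝ (localMul E G) (x, chartOne E G) (0, v))
      (fun x => fderiv ℝ (localMul E G) (x, chartOne E G) (0, w)) (chartOne E G) =
      mixedDeriv (localMul E G) (chartOne E G) v w -
        mixedDeriv (localMul E G) (chartOne E G) w v := by
    intro v w
    rw [lieBracket_eq]
    dsimp only
    rw [he, he, hD, hD]
  -- The manifold bracket is transported back by the inverse differential of the chart, which at the
  -- base point is the identity.
  have hinv : ∀ (A : E →L[ℝ] E), A = ContinuousLinearMap.id ℝ E → ∀ X, A.inverse X = X := by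
    rintro _ rfl X
    rw [ContinuousLinearMap.inverse_id]
    rfl
  exact (hinv _ (mfderiv_extChartAt_self (I := 𝓘(ℝ, E)) (x := (1 : G))) _).trans
    ((hlb _ _ _ _ _ (hV v) (hV w) hs).trans (key v w))

end LocalGroup

/-! ### An abstract Maurer–Cartan equation -/

section LocalCalculus

variable {E : Type*} [NormedAddCommGroup E] [NormedSpace ℝ E]
  {V : Type*} [NormedAddCommGroup V] [NormedSpace ℝ V]

/-- The derivative at `(e, e)` of a multiplication with unit `e` is the addition. -/
theorem fderiv_mul_unit {μ : E × E → E} {e : E} (hμ : DifferentiableAt ℝ μ (e, e))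
    (hl : ∀ᶠ x in 𝓝 e, μ (x, e) = x) (hr : ∀ᶠ x in 𝓝 e, μ (e, x) = x) (a b : E) :
    fderiv ℝ μ (e, e) (a, b) = a + b := by
  have h1 := HasFDerivAt.comp (f := fun x : E => (x, e)) e hμ.hasFDerivAt
    (hasFDerivAt_prodMk_left (𝕜 := ℝ) e e)
  have h2 := HasFDerivAt.comp (f := fun x : E => (e, x)) e hμ.hasFDerivAt
    (hasFDerivAt_prodMk_right (𝕜 := ℝ) e e)
  have h3 := DFunLike.congr_fun (h1.unique ((hasFDerivAt_id e).congr_of_eventuallyEq hl)) a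
  have h4 := DFunLike.congr_fun (h2.unique ((hasFDerivAt_id e).congr_of_eventuallyEq hr)) b
  have h5 : ((a, b) : E × E) = (a, 0) + (0, b) := by simp
  rw [h5, map_add]
  exact congrArg₂ (· + ·) h3 h4

/-- An abstract Maurer-Cartan equation: if `F x z = μ(p x, q z)` near the diagonal, where `F` is
constant on the diagonal, then the form `x ↦ D(F x)(x)` has the exterior derivative
prescribed by `μ`. -/
theorem fderiv_diagonal_antisymm {μ : E × E → E} {e : E} {p q : V → E} {y : V} {F : V → V → E}
    (hμ : ContDiffAt ℝ ∞ μ (e, e)) (hl : ∀ᶠ x in 𝓝 e, μ (x, e) = x)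
    (hr : ∀ᶠ x in 𝓝 e, μ (e, x) = x) (hp : ContDiffAt ℝ ∞ p y) (hq : ContDiffAt ℝ ∞ q y)
    (hpy : p y = e) (hqy : q y = e)
    (hF : ∀ᶠ x in 𝓝 y, ∀ᶠ z in 𝓝 x, F x z = μ (p x, q z)) (hd : ∀ᶠ x in 𝓝 y, F x x = e)
    (hy : fderiv ℝ (F y) y = fderiv ℝ q y) (u w : V) :
    fderiv ℝ (fun x => fderiv ℝ (F x) x) y u w - fderiv ℝ (fun x => fderiv ℝ (F x) x) y w u =
      mixedDeriv μ e (fderiv ℝ (F y) y w) (fderiv ℝ (F y) y u)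
        - mixedDeriv μ e (fderiv ℝ (F y) y u) (fderiv ℝ (F y) y w) := by
  have hpq0 : (p y, q y) = (e, e) := by rw [hpy, hqy]
  have hpq : ContinuousAt (fun x => (p x, q x)) y := hp.continuousAt.prodMk hq.continuousAt
  have hμd : ∀ᶠ x in 𝓝 y, DifferentiableAt ℝ μ (p x, q x) := by
    have h : ∀ᶠ a in 𝓝 (e, e), DifferentiableAt ℝ μ a := by
      filter_upwards [(hμ.of_le (m := 1) (by simp)).eventually (by simp)] with a ha using
        ha.differentiableAt (by simp)
    rw [← hpq0] at h
    exact hpq.eventually h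
  have hqd : ∀ᶠ x in 𝓝 y, DifferentiableAt ℝ q x := by
    filter_upwards [(hq.of_le (m := 1) (by simp)).eventually (by simp)] with a ha using
      ha.differentiableAt (by simp)
  -- On the diagonal `μ(p x, q x) = e`, and the derivative of `μ` at the unit is addition.
  have hneg : fderiv ℝ p y = -fderiv ℝ q y := by
    have h1 : HasFDerivAt μ (fderiv ℝ μ (e, e)) (p y, q y) := by
      rw [hpq0]; exact (hμ.differentiableAt (by simp)).hasFDerivAt
    have h2 := HasFDerivAt.comp y h1 ((hp.differentiableAt (by simp)).hasFDerivAt.prodMk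
      (hq.differentiableAt (by simp)).hasFDerivAt)
    have h3 : (μ ∘ fun x => (p x, q x)) =ᶠ[𝓝 y] fun _ => e := by
      filter_upwards [hF, hd] with x hx hx'
      rw [← hx']
      exact hx.self_of_nhds.symm
    have h4 := h2.unique ((hasFDerivAt_const e y).congr_of_eventuallyEq h3)
    ext a
    have h5 := DFunLike.congr_fun h4 a
    have h6 := fderiv_mul_unit (hμ.differentiableAt (by simp)) hl hr (fderiv ℝ p y a)
      (fderiv ℝ q y a)
    exact eq_neg_of_add_eq_zero_left (h6.symm.trans h5)
  -- With `x` frozen in `p x`, only the second argument of `μ` is differentiated. The resulting form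
  -- is the one treated by `fderiv_maurerCartan`.
  have hΛ : (fun x => fderiv ℝ (F x) x) =ᶠ[𝓝 y] fun x =>
      (fderiv ℝ μ (p x, q x)).comp ((ContinuousLinearMap.inr ℝ E E).comp (fderiv ℝ q x)) := by
    filter_upwards [hF, hμd, hqd] with x h1 h2 h3
    rw [Filter.EventuallyEq.fderiv_eq h1]
    have h4 := HasFDerivAt.comp x h2.hasFDerivAt ((hasFDerivAt_const (p x) x).prodMk h3.hasFDerivAt)
    rw [HasFDerivAt.fderiv (f := fun z => μ (p x, q z)) h4]
    ext a
    simp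
  rw [hΛ.fderiv_eq, hy]
  exact fderiv_maurerCartan hμ hp hq hpy hqy hneg u w

end LocalCalculus

/-! ### Logarithmic derivatives and the adjoint action -/

section LogDerivatives

variable {E : Type*} [NormedAddCommGroup E] [NormedSpace ℝ E]
  {G : Type*} [TopologicalSpace G] [ChartedSpace E G] [Group G]
  {V : Type*} [NormedAddCommGroup V] [NormedSpace ℝ V]

/-- The left logarithmic derivative of `ψ : V → G`, that is, `ψ^* θ^l`. -/
def leftLog (E : Type*) [NormedAddCommGroup E] [NormedSpace ℝ E]
    {G : Type*} [TopologicalSpace G] [ChartedSpace E G] [Group G] (ψ : V → G) (y : V) :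
    V →L[ℝ] E :=
  fderiv ℝ (fun z => chartAt E (1 : G) ((ψ y)⁻¹ * ψ z)) y

/-- The right logarithmic derivative of `ψ : V → G`, that is, `ψ^* θ^r`. -/
def rightLog (E : Type*) [NormedAddCommGroup E] [NormedSpace ℝ E]
    {G : Type*} [TopologicalSpace G] [ChartedSpace E G] [Group G] (ψ : V → G) (y : V) :
    V →L[ℝ] E :=
  fderiv ℝ (fun z => chartAt E (1 : G) (ψ z * (ψ y)⁻¹)) y

/-- The bracket of the Lie algebra of `G`, on the model space. -/
def modelBracket (E : Type*) [NormedAddCommGroup E] [NormedSpace ℝ E]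
    (G : Type*) [TopologicalSpace G] [ChartedSpace E G] [Group G] (v w : E) : E :=
  @Bracket.bracket (GroupLieAlgebra 𝓘(ℝ, E) G) (GroupLieAlgebra 𝓘(ℝ, E) G) _ v w

variable [LieGroup 𝓘(ℝ, E) ∞ G]

omit [LieGroup 𝓘(ℝ, E) ∞ G] in
theorem eventually_mem_chartAt_target_one :
    ∀ᶠ x in 𝓝 (chartOne E G), x ∈ (chartAt E (1 : G)).target :=
  (chartAt E (1 : G)).open_target.mem_nhds (mem_chart_target E (1 : G))

theorem contDiffAt_diag_left {ψ : V → G} {y : V} (hψ : ContMDiffAt 𝓘(ℝ, V) 𝓘(ℝ, E) ∞ ψ y) :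
    ContDiffAt ℝ ∞ (fun a : V × V => chartAt E (1 : G) ((ψ a.1)⁻¹ * ψ a.2)) (y, y) :=
  contDiffAt_chart_comp (ContMDiffAt.mul (n := ∞) (I := 𝓘(ℝ, E))
    (ContMDiffAt.inv (n := ∞) (I := 𝓘(ℝ, E))
      (ContMDiffAt.comp (g := ψ) (y, y) hψ contDiff_fst.contMDiff.contMDiffAt))
    (ContMDiffAt.comp (g := ψ) (y, y) hψ contDiff_snd.contMDiff.contMDiffAt)) (by simp)

theorem contDiffAt_diag_right {ψ : V → G} {y : V} (hψ : ContMDiffAt 𝓘(ℝ, V) 𝓘(ℝ, E) ∞ ψ y) :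
    ContDiffAt ℝ ∞ (fun a : V × V => chartAt E (1 : G) (ψ a.2 * (ψ a.1)⁻¹)) (y, y) :=
  contDiffAt_chart_comp (ContMDiffAt.mul (n := ∞) (I := 𝓘(ℝ, E))
    (ContMDiffAt.comp (g := ψ) (y, y) hψ contDiff_snd.contMDiff.contMDiffAt)
    (ContMDiffAt.inv (n := ∞) (I := 𝓘(ℝ, E))
      (ContMDiffAt.comp (g := ψ) (y, y) hψ contDiff_fst.contMDiff.contMDiffAt))) (by simp)

omit [LieGroup 𝓘(ℝ, E) ∞ G] in
-- The logarithmic derivatives differentiate in `z` and then set `z = x`; near the diagonal this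
-- equals the total derivative at `(x, x)` restricted to the second factor, which visibly depends
-- smoothly on `x`.
theorem contDiffAt_fderiv_diag {F : V × V → E} {U : Set V} (hU : IsOpen U)
    (hF : ∀ x ∈ U, ContDiffAt ℝ ∞ F (x, x)) {y : V} (hy : y ∈ U) :
    ContDiffAt ℝ ∞ (fun x => fderiv ℝ (fun z => F (x, z)) x) y := by
  have h1 : ContDiffAt ℝ ∞ (fun x => (fderiv ℝ F (x, x)).comp (ContinuousLinearMap.inr ℝ V V))
      y := by
    have h2 := ((hF y hy).fderiv_right (m := ∞) (by simp)).comp (f := fun x : V => (x, x)) y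
      (contDiff_id.prodMk contDiff_id).contDiffAt
    exact h2.clm_comp contDiffAt_const
  refine h1.congr_of_eventuallyEq ?_
  filter_upwards [hU.mem_nhds hy] with x hx
  have h2 := HasFDerivAt.comp (f := fun z : V => (x, z)) x
    ((hF x hx).differentiableAt (by simp)).hasFDerivAt (hasFDerivAt_prodMk_right (𝕜 := ℝ) x x)
  exact h2.fderiv

theorem contDiffOn_leftLog {ψ : V → G} {U : Set V} (hU : IsOpen U)
    (hψ : ContMDiffOn 𝓘(ℝ, V) 𝓘(ℝ, E) ∞ ψ U) : ContDiffOn ℝ ∞ (leftLog E ψ) U := fun _ hy =>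
  (contDiffAt_fderiv_diag hU (fun _ hx => contDiffAt_diag_left
    (hψ.contMDiffAt (hU.mem_nhds hx))) hy).contDiffWithinAt

theorem contDiffOn_rightLog {ψ : V → G} {U : Set V} (hU : IsOpen U)
    (hψ : ContMDiffOn 𝓘(ℝ, V) 𝓘(ℝ, E) ∞ ψ U) : ContDiffOn ℝ ∞ (rightLog E ψ) U := fun _ hy =>
  (contDiffAt_fderiv_diag hU (fun _ hx => contDiffAt_diag_right
    (hψ.contMDiffAt (hU.mem_nhds hx))) hy).contDiffWithinAt

/-- The Maurer-Cartan equation for `θ^l`. -/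
theorem fderiv_leftLog [CompleteSpace E] {ψ : V → G} {y : V}
    (hψ : ContMDiffAt 𝓘(ℝ, V) 𝓘(ℝ, E) ∞ ψ y) (u w : V) :
    fderiv ℝ (leftLog E ψ) y u w - fderiv ℝ (leftLog E ψ) y w u =
      - modelBracket E G (leftLog E ψ y u) (leftLog E ψ y w) := by
  have hc := hψ.continuousAt
  have : IsTopologicalGroup G := topologicalGroup_of_lieGroup 𝓘(ℝ, E) ∞
  have h1 : ∀ᶠ x in 𝓝 y, (ψ x)⁻¹ * ψ y ∈ (chartAt E (1 : G)).source :=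
    (hc.inv.mul continuousAt_const).eventually
      ((chartAt E (1 : G)).open_source.mem_nhds (by simp))
  have h2 : ∀ᶠ x in 𝓝 y, (ψ y)⁻¹ * ψ x ∈ (chartAt E (1 : G)).source :=
    (continuousAt_const.mul hc).eventually
      ((chartAt E (1 : G)).open_source.mem_nhds (by simp))
  -- Factor `ψ(x)⁻¹ψ(z) = (ψ(x)⁻¹ψ(y)) (ψ(y)⁻¹ψ(z))`; both factors lie in the chart at `1` for `x`
  -- and `z` near `y`.
  have key := fderiv_diagonal_antisymm (μ := localMul E G) (e := chartOne E G)
    (p := fun x => chartAt E (1 : G) ((ψ x)⁻¹ * ψ y))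
    (q := fun z => chartAt E (1 : G) ((ψ y)⁻¹ * ψ z)) (y := y)
    (F := fun x z => chartAt E (1 : G) ((ψ x)⁻¹ * ψ z)) contDiffAt_localMul
    (eventually_mem_chartAt_target_one.mono fun _ hx => localMul_chartOne_right hx)
    (eventually_mem_chartAt_target_one.mono fun _ hx => localMul_chartOne_left hx)
    ((contDiffAt_diag_left hψ).comp (f := fun x : V => (x, y)) y
      (contDiff_id.prodMk contDiff_const).contDiffAt)
    ((contDiffAt_diag_left hψ).comp (f := fun x : V => (y, x)) y
      (contDiff_const.prodMk contDiff_id).contDiffAt) (by simp) (by simp)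
    (by
      filter_upwards [h1, h2.eventually_nhds] with x hx hx'
      filter_upwards [hx'] with z hz
      rw [localMul_chart hx hz]
      group) (by simp) rfl u w
  refine key.trans ?_
  erw [modelBracket, bracket_eq_mixedDeriv]
  exact (neg_sub _ _).symm

/-- The Maurer-Cartan equation for `θ^r`. -/
theorem fderiv_rightLog [CompleteSpace E] {ψ : V → G} {y : V}
    (hψ : ContMDiffAt 𝓘(ℝ, V) 𝓘(ℝ, E) ∞ ψ y) (u w : V) :
    fderiv ℝ (rightLog E ψ) y u w - fderiv ℝ (rightLog E ψ) y w u =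
      modelBracket E G (rightLog E ψ y u) (rightLog E ψ y w) := by
  have hc := hψ.continuousAt
  have : IsTopologicalGroup G := topologicalGroup_of_lieGroup 𝓘(ℝ, E) ∞
  have h1 : ∀ᶠ x in 𝓝 y, ψ y * (ψ x)⁻¹ ∈ (chartAt E (1 : G)).source :=
    (continuousAt_const.mul hc.inv).eventually
      ((chartAt E (1 : G)).open_source.mem_nhds (by simp))
  have h2 : ∀ᶠ x in 𝓝 y, ψ x * (ψ y)⁻¹ ∈ (chartAt E (1 : G)).source :=
    (hc.mul continuousAt_const).eventually
      ((chartAt E (1 : G)).open_source.mem_nhds (by simp))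
  -- Here `ψ(z)ψ(x)⁻¹ = (ψ(z)ψ(y)⁻¹) (ψ(y)ψ(x)⁻¹)`, with the frozen factor on the right, so the
  -- opposite multiplication has to be used.
  have key := fderiv_diagonal_antisymm (μ := fun a => localMul E G (a.2, a.1)) (e := chartOne E G)
    (p := fun x => chartAt E (1 : G) (ψ y * (ψ x)⁻¹))
    (q := fun z => chartAt E (1 : G) (ψ z * (ψ y)⁻¹)) (y := y)
    (F := fun x z => chartAt E (1 : G) (ψ z * (ψ x)⁻¹))
    (contDiffAt_localMul.comp (f := fun a : E × E => (a.2, a.1)) (chartOne E G, chartOne E G)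
      (contDiff_snd.prodMk contDiff_fst).contDiffAt)
    (eventually_mem_chartAt_target_one.mono fun _ hx => localMul_chartOne_left hx)
    (eventually_mem_chartAt_target_one.mono fun _ hx => localMul_chartOne_right hx)
    ((contDiffAt_diag_right hψ).comp (f := fun x : V => (x, y)) y
      (contDiff_id.prodMk contDiff_const).contDiffAt)
    ((contDiffAt_diag_right hψ).comp (f := fun x : V => (y, x)) y
      (contDiff_const.prodMk contDiff_id).contDiffAt) (by simp) (by simp)
    (by
      filter_upwards [h1, h2.eventually_nhds] with x hx hx'
      filter_upwards [hx'] with z hz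
      rw [localMul_chart hz hx]
      group) (by simp) rfl u w
  rw [mixedDeriv_swap contDiffAt_localMul, mixedDeriv_swap contDiffAt_localMul] at key
  refine key.trans ?_
  erw [modelBracket, bracket_eq_mixedDeriv]
  rfl

/-- The adjoint action, on the model space. -/
def modelAd (E : Type*) [NormedAddCommGroup E] [NormedSpace ℝ E]
    {G : Type*} [TopologicalSpace G] [ChartedSpace E G] [Group G] (g : G) : E →L[ℝ] E :=
  adjointAction E g

theorem hasTangentMap_modelAd (g : G) :
    HasTangentMap (E₁ := E) (E₂ := E) (fun h : G => g * h * g⁻¹) 1 1 (modelAd E g) :=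
  MDifferentiableAt.hasTangentMap (((contMDiff_mul_left (I := 𝓘(ℝ, E)) (n := ∞) (a := g)).mul
    contMDiff_const).mdifferentiable (by simp) 1) (by simp)

theorem modelAd_mul (g h : G) :
    modelAd E (g * h) =
      (modelAd E g).comp (modelAd E h) := by
  refine (hasTangentMap_modelAd (g * h)).unique (y' := 1) ?_
  refine ((hasTangentMap_modelAd g).comp (hasTangentMap_modelAd h)).congr ?_
  filter_upwards with x
  group

theorem modelAd_mul_apply (g h : G) (v : E) :
    modelAd E (g * h) v =
      modelAd E g (modelAd E h v) := by
  rw [modelAd_mul]; rfl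

theorem modelAd_one : modelAd E (1 : G) = ContinuousLinearMap.id ℝ E := by
  refine (hasTangentMap_modelAd (1 : G)).unique (y' := 1) ?_
  refine (HasTangentMap.id (1 : G)).congr ?_
  filter_upwards with x
  group

/-- The adjoint action is an action by automorphisms of the Lie algebra. -/
theorem modelAd_bracket [CompleteSpace E] (g : G) (v w : E) :
    modelAd E g (modelBracket E G v w) =
      modelBracket E G (modelAd E g v)
        (modelAd E g w) := by
  set A : E →L[ℝ] E := modelAd E g with hA
  set ψ : E → G := ⇑(chartAt E (1 : G)).symm
  have hψ := contMDiffAt_chart_symm (1 : G) (mem_chart_target E (1 : G))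
  have hψ' : ContMDiffAt 𝓘(ℝ, E) 𝓘(ℝ, E) ∞ (fun y => g * ψ y * g⁻¹) (chartOne E G) :=
    (contMDiffAt_const.mul hψ).mul contMDiffAt_const
  -- Conjugating `ψ` by the constant `g` applies `Ad_g` to its logarithmic derivative. Comparing the
  -- Maurer–Cartan equations of `ψ` and of its conjugate at the unit, where the logarithmic
  -- derivative of `ψ` is the identity, gives compatibility with the bracket.
  have hlog : ∀ y ∈ (chartAt E (1 : G)).target,
      leftLog E (fun y => g * ψ y * g⁻¹) y = A.comp (leftLog E ψ y) := by
    intro y hy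
    have h1 : HasTangentMap (fun z => (ψ y)⁻¹ * ψ z) y 1 _ :=
      MDifferentiableAt.hasTangentMap
        ((contMDiffAt_const.mul (contMDiffAt_chart_symm (1 : G) hy)).mdifferentiableAt (by simp))
        (by simp)
    have h2 := ((hasTangentMap_modelAd g).comp h1).hasFDerivAt_chart
    rw [leftLog, leftLog, h1.hasFDerivAt_chart.fderiv, ← h2.fderiv]
    congr 1
    funext z
    group
  have hone : leftLog E ψ (chartOne E G) = ContinuousLinearMap.id ℝ E := by
    have h := (hasTangentMap_chartAt_symm (E₂ := E) (1 : G)).hasFDerivAt_chart.fderiv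
    rw [leftLog, ← h]
    simp [ψ]
  have hd : DifferentiableAt ℝ (leftLog E ψ) (chartOne E G) :=
    ((contDiffOn_leftLog (chartAt E (1 : G)).open_target
      (contMDiffOn_chart_symm (I := 𝓘(ℝ, E)) (n := ∞))).contDiffAt
        ((chartAt E (1 : G)).open_target.mem_nhds (mem_chart_target E _))).differentiableAt
        (by simp)
  have h1 := fderiv_leftLog hψ v w
  have h2 := fderiv_leftLog hψ' v w
  have h3 : leftLog E (fun y => g * ψ y * g⁻¹) =ᶠ[𝓝 (chartOne E G)] fun y =>
      A.comp (leftLog E ψ y) := by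
    filter_upwards [eventually_mem_chartAt_target_one] with y hy using hlog y hy
  rw [h3.fderiv_eq, h3.self_of_nhds] at h2
  have h4 := ((hasFDerivAt_const A (chartOne E G)).clm_comp hd.hasFDerivAt).fderiv
  rw [h4] at h2
  rw [hone] at h1
  simp [hone] at h1 h2
  rw [← map_sub, h1, map_neg, neg_inj] at h2
  exact h2

/-- The derivative of the adjoint action at `1` is the bracket. -/
theorem hasFDerivAt_modelAd [CompleteSpace E] :
    ∃ D : E →L[ℝ] E →L[ℝ] E,
      HasFDerivAt (fun x => modelAd E ((chartAt E (1 : G)).symm x)) D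
        (chartOne E G) ∧ ∀ v w, D v w = modelBracket E G v w := by
  have hTG : IsTopologicalGroup G := topologicalGroup_of_lieGroup 𝓘(ℝ, E) ∞
  set ψ : E → G := ⇑(chartAt E (1 : G)).symm with hψd
  have hψ := contMDiffAt_chart_symm (1 : G) (mem_chart_target E (1 : G))
  set e := chartOne E G with he
  have hψe : ψ e = 1 := chartOne_symm
  -- This is conjugation in the chart; its derivative in the second variable at `e` is `Ad`.
  set c : E × E → E := fun a => chartAt E (1 : G) (ψ a.1 * ψ a.2 * (ψ a.1)⁻¹) with hc
  have h1 : ContMDiffAt 𝓘(ℝ, E × E) 𝓘(ℝ, E) ∞ (fun a : E × E => ψ a.1) (e, e) :=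
    ContMDiffAt.comp (g := ψ) (e, e) hψ contDiff_fst.contMDiff.contMDiffAt
  have h2 : ContMDiffAt 𝓘(ℝ, E × E) 𝓘(ℝ, E) ∞ (fun a : E × E => ψ a.2) (e, e) :=
    ContMDiffAt.comp (g := ψ) (e, e) hψ contDiff_snd.contMDiff.contMDiffAt
  have hcG : ContMDiffAt 𝓘(ℝ, E × E) 𝓘(ℝ, E) ∞
      (fun a : E × E => ψ a.1 * ψ a.2 * (ψ a.1)⁻¹) (e, e) := (h1.mul h2).mul h1.inv
  have hcs : ContDiffAt ℝ ∞ c (e, e) :=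
    contDiffAt_chart_comp hcG (by simp [hψe])
  have hψs : ∀ x ∈ (chartAt E (1 : G)).target, ψ x ∈ (chartAt E (1 : G)).source :=
    fun x hx => (chartAt E (1 : G)).map_target hx
  -- The relation `(x z x⁻¹) x = x z` avoids differentiating the inversion.
  have hcμ : ∀ᶠ a in 𝓝 (e, e), localMul E G (c a, a.1) = localMul E G a := by
    have h3 := hcG.continuousAt.eventually ((chartAt E (1 : G)).open_source.mem_nhds
      (by simp [hψe]))
    have h4 : ∀ᶠ a : E × E in 𝓝 (e, e), a.1 ∈ (chartAt E (1 : G)).target :=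
      continuousAt_fst.eventually eventually_mem_chartAt_target_one
    filter_upwards [h3, h4] with a ha ha'
    rw [localMul, hc]
    dsimp only
    rw [(chartAt E (1 : G)).left_inv ha, localMul]
    congr 1
    simp [hψd]
  have key := fderiv_conj contDiffAt_localMul hcs
    (eventually_mem_chartAt_target_one.mono fun _ hx => localMul_chartOne_right hx)
    (.of_forall fun x => by
      change chartAt E (1 : G) (ψ x * ψ e * (ψ x)⁻¹) = e
      rw [hψe]
      simp [he])
    (eventually_mem_chartAt_target_one.mono fun x hx => by
      change chartAt E (1 : G) (ψ e * ψ x * (ψ e)⁻¹) = x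
      rw [hψe]
      simp [hψd, (chartAt E (1 : G)).right_inv hx]) hcμ
  have hA : (fun x => modelAd E (ψ x)) =ᶠ[𝓝 e] fun x =>
      (fderiv ℝ c (x, e)).comp (ContinuousLinearMap.inr ℝ E E) := by
    have h3 : ∀ᶠ a in 𝓝 (e, e), DifferentiableAt ℝ c a := by
      filter_upwards [(hcs.of_le (m := 1) (by simp)).eventually (by simp)] with a ha using
        ha.differentiableAt (by simp)
    have h4 : ContinuousAt (fun x : E => (x, e)) e := by fun_prop
    filter_upwards [h4.eventually h3] with x hx
    have h5 := HasFDerivAt.comp (f := fun z : E => (x, z)) e hx.hasFDerivAt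
      (hasFDerivAt_prodMk_right (𝕜 := ℝ) x e)
    have h6 := ((hasTangentMap_modelAd (E := E) (ψ x)).comp
      (hasTangentMap_chartAt_symm (1 : G))).hasFDerivAt_chart
    exact (h5.unique h6).symm
  have hd : DifferentiableAt ℝ (fun x => (fderiv ℝ c (x, e)).comp
      (ContinuousLinearMap.inr ℝ E E)) e := by
    have h3 : DifferentiableAt ℝ (fderiv ℝ c) (e, e) :=
      (hcs.fderiv_right (m := ∞) (by simp)).differentiableAt (by simp)
    have h4 : DifferentiableAt ℝ (fun x => fderiv ℝ c (x, e)) e :=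
      DifferentiableAt.comp e h3 (by fun_prop)
    exact h4.clm_comp (differentiableAt_const _)
  refine ⟨_, hd.hasFDerivAt.congr_of_eventuallyEq hA, fun v w => ?_⟩
  rw [key, modelBracket]
  exact (bracket_eq_mixedDeriv (G := G) v w).symm

end LogDerivatives

/-! ### Product rules for Maurer–Cartan forms and `Ad`-invariance -/

section ThetaAlgebra

variable {E : Type*} [NormedAddCommGroup E] [NormedSpace ℝ E]
  {G : Type*} [TopologicalSpace G] [ChartedSpace E G] [Group G] [LieGroup 𝓘(ℝ, E) ∞ G]
  {V : Type*} [NormedAddCommGroup V] [NormedSpace ℝ V]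
  {M : Type*} [TopologicalSpace M] [ChartedSpace V M]

/-- In the chart at `1` the product becomes `localMul`, whose derivative at the unit is addition. -/
theorem HasTangentMap.mul_one {f h : M → G} {x : M} {L L' : V →L[ℝ] E}
    (hf : HasTangentMap f x 1 L) (hh : HasTangentMap h x 1 L') :
    HasTangentMap (fun z => f z * h z) x 1 (L + L') := by
  have hTG : IsTopologicalGroup G := topologicalGroup_of_lieGroup 𝓘(ℝ, E) ∞
  have h1 := (hasTangentMap_chartAt (E₂ := E) (1 : G)).comp hf
  have h2 := (hasTangentMap_chartAt (E₂ := E) (1 : G)).comp hh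
  have h3 : HasTangentMap (E₁ := V) (E₂ := E × E)
      (fun z => (chartAt E (1 : G) (f z), chartAt E (1 : G) (h z))) x
      (chartOne E G, chartOne E G) (L.prod L') :=
    ⟨Prod.ext h1.1 h2.1, ⟨h1.2.1.prodMk h2.2.1, h1.2.2.prodMk h2.2.2⟩⟩
  have h4 : HasTangentMap (localMul E G) (chartOne E G, chartOne E G) (chartOne E G) _ :=
    (contDiffAt_localMul.differentiableAt (by simp)).hasFDerivAt.hasTangentMap
      (localMul_chartOne_right (mem_chart_target E _))
  have h5 := (hasTangentMap_chartAt_symm (E₂ := E) (1 : G)).comp (h4.comp h3)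
  have h6 : (fun z => f z * h z) =ᶠ[𝓝 x] fun z => (chartAt E (1 : G)).symm
      (localMul E G (chartAt E (1 : G) (f z), chartAt E (1 : G) (h z))) := by
    have hs := (chartAt E (1 : G)).open_source.mem_nhds (mem_chart_source E (1 : G))
    have hcf := hf.2.continuousAt
    have hch := hh.2.continuousAt
    have e1 := hcf.eventually (by rw [hf.1]; exact hs)
    have e2 := hch.eventually (by rw [hh.1]; exact hs)
    have e3 : ∀ᶠ z in 𝓝 x, f z * h z ∈ (chartAt E (1 : G)).source := by
      have hc : ContinuousAt (fun z => f z * h z) x := hcf.mul hch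
      refine hc.eventually ((chartAt E (1 : G)).open_source.mem_nhds ?_)
      change f x * h x ∈ _
      rw [hf.1, hh.1, _root_.mul_one]
      exact mem_chart_source E 1
    filter_upwards [e1, e2, e3] with z z1 z2 z3
    rw [localMul_chart z1 z2, (chartAt E (1 : G)).left_inv z3]
  have h7 := h5.congr h6
  have h8 : ((ContinuousLinearMap.id ℝ E).comp
      ((fderiv ℝ (localMul E G) (chartOne E G, chartOne E G)).comp (L.prod L'))) = L + L' := by
    ext v
    exact fderiv_mul_unit (contDiffAt_localMul.differentiableAt (by simp))
      (eventually_mem_chartAt_target_one.mono fun _ hx => localMul_chartOne_right hx)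
      (eventually_mem_chartAt_target_one.mono fun _ hx => localMul_chartOne_left hx) _ _
  rw [h8] at h7
  exact h7

/-- The left Maurer-Cartan form, on the model space. -/
def modelLeftMC (E : Type*) [NormedAddCommGroup E] [NormedSpace ℝ E]
    {G : Type*} [TopologicalSpace G] [ChartedSpace E G] [Group G] (g : G) : E →L[ℝ] E :=
  leftMC E g

/-- The right Maurer-Cartan form, on the model space. -/
def modelRightMC (E : Type*) [NormedAddCommGroup E] [NormedSpace ℝ E]
    {G : Type*} [TopologicalSpace G] [ChartedSpace E G] [Group G] (g : G) : E →L[ℝ] E :=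
  rightMC E g

/-- The pullback `f^* θ^l` at `x`, with values in the model space. -/
def thetaLeft (E : Type*) [NormedAddCommGroup E] [NormedSpace ℝ E]
    {G : Type*} [TopologicalSpace G] [ChartedSpace E G] [Group G]
    {V : Type*} [NormedAddCommGroup V] [NormedSpace ℝ V]
    {M : Type*} [TopologicalSpace M] [ChartedSpace V M] (f : M → G) (x : M) : V →L[ℝ] E :=
  (modelLeftMC E (f x)).comp (mfderiv 𝓘(ℝ, V) 𝓘(ℝ, E) f x : V →L[ℝ] E)

/-- The pullback `f^* θ^r` at `x`, with values in the model space. -/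
def thetaRight (E : Type*) [NormedAddCommGroup E] [NormedSpace ℝ E]
    {G : Type*} [TopologicalSpace G] [ChartedSpace E G] [Group G]
    {V : Type*} [NormedAddCommGroup V] [NormedSpace ℝ V]
    {M : Type*} [TopologicalSpace M] [ChartedSpace V M] (f : M → G) (x : M) : V →L[ℝ] E :=
  (modelRightMC E (f x)).comp (mfderiv 𝓘(ℝ, V) 𝓘(ℝ, E) f x : V →L[ℝ] E)

theorem hasTangentMap_leftMC (g : G) :
    HasTangentMap (E₁ := E) (E₂ := E) (fun h => g⁻¹ * h) g 1 (modelLeftMC E g) :=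
  MDifferentiableAt.hasTangentMap ((contMDiff_mul_left (I := 𝓘(ℝ, E)) (n := ∞)).mdifferentiable
    (by simp) g) (by simp)

theorem hasTangentMap_rightMC (g : G) :
    HasTangentMap (E₁ := E) (E₂ := E) (fun h => h * g⁻¹) g 1 (modelRightMC E g) :=
  MDifferentiableAt.hasTangentMap ((contMDiff_mul_right (I := 𝓘(ℝ, E)) (n := ∞)).mdifferentiable
    (by simp) g) (by simp)

theorem leftMC_one : modelLeftMC E (1 : G) = ContinuousLinearMap.id ℝ E := by
  refine (hasTangentMap_leftMC (1 : G)).unique (y' := 1) ?_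
  refine (HasTangentMap.id (1 : G)).congr (.of_forall fun x => ?_)
  simp

theorem rightMC_one : modelRightMC E (1 : G) = ContinuousLinearMap.id ℝ E := by
  refine (hasTangentMap_rightMC (1 : G)).unique (y' := 1) ?_
  refine (HasTangentMap.id (1 : G)).congr (.of_forall fun x => ?_)
  simp

theorem hasTangentMap_thetaLeft {f : M → G} {x : M}
    (hf : MDifferentiableAt 𝓘(ℝ, V) 𝓘(ℝ, E) f x) :
    HasTangentMap (E₁ := V) (E₂ := E) (fun z => (f x)⁻¹ * f z) x 1 (thetaLeft E f x) :=
  (hasTangentMap_leftMC (f x)).comp (hf.hasTangentMap rfl)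

theorem hasTangentMap_thetaRight {f : M → G} {x : M}
    (hf : MDifferentiableAt 𝓘(ℝ, V) 𝓘(ℝ, E) f x) :
    HasTangentMap (E₁ := V) (E₂ := E) (fun z => f z * (f x)⁻¹) x 1 (thetaRight E f x) :=
  (hasTangentMap_rightMC (f x)).comp (hf.hasTangentMap rfl)

/-- Differentiate `f(z)f(x)⁻¹ = f(x) (f(x)⁻¹f(z)) f(x)⁻¹` at `z = x`. -/
theorem thetaRight_eq {f : M → G} {x : M} (hf : MDifferentiableAt 𝓘(ℝ, V) 𝓘(ℝ, E) f x) :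
    thetaRight (V := V) E f x = (modelAd E (f x)).comp (thetaLeft E f x) := by
  refine (hasTangentMap_thetaRight hf).unique (y' := 1) ?_
  refine ((hasTangentMap_modelAd (f x)).comp (hasTangentMap_thetaLeft hf)).congr
    (.of_forall fun z => ?_)
  group

/-- At `z = x`, differentiate the conjugate by `h(x)⁻¹` of `(f(x)⁻¹f(z)) (h(z)h(x)⁻¹)`. Both factors
of the latter pass through `1`, so their derivatives add. -/
theorem thetaLeft_mul {f h : M → G} {x : M} (hf : MDifferentiableAt 𝓘(ℝ, V) 𝓘(ℝ, E) f x)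
    (hh : MDifferentiableAt 𝓘(ℝ, V) 𝓘(ℝ, E) h x)
    (hfh : MDifferentiableAt 𝓘(ℝ, V) 𝓘(ℝ, E) (fun z => f z * h z) x) :
    thetaLeft (V := V) E (fun z => f z * h z) x =
      (modelAd E (h x)⁻¹).comp (thetaLeft E f x + thetaRight E h x) := by
  refine (hasTangentMap_thetaLeft hfh).unique (y' := 1) ?_
  refine ((hasTangentMap_modelAd (h x)⁻¹).comp
    ((hasTangentMap_thetaLeft hf).mul_one (hasTangentMap_thetaRight hh))).congr
    (.of_forall fun z => ?_)
  group

theorem modelAd_inv_apply (g : G) (v : E) :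
    modelAd E g⁻¹ (modelAd E g v) = v := by
  rw [← modelAd_mul_apply, inv_mul_cancel, modelAd_one]; rfl

theorem modelAd_apply_inv (g : G) (v : E) :
    modelAd E g (modelAd E g⁻¹ v) = v := by
  rw [← modelAd_mul_apply, mul_inv_cancel, modelAd_one]; rfl

theorem thetaRight_mul_apply {f h : M → G} {x : M} (hf : MDifferentiableAt 𝓘(ℝ, V) 𝓘(ℝ, E) f x)
    (hh : MDifferentiableAt 𝓘(ℝ, V) 𝓘(ℝ, E) h x)
    (hfh : MDifferentiableAt 𝓘(ℝ, V) 𝓘(ℝ, E) (fun z => f z * h z) x) (v : V) :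
    thetaRight (V := V) E (fun z => f z * h z) x v =
      thetaRight E f x v +
        modelAd E (f x) (thetaRight E h x v) := by
  rw [thetaRight_eq hfh, thetaLeft_mul hf hh hfh]
  change modelAd E (f x * h x) (modelAd E (h x)⁻¹
    (thetaLeft E f x v + thetaRight E h x v)) = _
  rw [modelAd_mul_apply, modelAd_apply_inv, map_add, thetaRight_eq hf]
  rfl

omit [LieGroup 𝓘(ℝ, E) ∞ G] in
theorem exists_continuous_bilinear [FiniteDimensional ℝ E]
    (B : LinearMap.BilinForm ℝ (GroupLieAlgebra 𝓘(ℝ, E) G)) :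
    ∃ b : E →L[ℝ] E →L[ℝ] ℝ, ∀ v w : E, b v w = B v w :=
  ⟨LinearMap.toContinuousLinearMap (E := E) (F' := E →L[ℝ] ℝ)
    ((LinearMap.toContinuousLinearMap (E := E) (F' := ℝ)).toLinearMap ∘ₗ
      (B : E →ₗ[ℝ] E →ₗ[ℝ] ℝ)), fun _ _ => rfl⟩

/-- On a connected group, an `ad`-invariant form is `Ad`-invariant. -/
theorem IsQuadratic.modelAd_invariant [FiniteDimensional ℝ E] [PreconnectedSpace G]
    {B : LinearMap.BilinForm ℝ (GroupLieAlgebra 𝓘(ℝ, E) G)} (hB : IsQuadratic B) (g : G)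
    (a a' : E) :
    B (modelAd E g a) (modelAd E g a') = B a a' := by
  obtain ⟨b, hb⟩ := exists_continuous_bilinear B
  set k : E → E → G → ℝ := fun a a' h =>
    b (modelAd E h a) (modelAd E h a') with hk
  -- At `1` the derivative of `⟨Ad_h a, Ad_h a'⟩` in direction `v` is `⟨[v, a], a'⟩ + ⟨a, [v, a']⟩`,
  -- which vanishes by invariance.
  have hk1 : ∀ a a', HasTangentMap (E₁ := E) (E₂ := ℝ) (k a a') 1 (k a a' 1) 0 := by
    intro a a'
    obtain ⟨D, hD, hD'⟩ := hasFDerivAt_modelAd (E := E) (G := G)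
    have h1 := b.hasFDerivAt_of_bilinear
      (hD.clm_apply (hasFDerivAt_const a _)) (hD.clm_apply (hasFDerivAt_const a' _))
    have h2 : HasFDerivAt (fun x => k a a' ((chartAt E (1 : G)).symm x)) (0 : E →L[ℝ] ℝ)
        (chartOne E G) := by
      refine HasFDerivAt.congr_fderiv h1 ?_
      ext v
      have h3 := hB.invariant v a a'
      simp only [chartOne_symm, modelAd_one]
      simp [hD', hb]
      rw [add_comm]
      exact h3
    have h4 := (h2.hasTangentMap (y := k a a' 1) (by rw [chartOne_symm])).comp_zero
      (hasTangentMap_chartAt (E₂ := E) (1 : G))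
    refine h4.congr ?_
    filter_upwards [(chartAt E (1 : G)).open_source.mem_nhds (mem_chart_source E (1 : G))]
      with x hx
    rw [(chartAt E (1 : G)).left_inv hx]
  set f := k a a' with hf
  -- Right translation by `h⁻¹` moves the point to `1` and replaces `a`, `a'` by `Ad_h a`, `Ad_h
  -- a'`. This is why `hk1` was proved for all pairs.
  have hfd : ∀ h : G, HasTangentMap (E₁ := E) (E₂ := ℝ) f h (f h) 0 := by
    intro h
    have h1 := (hk1 (modelAd E h a) (modelAd E h a')).comp_zero
      (hasTangentMap_rightMC (E := E) h)
    have h2 : f = fun x => k (modelAd E h a)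
        (modelAd E h a') (x * h⁻¹) := by
      funext x
      simp only [hf, hk]
      rw [← modelAd_mul_apply, ← modelAd_mul_apply, inv_mul_cancel_right]
    have h3 := h1.congr (g := f) (by rw [h2])
    exact ⟨rfl, h3.2⟩
  -- A vanishing derivative gives constancy on balls inside chart targets, since these are
  -- connected.
  have hloc : IsLocallyConstant f := by
    rw [IsLocallyConstant.iff_eventually_eq]
    intro x
    obtain ⟨r, hr, hball⟩ := Metric.isOpen_iff.1 (chartAt E x).open_target _
      (mem_chart_target E x)
    have hd : ∀ y ∈ Metric.ball (chartAt E x x) r,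
        HasFDerivAt (fun z => f ((chartAt E x).symm z)) (0 : E →L[ℝ] ℝ) y := by
      intro y hy
      have h1 := (hfd ((chartAt E x).symm y)).comp_zero
        (((contMDiffAt_chart_symm x (hball hy)).mdifferentiableAt (by simp)).hasTangentMap rfl)
      exact h1.hasFDerivAt
    have hev : ∀ᶠ y in 𝓝 x, y ∈ (chartAt E x).source ∧
        chartAt E x y ∈ Metric.ball (chartAt E x x) r :=
      Filter.Eventually.and
        ((chartAt E x).open_source.mem_nhds (mem_chart_source E x))
        (((chartAt E x).continuousAt (mem_chart_source E x)).eventually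
          (Metric.ball_mem_nhds _ hr))
    filter_upwards [hev] with y hy
    have h2 := Metric.isOpen_ball.is_const_of_fderiv_eq_zero
      (convex_ball _ r).isPreconnected
      (fun z hz => (hd z hz).differentiableAt.differentiableWithinAt)
      (fun z hz => (hd z hz).fderiv) hy.2 (Metric.mem_ball_self hr)
    rwa [(chartAt E x).left_inv hy.1, (chartAt E x).left_inv (mem_chart_source E x)] at h2
  have h := hloc.apply_eq_of_preconnectedSpace g 1
  simp only [hf, hk, hb, modelAd_one] at h
  exact h

end ThetaAlgebra

/-! ### Exterior derivatives on vector spaces -/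

section AlternatingForms

/-- An alternating form is determined by its values on tuples of basis vectors. This evaluation is
an injective linear map to a finite-dimensional space and has a linear left inverse, so smoothness
of the values suffices. -/
theorem contDiffOn_alternating_of_apply {V : Type*} [NormedAddCommGroup V] [NormedSpace ℝ V]
    [FiniteDimensional ℝ V] {k : ℕ} {f : V → V [⋀^Fin k]→L[ℝ] ℝ} {U : Set V}
    (h : ∀ u : Fin k → V, ContDiffOn ℝ ∞ (fun y => f y u) U) : ContDiffOn ℝ ∞ f U := by
  let b := Module.finBasis ℝ V
  let ev : V [⋀^Fin k]→L[ℝ] ℝ →ₗ[ℝ] ((Fin k → Fin (Module.finrank ℝ V)) → ℝ) :=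
    { toFun := fun w s => w fun i => b (s i)
      map_add' := fun _ _ => rfl
      map_smul' := fun _ _ => rfl }
  have hev : Function.Injective ev := by
    intro w w' hw
    have h1 : w.toAlternatingMap.toMultilinearMap = w'.toAlternatingMap.toMultilinearMap :=
      Module.Basis.ext_multilinear (fun _ => b) fun s => congrFun hw s
    ext u
    exact DFunLike.congr_fun h1 u
  have : FiniteDimensional ℝ (V [⋀^Fin k]→L[ℝ] ℝ) := FiniteDimensional.of_injective ev hev
  obtain ⟨r, hr⟩ := ev.exists_leftInverse_of_injective (LinearMap.ker_eq_bot.2 hev)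
  have h1 : ContDiffOn ℝ ∞ (fun y => ev (f y)) U := contDiffOn_pi.2 fun s => h _
  have h2 : ContDiff ℝ ∞ r := (LinearMap.toContinuousLinearMap r).contDiff
  refine (h2.comp_contDiffOn h1).congr fun y _ => ?_
  exact (DFunLike.congr_fun hr (f y)).symm

variable {E : Type*} [NormedAddCommGroup E] [NormedSpace ℝ E] {V : Type*} [NormedAddCommGroup V]
  [NormedSpace ℝ V]

/-- The exterior derivative of `⟨L ∧ R⟩` for `1`-forms `L` and `R` with values in `E`. -/
theorem extDeriv_wedge_apply (b : E →L[ℝ] E →L[ℝ] ℝ) {L R : V → V →L[ℝ] E} {y : V}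
    {η : V → V [⋀^Fin 2]→L[ℝ] ℝ} (hL : DifferentiableAt ℝ L y) (hR : DifferentiableAt ℝ R y)
    (hη : DifferentiableAt ℝ η y)
    (h : ∀ᶠ z in 𝓝 y, ∀ u, η z u = b (L z (u 0)) (R z (u 1)) - b (L z (u 1)) (R z (u 0)))
    (v : Fin 3 → V) :
    extDeriv η y v =
      b (fderiv ℝ L y (v 0) (v 1) - fderiv ℝ L y (v 1) (v 0)) (R y (v 2))
      - b (fderiv ℝ L y (v 0) (v 2) - fderiv ℝ L y (v 2) (v 0)) (R y (v 1))
      + b (fderiv ℝ L y (v 1) (v 2) - fderiv ℝ L y (v 2) (v 1)) (R y (v 0))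
      - (b (L y (v 0)) (fderiv ℝ R y (v 1) (v 2) - fderiv ℝ R y (v 2) (v 1))
      - b (L y (v 1)) (fderiv ℝ R y (v 0) (v 2) - fderiv ℝ R y (v 2) (v 0))
      + b (L y (v 2)) (fderiv ℝ R y (v 0) (v 1) - fderiv ℝ R y (v 1) (v 0))) := by
  have hd : ∀ (u : Fin 2 → V) (t : V), fderiv ℝ (fun z => η z u) y t =
      b (fderiv ℝ L y t (u 0)) (R y (u 1)) + b (L y (u 0)) (fderiv ℝ R y t (u 1))
      - (b (fderiv ℝ L y t (u 1)) (R y (u 0)) + b (L y (u 1)) (fderiv ℝ R y t (u 0))) := by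
    intro u t
    have h1 : ∀ a c : V, HasFDerivAt (fun z => b (L z a) (R z c)) _ y := fun a c =>
      b.hasFDerivAt_of_bilinear (hL.hasFDerivAt.clm_apply (hasFDerivAt_const a y))
        (hR.hasFDerivAt.clm_apply (hasFDerivAt_const c y))
    have h2 : (fun z => η z u) =ᶠ[𝓝 y] fun z => b (L z (u 0)) (R z (u 1)) -
        b (L z (u 1)) (R z (u 0)) := h.mono fun z hz => hz u
    rw [h2.fderiv_eq, HasFDerivAt.fderiv ((h1 (u 0) (u 1)).fun_sub (h1 (u 1) (u 0)))]
    simp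
    ring
  rw [extDeriv_apply hη, Fin.sum_univ_three]
  simp only [hd]
  simp [Fin.removeNth, Fin.succAbove]
  ring

/-- The exterior derivative of `(1/6)⟨L, [L, L]⟩` for a `1`-form `L` with values in a quadratic
Lie algebra which satisfies the Maurer-Cartan equation vanishes. -/
theorem extDeriv_triple_eq_zero (b : E →L[ℝ] E →L[ℝ] ℝ) (br : E →L[ℝ] E →L[ℝ] E)
    (hsymm : ∀ x y, b x y = b y x) (hskew : ∀ x y, br x y = - br y x)
    (hinv : ∀ x y z, b (br x y) z + b y (br x z) = 0)
    (hjac : ∀ x y z, br x (br y z) = br (br x y) z + br y (br x z))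
    {L : V → V →L[ℝ] E} {y : V}
    {η : V → V [⋀^Fin 3]→L[ℝ] ℝ} (hL : DifferentiableAt ℝ L y)
    (hη : DifferentiableAt ℝ η y)
    (h : ∀ᶠ z in 𝓝 y, ∀ u, η z u = b (L z (u 0)) (br (L z (u 1)) (L z (u 2))))
    (hMC : ∀ u w, fderiv ℝ L y u w - fderiv ℝ L y w u = - br (L y u) (L y w))
    (v : Fin 4 → V) : extDeriv η y v = 0 := by
  have hd : ∀ (u : Fin 3 → V) (t : V), fderiv ℝ (fun z => η z u) y t =
      b (fderiv ℝ L y t (u 0)) (br (L y (u 1)) (L y (u 2)))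
      + b (fderiv ℝ L y t (u 1)) (br (L y (u 2)) (L y (u 0)))
      + b (fderiv ℝ L y t (u 2)) (br (L y (u 0)) (L y (u 1))) := by
    intro u t
    have h1 : ∀ a : V, HasFDerivAt (fun z => L z a) _ y := fun a =>
      hL.hasFDerivAt.clm_apply (hasFDerivAt_const a y)
    have h2 : (fun z => η z u) =ᶠ[𝓝 y] fun z => b (L z (u 0)) (br (L z (u 1)) (L z (u 2))) :=
      h.mono fun z hz => hz u
    rw [h2.fderiv_eq, HasFDerivAt.fderiv (b.hasFDerivAt_of_bilinear (h1 (u 0))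
      (br.hasFDerivAt_of_bilinear (h1 (u 1)) (h1 (u 2))))]
    simp
    -- By cyclicity the derivative falling on any slot can be moved to the first one.
    have e1 : ∀ x y z, b x (br y z) = b z (br x y) := fun x y z => by
      have := hinv y x z
      rw [hskew y x] at this
      simp at this
      rw [hsymm z]
      linarith
    rw [e1 _ (L y (u 1)), e1 (L y (u 0)) (fderiv ℝ L y t (u 1)), e1 (L y (u 2))]
    ring
  -- The Maurer–Cartan equation trades half of the derivatives for the other half plus brackets. The
  -- derivatives then cancel and only products of two brackets remain.
  have hX : ∀ u w, fderiv ℝ L y w u = fderiv ℝ L y u w + br (L y u) (L y w) := fun u w => by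
    have := hMC u w
    rw [sub_eq_iff_eq_add] at this
    rw [this]
    abel
  have e2 : ∀ x y z, b (br x y) z = b x (br y z) := fun x y z => by
    have := hinv y x z
    rw [hskew y x, map_neg, neg_apply] at this
    linarith
  rw [extDeriv_apply hη, Fin.sum_univ_four]
  simp only [hd]
  simp [Fin.removeNth, Fin.succAbove]
  rw [hX (v 0) (v 1), hX (v 0) (v 2), hX (v 0) (v 3), hX (v 1) (v 2), hX (v 1) (v 3),
    hX (v 2) (v 3)]
  simp only [map_add, add_apply]
  ring_nf
  rw [hskew (L y (v 3)) (L y (v 1)), hskew (L y (v 2)) (L y (v 0)),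
    hskew (L y (v 3)) (L y (v 0))]
  simp only [map_neg]
  rw [hsymm (br (L y (v 1)) (L y (v 2))), hsymm (br (L y (v 1)) (L y (v 3))),
    hsymm (br (L y (v 2)) (L y (v 3)))]
  simp only [e2]
  -- With every term brought to the form `⟨L v₀, nested bracket⟩`, the remaining sum vanishes by the
  -- Jacobi identity.
  rw [hjac (L y (v 1)), hskew (br (L y (v 1)) (L y (v 2))) (L y (v 3)), map_add, map_neg]
  ring

end AlternatingForms

/-! ### Values of the alternatizations -/

section FormValues

variable {E : Type v} [NormedAddCommGroup E] [NormedSpace ℝ E] [FiniteDimensional ℝ E]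
  {G : Type u} [TopologicalSpace G] [ChartedSpace E G] [Group G]
  {V : Type*} [AddCommGroup V] [Module ℝ V] [TopologicalSpace V]

theorem pairingMultilinear_alternatization_apply
    (B : LinearMap.BilinForm ℝ (GroupLieAlgebra 𝓘(ℝ, E) G))
    (a b : V →L[ℝ] GroupLieAlgebra 𝓘(ℝ, E) G) (u : Fin 2 → V) :
    (pairingMultilinear B a b).alternatization u =
      B (a (u 0)) (b (u 1)) - B (a (u 1)) (b (u 0)) := by
  rw [ContinuousMultilinearMap.alternatization_apply_apply]
  rw [show (Finset.univ : Finset (Equiv.Perm (Fin 2))) = {1, Equiv.swap 0 1} from by decide,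
    Finset.sum_pair (by decide), Equiv.Perm.sign_one, Equiv.Perm.sign_swap (by decide)]
  rw [one_smul, Units.neg_smul, one_smul, sub_eq_add_neg]
  rfl

variable [LieGroup 𝓘(ℝ, E) ∞ G]

theorem IsQuadratic.cyclic {B : LinearMap.BilinForm ℝ (GroupLieAlgebra 𝓘(ℝ, E) G)}
    (hB : IsQuadratic B) (x y z : GroupLieAlgebra 𝓘(ℝ, E) G) :
    B x ⁅y, z⁆ = B ⁅x, y⁆ z := by
  have h := hB.invariant y x z
  rw [← lie_skew y x, map_neg, LinearMap.neg_apply] at h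
  linarith

/-- Invariance makes the trilinear map already alternating, so alternatization multiplies it by `3!
= 6`, which the factor `1/6` cancels. -/
theorem IsQuadratic.pairingBracket_alternatization_apply
    {B : LinearMap.BilinForm ℝ (GroupLieAlgebra 𝓘(ℝ, E) G)} (hB : IsQuadratic B)
    (a : V →L[ℝ] GroupLieAlgebra 𝓘(ℝ, E) G) (u : Fin 3 → V) :
    ((1 / 6 : ℝ) • (pairingBracketMultilinear B a).alternatization) u =
      B (a (u 0)) ⁅a (u 1), a (u 2)⁆ := by
  let T : V [⋀^Fin 3]→ₗ[ℝ] ℝ :=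
    { (pairingBracketMultilinear B a).toMultilinearMap with
      map_eq_zero_of_eq' := by
        intro v i j hij hne
        change B (a (v 0)) ⁅a (v 1), a (v 2)⁆ = 0
        have h01 : v 0 = v 1 → B (a (v 0)) ⁅a (v 1), a (v 2)⁆ = 0 := fun h => by
          rw [h, hB.cyclic, lie_self, map_zero, LinearMap.zero_apply]
        have h12 : v 1 = v 2 → B (a (v 0)) ⁅a (v 1), a (v 2)⁆ = 0 := fun h => by
          rw [h, lie_self, map_zero]
        have h02 : v 0 = v 2 → B (a (v 0)) ⁅a (v 1), a (v 2)⁆ = 0 := fun h => by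
          have h1 := hB.cyclic (a (v 2)) (a (v 1)) (a (v 2))
          rw [← lie_skew (a (v 1)) (a (v 2)), map_neg, hB.symm ⁅a (v 2), _⁆] at h1
          rw [h, ← lie_skew (a (v 1)) (a (v 2)), map_neg]
          linarith
        fin_cases i <;> fin_cases j <;> simp at hij hne <;>
          first
          | exact h01 hij
          | exact h12 hij
          | exact h02 hij
          | exact h01 hij.symm
          | exact h12 hij.symm
          | exact h02 hij.symm }
  have hperm : ∀ σ : Equiv.Perm (Fin 3), pairingBracketMultilinear B a (u ∘ σ) =
      Equiv.Perm.sign σ • pairingBracketMultilinear B a u := fun σ => T.map_perm u σ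
  rw [ContinuousAlternatingMap.smul_apply, ContinuousMultilinearMap.alternatization_apply_apply]
  simp only [hperm, smul_smul, Int.units_mul_self, one_smul, Finset.sum_const,
    Finset.card_univ, Fintype.card_perm, Fintype.card_fin]
  rw [Nat.factorial, Nat.factorial, Nat.factorial, Nat.factorial, nsmul_eq_mul, smul_eq_mul,
    ← mul_assoc]
  norm_num
  rfl

end FormValues

/-! ### Maurer–Cartan forms and de Rham differentials in charts -/

section ChartExpressions

variable {E : Type*} [NormedAddCommGroup E] [NormedSpace ℝ E]
  {G : Type*} [TopologicalSpace G] [ChartedSpace E G] [Group G] [LieGroup 𝓘(ℝ, E) ∞ G]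
  {V : Type*} [NormedAddCommGroup V] [NormedSpace ℝ V]
  {M : Type*} [TopologicalSpace M] [ChartedSpace V M]

theorem HasTangentMap.leftLog_eq {ψ : V → G} {y : V} {L : V →L[ℝ] E}
    (h : HasTangentMap (fun z => (ψ y)⁻¹ * ψ z) y 1 L) : leftLog E ψ y = L :=
  h.hasFDerivAt_chart.fderiv

theorem HasTangentMap.rightLog_eq {ψ : V → G} {y : V} {L : V →L[ℝ] E}
    (h : HasTangentMap (fun z => ψ z * (ψ y)⁻¹) y 1 L) : rightLog E ψ y = L :=
  h.hasFDerivAt_chart.fderiv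

variable [IsManifold 𝓘(ℝ, V) ∞ M]

omit [Group G] [LieGroup 𝓘(ℝ, E) ∞ G] in
theorem contMDiffOn_comp_chartAt_symm {f : M → G} (hf : ContMDiff 𝓘(ℝ, V) 𝓘(ℝ, E) ∞ f) (x₀ : M) :
    ContMDiffOn 𝓘(ℝ, V) 𝓘(ℝ, E) ∞ (fun z => f ((chartAt V x₀).symm z)) (chartAt V x₀).target :=
  fun _ hy => ((hf _).comp _ (contMDiffAt_chart_symm x₀ hy)).contMDiffWithinAt

/-- This moves pullbacks of `θ^l` from a manifold to a vector space, where the Maurer–Cartan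
equation is available for logarithmic derivatives. -/
theorem thetaLeft_chart {f : M → G} (hf : ContMDiff 𝓘(ℝ, V) 𝓘(ℝ, E) ∞ f) {x₀ : M} {y : V}
    (hy : y ∈ (chartAt V x₀).target) (v : V) :
    thetaLeft (V := V) E f ((chartAt V x₀).symm y)
      ((mfderiv 𝓘(ℝ, V) 𝓘(ℝ, V) (chartAt V x₀).symm y : V →L[ℝ] V) v) =
      leftLog E (fun z => f ((chartAt V x₀).symm z)) y v := by
  have h := (((contMDiffAt_chart_symm x₀ hy).mdifferentiableAt (by simp)).hasTangentMap
    (y := (chartAt V x₀).symm y) rfl)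
  rw [HasTangentMap.leftLog_eq (E := E) (ψ := fun z => f ((chartAt V x₀).symm z))
    ((hasTangentMap_thetaLeft (V := V)
    ((hf ((chartAt V x₀).symm y)).mdifferentiableAt (by simp))).comp h)]
  rfl

theorem thetaRight_chart {f : M → G} (hf : ContMDiff 𝓘(ℝ, V) 𝓘(ℝ, E) ∞ f) {x₀ : M} {y : V}
    (hy : y ∈ (chartAt V x₀).target) (v : V) :
    thetaRight (V := V) E f ((chartAt V x₀).symm y)
      ((mfderiv 𝓘(ℝ, V) 𝓘(ℝ, V) (chartAt V x₀).symm y : V →L[ℝ] V) v) =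
      rightLog E (fun z => f ((chartAt V x₀).symm z)) y v := by
  have h := (((contMDiffAt_chart_symm x₀ hy).mdifferentiableAt (by simp)).hasTangentMap
    (y := (chartAt V x₀).symm y) rfl)
  rw [HasTangentMap.rightLog_eq (E := E) (ψ := fun z => f ((chartAt V x₀).symm z))
    ((hasTangentMap_thetaRight (V := V)
    ((hf ((chartAt V x₀).symm y)).mdifferentiableAt (by simp))).comp h)]
  rfl

theorem leftLog_chart_self {f : M → G} (hf : ContMDiff 𝓘(ℝ, V) 𝓘(ℝ, E) ∞ f) (x : M) :
    leftLog E (fun z => f ((chartAt V x).symm z)) (chartAt V x x) = thetaLeft (V := V) E f x := by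
  refine HasTangentMap.leftLog_eq (E := E) ?_
  rw [(chartAt V x).left_inv (mem_chart_source V x)]
  exact (hasTangentMap_thetaLeft (V := V)
    ((hf x).mdifferentiableAt (by simp))).comp (hasTangentMap_chartAt_symm x)

theorem rightLog_chart_self {f : M → G} (hf : ContMDiff 𝓘(ℝ, V) 𝓘(ℝ, E) ∞ f) (x : M) :
    rightLog E (fun z => f ((chartAt V x).symm z)) (chartAt V x x) =
      thetaRight (V := V) E f x := by
  refine HasTangentMap.rightLog_eq (E := E) ?_
  rw [(chartAt V x).left_inv (mem_chart_source V x)]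
  exact (hasTangentMap_thetaRight (V := V)
    ((hf x).mdifferentiableAt (by simp))).comp (hasTangentMap_chartAt_symm x)

/-- The preferred chart at `x` has identity differential there, so the outer pullback in the
definition of `d` does nothing. -/
theorem DForm.d_apply {k : ℕ} (η : DForm V M k) (x : M) (v : Fin (k + 1) → V) :
    DForm.d η x v = extDeriv (DForm.inChart η x) (chartAt V x x) v := by
  have h : (mfderiv 𝓘(ℝ, V) 𝓘(ℝ, V) (chartAt V x) x : V →L[ℝ] V) = ContinuousLinearMap.id ℝ V :=
    (hasTangentMap_chartAt x).mfderiv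
  change extDeriv (DForm.inChart η x) (chartAt V x x)
    (fun i => (mfderiv 𝓘(ℝ, V) 𝓘(ℝ, V) (chartAt V x) x : V →L[ℝ] V) (v i)) = _
  rw [h]
  rfl

omit [IsManifold 𝓘(ℝ, V) ∞ M] in
theorem DForm.IsSmooth.differentiableAt {k : ℕ} {η : DForm V M k} (h : η.IsSmooth) (x : M) :
    DifferentiableAt ℝ (DForm.inChart η x) (chartAt V x x) :=
  ((h x).contDiffAt ((chartAt V x).open_target.mem_nhds (mem_chart_target V x))).differentiableAt
    (by simp)

omit [IsManifold 𝓘(ℝ, V) ∞ M] in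
theorem DForm.isSmooth_zero {k : ℕ} : DForm.IsSmooth (0 : DForm V M k) := fun x₀ => by
  have h : DForm.inChart (0 : DForm V M k) x₀ = fun _ => 0 := rfl
  rw [h]
  exact contDiffOn_const

omit [IsManifold 𝓘(ℝ, V) ∞ M] in
theorem DForm.inChart_neg {k : ℕ} (η : DForm V M k) (x₀ : M) :
    DForm.inChart (-η) x₀ = -DForm.inChart η x₀ := rfl

omit [IsManifold 𝓘(ℝ, V) ∞ M] in
theorem DForm.IsSmooth.neg {k : ℕ} {η : DForm V M k} (h : η.IsSmooth) :
    DForm.IsSmooth (-η) := fun x₀ => by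
  rw [DForm.inChart_neg]
  exact (h x₀).neg

theorem DForm.d_smul {k : ℕ} (c : ℝ) (η : DForm V M k) : DForm.d (c • η) = c • DForm.d η := by
  funext x
  ext v
  have h : DForm.inChart (c • η) x = c • DForm.inChart η x := rfl
  refine (DForm.d_apply (c • η) x v).trans ?_
  rw [h, extDeriv_smul]
  exact congrArg (c • ·) (DForm.d_apply η x v).symm

theorem DForm.d_zero {k : ℕ} : DForm.d (0 : DForm V M k) = 0 := by
  have h := DForm.d_smul 0 (0 : DForm V M k)
  rwa [zero_smul, zero_smul] at h

omit [IsManifold 𝓘(ℝ, V) ∞ M] in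
theorem DForm.neg_one_smul_eq {k : ℕ} (η : DForm V M k) : (-1 : ℝ) • η = -η := by
  funext x
  ext v
  exact neg_one_mul (η x v)

theorem DForm.d_neg {k : ℕ} (η : DForm V M k) : DForm.d (-η) = -DForm.d η := by
  have h := DForm.d_smul (-1) η
  rwa [DForm.neg_one_smul_eq, DForm.neg_one_smul_eq] at h

end ChartExpressions

/-! ### Smoothness and differentials of the two kinds of forms -/

section InvariantForms

variable {E : Type*} [NormedAddCommGroup E] [NormedSpace ℝ E] [FiniteDimensional ℝ E]
  {G : Type*} [TopologicalSpace G] [ChartedSpace E G] [Group G] [LieGroup 𝓘(ℝ, E) ∞ G]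
  {V : Type*} [NormedAddCommGroup V] [NormedSpace ℝ V] [FiniteDimensional ℝ V]
  {M : Type*} [TopologicalSpace M] [ChartedSpace V M] [IsManifold 𝓘(ℝ, V) ∞ M]

/-- The bracket of the Lie algebra of `G` as a continuous bilinear map on the model space. -/
theorem exists_continuous_bracket (E : Type*) [NormedAddCommGroup E] [NormedSpace ℝ E]
    [FiniteDimensional ℝ E] (G : Type*) [TopologicalSpace G] [ChartedSpace E G] [Group G]
    [LieGroup 𝓘(ℝ, E) ∞ G] :
    ∃ br : E →L[ℝ] E →L[ℝ] E, ∀ v w, br v w = modelBracket E G v w := by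
  have : CompleteSpace E := FiniteDimensional.complete ℝ E
  let br : GroupLieAlgebra 𝓘(ℝ, E) G →ₗ[ℝ] GroupLieAlgebra 𝓘(ℝ, E) G →ₗ[ℝ]
      GroupLieAlgebra 𝓘(ℝ, E) G :=
    LinearMap.mk₂ ℝ (fun a b => ⁅a, b⁆) add_lie smul_lie lie_add (fun c a b => lie_smul c a b)
  exact ⟨LinearMap.toContinuousLinearMap (E := E) (F' := E →L[ℝ] E)
    ((LinearMap.toContinuousLinearMap (E := E) (F' := E)).toLinearMap ∘ₗ
      (br : E →ₗ[ℝ] E →ₗ[ℝ] E)), fun _ _ => rfl⟩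

variable (b : E →L[ℝ] E →L[ℝ] ℝ) {f h : M → G}

omit [FiniteDimensional ℝ E] [FiniteDimensional ℝ V] in
theorem inChart_wedge_apply {η : DForm V M 2} (hf : ContMDiff 𝓘(ℝ, V) 𝓘(ℝ, E) ∞ f)
    (hh : ContMDiff 𝓘(ℝ, V) 𝓘(ℝ, E) ∞ h)
    (hη : ∀ x (u : Fin 2 → V), η x u = b (thetaLeft E f x (u 0)) (thetaRight E h x (u 1)) -
      b (thetaLeft E f x (u 1)) (thetaRight E h x (u 0))) (x₀ : M) {y : V}
    (hy : y ∈ (chartAt V x₀).target) (u : Fin 2 → V) :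
    DForm.inChart η x₀ y u =
      b (leftLog E (fun z => f ((chartAt V x₀).symm z)) y (u 0))
        (rightLog E (fun z => h ((chartAt V x₀).symm z)) y (u 1)) -
      b (leftLog E (fun z => f ((chartAt V x₀).symm z)) y (u 1))
        (rightLog E (fun z => h ((chartAt V x₀).symm z)) y (u 0)) := by
  simp only [← thetaLeft_chart hf hy, ← thetaRight_chart hh hy]
  exact hη _ fun i => (mfderiv 𝓘(ℝ, V) 𝓘(ℝ, V) (chartAt V x₀).symm y : V →L[ℝ] V) (u i)

omit [FiniteDimensional ℝ E] in
theorem isSmooth_wedge {η : DForm V M 2} (hf : ContMDiff 𝓘(ℝ, V) 𝓘(ℝ, E) ∞ f)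
    (hh : ContMDiff 𝓘(ℝ, V) 𝓘(ℝ, E) ∞ h)
    (hη : ∀ x (u : Fin 2 → V), η x u = b (thetaLeft E f x (u 0)) (thetaRight E h x (u 1)) -
      b (thetaLeft E f x (u 1)) (thetaRight E h x (u 0))) : η.IsSmooth := fun x₀ => by
  refine contDiffOn_alternating_of_apply fun u => ?_
  have hU := (chartAt V x₀).open_target
  have h1 := contDiffOn_leftLog hU (contMDiffOn_comp_chartAt_symm hf x₀)
  have h2 := contDiffOn_rightLog hU (contMDiffOn_comp_chartAt_symm hh x₀)
  have h3 : ∀ a c : V, ContDiffOn ℝ ∞ (fun y =>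
      b (leftLog E (fun z => f ((chartAt V x₀).symm z)) y a)
        (rightLog E (fun z => h ((chartAt V x₀).symm z)) y c)) (chartAt V x₀).target := fun a c =>
    (contDiffOn_const.clm_apply (h1.clm_apply contDiffOn_const)).clm_apply
      (h2.clm_apply contDiffOn_const)
  exact ((h3 (u 0) (u 1)).sub (h3 (u 1) (u 0))).congr fun y hy =>
    inChart_wedge_apply b hf hh hη x₀ hy u

/-- The Leibniz rule, with the derivatives of `θ^l` and `θ^r` replaced by brackets: the
Maurer–Cartan equations carry a minus sign for `θ^l` and a plus sign for `θ^r`. -/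
theorem d_wedge_apply {η : DForm V M 2} (hf : ContMDiff 𝓘(ℝ, V) 𝓘(ℝ, E) ∞ f)
    (hh : ContMDiff 𝓘(ℝ, V) 𝓘(ℝ, E) ∞ h)
    (hη : ∀ x (u : Fin 2 → V), η x u = b (thetaLeft E f x (u 0)) (thetaRight E h x (u 1)) -
      b (thetaLeft E f x (u 1)) (thetaRight E h x (u 0))) (x : M) (v : Fin 3 → V) :
    DForm.d η x v =
      - b (modelBracket E G (thetaLeft E f x (v 0)) (thetaLeft E f x (v 1)))
        (thetaRight E h x (v 2))
      + b (modelBracket E G (thetaLeft E f x (v 0)) (thetaLeft E f x (v 2)))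
        (thetaRight E h x (v 1))
      - b (modelBracket E G (thetaLeft E f x (v 1)) (thetaLeft E f x (v 2)))
        (thetaRight E h x (v 0))
      - b (thetaLeft E f x (v 0))
        (modelBracket E G (thetaRight E h x (v 1)) (thetaRight E h x (v 2)))
      + b (thetaLeft E f x (v 1))
        (modelBracket E G (thetaRight E h x (v 0)) (thetaRight E h x (v 2)))
      - b (thetaLeft E f x (v 2))
        (modelBracket E G (thetaRight E h x (v 0)) (thetaRight E h x (v 1))) := by
  have : CompleteSpace E := FiniteDimensional.complete ℝ E
  have hx := (chartAt V x).open_target.mem_nhds (mem_chart_target V x)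
  have hU := (chartAt V x).open_target
  have h1 := contDiffOn_leftLog hU (contMDiffOn_comp_chartAt_symm hf x)
  have h2 := contDiffOn_rightLog hU (contMDiffOn_comp_chartAt_symm hh x)
  rw [DForm.d_apply, extDeriv_wedge_apply b ((h1.contDiffAt hx).differentiableAt (by simp))
    ((h2.contDiffAt hx).differentiableAt (by simp))
    ((isSmooth_wedge b hf hh hη).differentiableAt x)
    (by filter_upwards [hx] with y hy u using inChart_wedge_apply b hf hh hη x hy u)]
  have c1 := (contMDiffOn_comp_chartAt_symm hf x).contMDiffAt hx
  have c2 := (contMDiffOn_comp_chartAt_symm hh x).contMDiffAt hx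
  simp only [fderiv_leftLog c1, fderiv_rightLog c2, leftLog_chart_self hf, rightLog_chart_self hh,
    map_neg, neg_apply]
  ring

omit [FiniteDimensional ℝ E] [FiniteDimensional ℝ V] in
theorem inChart_triple_apply {η : DForm V M 3} (hf : ContMDiff 𝓘(ℝ, V) 𝓘(ℝ, E) ∞ f)
    (hη : ∀ x (u : Fin 3 → V), η x u = b (thetaLeft E f x (u 0))
      (modelBracket E G (thetaLeft E f x (u 1)) (thetaLeft E f x (u 2)))) (x₀ : M) {y : V}
    (hy : y ∈ (chartAt V x₀).target) (u : Fin 3 → V) :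
    DForm.inChart η x₀ y u =
      b (leftLog E (fun z => f ((chartAt V x₀).symm z)) y (u 0))
        (modelBracket E G (leftLog E (fun z => f ((chartAt V x₀).symm z)) y (u 1))
          (leftLog E (fun z => f ((chartAt V x₀).symm z)) y (u 2))) := by
  simp only [← thetaLeft_chart hf hy]
  exact hη _ fun i => (mfderiv 𝓘(ℝ, V) 𝓘(ℝ, V) (chartAt V x₀).symm y : V →L[ℝ] V) (u i)

theorem isSmooth_triple {η : DForm V M 3} (hf : ContMDiff 𝓘(ℝ, V) 𝓘(ℝ, E) ∞ f)
    (hη : ∀ x (u : Fin 3 → V), η x u = b (thetaLeft E f x (u 0))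
      (modelBracket E G (thetaLeft E f x (u 1)) (thetaLeft E f x (u 2)))) :
    η.IsSmooth := fun x₀ => by
  obtain ⟨br, hbr⟩ := exists_continuous_bracket E G
  refine contDiffOn_alternating_of_apply fun u => ?_
  have h1 := contDiffOn_leftLog (chartAt V x₀).open_target (contMDiffOn_comp_chartAt_symm hf x₀)
  refine ContDiffOn.congr ?_ fun y hy => (inChart_triple_apply b hf hη x₀ hy u)
  simp only [← hbr]
  exact (contDiffOn_const.clm_apply (h1.clm_apply contDiffOn_const)).clm_apply
    ((contDiffOn_const.clm_apply (h1.clm_apply contDiffOn_const)).clm_apply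
      (h1.clm_apply contDiffOn_const))

theorem d_triple_eq_zero {B : LinearMap.BilinForm ℝ (GroupLieAlgebra 𝓘(ℝ, E) G)}
    (hB : IsQuadratic B) (hb : ∀ v w : E, b v w = B v w)
    {η : DForm V M 3} (hf : ContMDiff 𝓘(ℝ, V) 𝓘(ℝ, E) ∞ f)
    (hη : ∀ x (u : Fin 3 → V), η x u = b (thetaLeft E f x (u 0))
      (modelBracket E G (thetaLeft E f x (u 1)) (thetaLeft E f x (u 2)))) :
    DForm.d η = 0 := by
  have : CompleteSpace E := FiniteDimensional.complete ℝ E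
  obtain ⟨br, hbr⟩ := exists_continuous_bracket E G
  funext x
  ext v
  have hx := (chartAt V x).open_target.mem_nhds (mem_chart_target V x)
  have h1 := contDiffOn_leftLog (chartAt V x).open_target (contMDiffOn_comp_chartAt_symm hf x)
  refine (DForm.d_apply η x v).trans (extDeriv_triple_eq_zero b br ?_ ?_ ?_ ?_
    ((h1.contDiffAt hx).differentiableAt (by simp)) ((isSmooth_triple b hf hη).differentiableAt x)
    (by filter_upwards [hx] with y hy u using by
          simpa only [hbr] using inChart_triple_apply b hf hη x hy u) ?_ v)
  · exact fun v w => by rw [hb, hb]; exact hB.symm v w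
  · intro v w
    rw [hbr, hbr]
    exact (lie_skew (L := GroupLieAlgebra 𝓘(ℝ, E) G) v w).symm
  · intro v w z
    rw [hb, hb, hbr, hbr]
    exact hB.invariant v w z
  · intro v w z
    simp only [hbr]
    exact leibniz_lie (L₁ := GroupLieAlgebra 𝓘(ℝ, E) G) (L₂ := GroupLieAlgebra 𝓘(ℝ, E) G)
      (M := GroupLieAlgebra 𝓘(ℝ, E) G) v w z
  · intro v w
    rw [hbr]
    exact fderiv_leftLog ((contMDiffOn_comp_chartAt_symm hf x).contMDiffAt hx) v w

end InvariantForms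

/-! ### Naturality of the pulled back Maurer–Cartan forms -/

section ThetaPullback

variable {E : Type*} [NormedAddCommGroup E] [NormedSpace ℝ E]
  {G : Type*} [TopologicalSpace G] [ChartedSpace E G] [Group G] [LieGroup 𝓘(ℝ, E) ∞ G]
  {V W : Type*} [NormedAddCommGroup V] [NormedSpace ℝ V] [NormedAddCommGroup W] [NormedSpace ℝ W]
  {M N : Type*} [TopologicalSpace M] [ChartedSpace V M] [TopologicalSpace N] [ChartedSpace W N]

theorem thetaLeft_comp {f : N → G} {F : M → N} {x : M}
    (hf : MDifferentiableAt 𝓘(ℝ, W) 𝓘(ℝ, E) f (F x))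
    (hF : MDifferentiableAt 𝓘(ℝ, V) 𝓘(ℝ, W) F x) :
    thetaLeft (V := V) E (fun y => f (F y)) x =
      (thetaLeft (V := W) E f (F x)).comp (mfderiv 𝓘(ℝ, V) 𝓘(ℝ, W) F x : V →L[ℝ] W) :=
  (hasTangentMap_thetaLeft (hf.comp x hF)).unique (y' := 1)
    ((hasTangentMap_thetaLeft hf).comp (hF.hasTangentMap rfl))

theorem thetaRight_comp {f : N → G} {F : M → N} {x : M}
    (hf : MDifferentiableAt 𝓘(ℝ, W) 𝓘(ℝ, E) f (F x))
    (hF : MDifferentiableAt 𝓘(ℝ, V) 𝓘(ℝ, W) F x) :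
    thetaRight (V := V) E (fun y => f (F y)) x =
      (thetaRight (V := W) E f (F x)).comp (mfderiv 𝓘(ℝ, V) 𝓘(ℝ, W) F x : V →L[ℝ] W) :=
  (hasTangentMap_thetaRight (hf.comp x hF)).unique (y' := 1)
    ((hasTangentMap_thetaRight hf).comp (hF.hasTangentMap rfl))

theorem thetaLeft_const (g : G) (x : M) : thetaLeft (V := V) E (fun _ : M => g) x = 0 :=
  (hasTangentMap_thetaLeft (mdifferentiableAt_const)).unique (y' := (1 : G))
    ((HasTangentMap.const x (1 : G)).congr (.of_forall fun _ => by simp))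

theorem thetaRight_const (g : G) (x : M) : thetaRight (V := V) E (fun _ : M => g) x = 0 :=
  (hasTangentMap_thetaRight (mdifferentiableAt_const)).unique (y' := (1 : G))
    ((HasTangentMap.const x (1 : G)).congr (.of_forall fun _ => by simp))

theorem thetaLeft_mul_apply {f h : M → G} {x : M} (hf : MDifferentiableAt 𝓘(ℝ, V) 𝓘(ℝ, E) f x)
    (hh : MDifferentiableAt 𝓘(ℝ, V) 𝓘(ℝ, E) h x)
    (hfh : MDifferentiableAt 𝓘(ℝ, V) 𝓘(ℝ, E) (fun z => f z * h z) x) (v : V) :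
    thetaLeft (V := V) E (fun z => f z * h z) x v =
      modelAd E (h x)⁻¹ (thetaLeft E f x v + thetaRight E h x v) := by
  rw [thetaLeft_mul hf hh hfh]
  rfl

theorem DForm.ext_apply {k : ℕ} {η η' : DForm V M k} (h : ∀ x (u : Fin k → V), η x u = η' x u) :
    η = η' := by
  funext x
  ext u
  exact h x u

/-- The adjoint transformation of `θ^r`. -/
theorem modelAd_inv_thetaRight {f : M → G} {x : M}
    (hf : MDifferentiableAt 𝓘(ℝ, V) 𝓘(ℝ, E) f x) (v : V) :
    modelAd E (f x)⁻¹ (thetaRight (V := V) E f x v) = thetaLeft E f x v := by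
  rw [thetaRight_eq hf]
  exact modelAd_inv_apply _ _

end ThetaPullback

/-! ### The forms on the nerve and `δΩ = 0` -/

section NerveForms

variable {E : Type v} [NormedAddCommGroup E] [NormedSpace ℝ E] [FiniteDimensional ℝ E]
  {G : Type u} [TopologicalSpace G] [ChartedSpace E G] [Group G] [LieGroup 𝓘(ℝ, E) ∞ G]

instance finiteDimensional_nerve (n : ℕ) : FiniteDimensional ℝ ((nerve E G).E n) :=
  inferInstanceAs (FiniteDimensional ℝ (Fin n → E))

/-- The coordinate functions on `NG_n = G^n`. -/
def nerveCoord (E : Type v) [NormedAddCommGroup E] [NormedSpace ℝ E] [CompleteSpace E]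
    {G : Type u} [TopologicalSpace G] [ChartedSpace E G] [Group G] [LieGroup 𝓘(ℝ, E) ∞ G]
    {n : ℕ} (i : Fin n) : (nerve E G).X n → G := fun x => (x : Fin n → G) i

omit [FiniteDimensional ℝ E] in
theorem contMDiff_nerveCoord [CompleteSpace E] {n : ℕ} (i : Fin n) :
    ContMDiff 𝓘(ℝ, (nerve E G).E n) 𝓘(ℝ, E) ∞ (nerveCoord (G := G) E i) :=
  let _ := powChartedSpace E G n
  contMDiff_pow_apply (E := E) (G := G) i

omit [FiniteDimensional ℝ E] in
theorem mdifferentiableAt_nerveCoord [CompleteSpace E] {n : ℕ} (i : Fin n) (x : (nerve E G).X n) :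
    MDifferentiableAt 𝓘(ℝ, (nerve E G).E n) 𝓘(ℝ, E) (nerveCoord (G := G) E i) x :=
  (contMDiff_nerveCoord i x).mdifferentiableAt (by simp)

omit [FiniteDimensional ℝ E] in
theorem mdifferentiableAt_nerveCoord_mul [CompleteSpace E] {n : ℕ} (i j : Fin n)
    (x : (nerve E G).X n) :
    MDifferentiableAt 𝓘(ℝ, (nerve E G).E n) 𝓘(ℝ, E)
      (fun y => nerveCoord (G := G) E i y * nerveCoord E j y) x :=
  (((contMDiff_nerveCoord i).mul (contMDiff_nerveCoord j)) x).mdifferentiableAt (by simp)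

theorem SimplicialManifold.mdifferentiableAt_face (K : SimplicialManifold.{u, v}) (l : ℕ)
    (i : Fin (l + 2)) (x : K.X (l + 1)) :
    MDifferentiableAt 𝓘(ℝ, K.E (l + 1)) 𝓘(ℝ, K.E l) (K.face l i) x :=
  (K.contMDiff_face l i x).mdifferentiableAt (by simp)

theorem SimplicialManifold.mdifferentiableAt_degen (K : SimplicialManifold.{u, v}) (l : ℕ)
    (i : Fin (l + 1)) (x : K.X l) :
    MDifferentiableAt 𝓘(ℝ, K.E l) 𝓘(ℝ, K.E (l + 1)) (K.degen l i) x :=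
  (K.contMDiff_degen l i x).mdifferentiableAt (by simp)

variable {B : LinearMap.BilinForm ℝ (GroupLieAlgebra 𝓘(ℝ, E) G)} {b : E →L[ℝ] E →L[ℝ] ℝ}

/-- The face `d_2` keeps `g₁` and `d_0` keeps `g₂`, so both pullbacks are along coordinates. -/
theorem brylinskiWeinsteinForm_apply (hb : ∀ v w : E, b v w = B v w) (x : (nerve E G).X 2)
    (u : Fin 2 → (nerve E G).E 2) :
    brylinskiWeinsteinForm B x u =
      b (thetaLeft E (nerveCoord (G := G) E (0 : Fin 2)) x (u 0))
        (thetaRight E (nerveCoord (G := G) E (1 : Fin 2)) x (u 1)) -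
      b (thetaLeft E (nerveCoord (G := G) E (0 : Fin 2)) x (u 1))
        (thetaRight E (nerveCoord (G := G) E (1 : Fin 2)) x (u 0)) := by
  rw [hb, hb]
  exact pairingMultilinear_alternatization_apply (V := (nerve E G).E 2) B _ _ u

theorem nerveCartanForm_apply (hB : IsQuadratic B) (hb : ∀ v w : E, b v w = B v w)
    (x : (nerve E G).X 1) (u : Fin 3 → (nerve E G).E 1) :
    nerveCartanForm B x u =
      b (thetaLeft E (nerveCoord (G := G) E (0 : Fin 1)) x (u 0))
        (modelBracket E G (thetaLeft E (nerveCoord (G := G) E (0 : Fin 1)) x (u 1))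
          (thetaLeft E (nerveCoord (G := G) E (0 : Fin 1)) x (u 2))) := by
  rw [hb]
  exact hB.pairingBracket_alternatization_apply (V := E) (leftMC E (nerveCoord (G := G) E 0 x))
    (fun i => (mfderiv 𝓘(ℝ, (nerve E G).E 1) 𝓘(ℝ, E) (nerveCoord (G := G) E (0 : Fin 1)) x :
      (nerve E G).E 1 →L[ℝ] E) (u i))

theorem isSmooth_brylinskiWeinsteinForm : (brylinskiWeinsteinForm B).IsSmooth := by
  obtain ⟨b, hb⟩ := exists_continuous_bilinear B
  exact isSmooth_wedge b (contMDiff_nerveCoord 0) (contMDiff_nerveCoord 1)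
    (brylinskiWeinsteinForm_apply hb)

theorem isSmooth_nerveCartanForm (hB : IsQuadratic B) : (nerveCartanForm B).IsSmooth := by
  obtain ⟨b, hb⟩ := exists_continuous_bilinear B
  exact isSmooth_triple b (contMDiff_nerveCoord 0) (nerveCartanForm_apply hB hb)

theorem d_nerveCartanForm (hB : IsQuadratic B) : (nerveCartanForm B).d = 0 := by
  obtain ⟨b, hb⟩ := exists_continuous_bilinear B
  exact d_triple_eq_zero b hB hb (contMDiff_nerveCoord 0) (nerveCartanForm_apply hB hb)

/-- A map to `G × G` enters only through its two coordinate functions. Stated for arbitrary maps,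
this serves the faces and the degeneracies alike. -/
theorem pullback_brylinskiWeinsteinForm_apply {W : Type*} [NormedAddCommGroup W] [NormedSpace ℝ W]
    {N : Type*} [TopologicalSpace N] [ChartedSpace W N] (hb : ∀ v w : E, b v w = B v w)
    {F : N → (nerve E G).X 2} {x : N}
    (hF : MDifferentiableAt 𝓘(ℝ, W) 𝓘(ℝ, (nerve E G).E 2) F x) {f h : N → G}
    (hf : ∀ y, nerveCoord E 0 (F y) = f y) (hh : ∀ y, nerveCoord E 1 (F y) = h y)
    (u : Fin 2 → W) :
    DForm.pullback (E := W) F (brylinskiWeinsteinForm B) x u =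
      b (thetaLeft E f x (u 0)) (thetaRight E h x (u 1)) -
      b (thetaLeft E f x (u 1)) (thetaRight E h x (u 0)) := by
  obtain rfl : (fun y => nerveCoord E 0 (F y)) = f := funext hf
  obtain rfl : (fun y => nerveCoord E 1 (F y)) = h := funext hh
  rw [thetaLeft_comp (mdifferentiableAt_nerveCoord _ _) hF,
    thetaRight_comp (mdifferentiableAt_nerveCoord _ _) hF]
  exact brylinskiWeinsteinForm_apply hb (F x) fun i =>
    (mfderiv 𝓘(ℝ, W) 𝓘(ℝ, (nerve E G).E 2) F x : W →L[ℝ] (nerve E G).E 2) (u i)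

theorem pullback_nerveCartanForm_apply {W : Type*} [NormedAddCommGroup W] [NormedSpace ℝ W]
    {N : Type*} [TopologicalSpace N] [ChartedSpace W N] (hB : IsQuadratic B)
    (hb : ∀ v w : E, b v w = B v w) {F : N → (nerve E G).X 1} {x : N}
    (hF : MDifferentiableAt 𝓘(ℝ, W) 𝓘(ℝ, (nerve E G).E 1) F x) {f : N → G}
    (hf : ∀ y, nerveCoord E 0 (F y) = f y) (u : Fin 3 → W) :
    DForm.pullback (E := W) F (nerveCartanForm B) x u =
      b (thetaLeft E f x (u 0))
        (modelBracket E G (thetaLeft E f x (u 1)) (thetaLeft E f x (u 2))) := by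
  obtain rfl : (fun y => nerveCoord E 0 (F y)) = f := funext hf
  rw [thetaLeft_comp (mdifferentiableAt_nerveCoord _ _) hF]
  exact nerveCartanForm_apply hB hb (F x) fun i =>
    (mfderiv 𝓘(ℝ, W) 𝓘(ℝ, (nerve E G).E 1) F x : W →L[ℝ] (nerve E G).E 1) (u i)

theorem SimplicialManifold.δ_apply (K : SimplicialManifold.{u, v}) {p q : ℕ}
    (η : DForm (K.E p) (K.X p) q) (x : K.X (p + 1)) (u : Fin q → K.E (p + 1)) :
    K.δ η x u = ∑ i : Fin (p + 2), (-1 : ℝ) ^ (i : ℕ) * DForm.pullback (K.face p i) η x u := by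
  simp only [SimplicialManifold.δ, Finset.sum_apply]
  erw [ContinuousAlternatingMap.sum_apply]
  rfl

theorem SimplicialManifold.δ_zero (K : SimplicialManifold.{u, v}) {p q : ℕ} :
    K.δ (0 : DForm (K.E p) (K.X p) q) = 0 := by
  funext x
  ext u
  refine (K.δ_apply 0 x u).trans (Finset.sum_eq_zero fun i _ => ?_)
  exact mul_zero _

/-- The form `Ω` is multiplicative. -/
theorem δ_brylinskiWeinsteinForm
    (hAd : ∀ (g : G) (v w : E), B (modelAd E g v) (modelAd E g w) = B v w) :
    (nerve E G).δ (brylinskiWeinsteinForm B) = 0 := by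
  obtain ⟨b, hb⟩ := exists_continuous_bilinear B
  simp only [← hb] at hAd
  refine DForm.ext_apply fun x u => ?_
  refine ((nerve E G).δ_apply _ x u).trans ?_
  have hF := fun i => (nerve E G).mdifferentiableAt_face 2 i x
  rw [Fin.sum_univ_four,
    pullback_brylinskiWeinsteinForm_apply hb (hF 0) (f := nerveCoord E (1 : Fin 3))
      (h := nerveCoord E (2 : Fin 3)) (fun _ => rfl) (fun _ => rfl) u,
    pullback_brylinskiWeinsteinForm_apply hb (hF 1)
      (f := fun y => nerveCoord E (0 : Fin 3) y * nerveCoord E (1 : Fin 3) y)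
      (h := nerveCoord E (2 : Fin 3)) (fun _ => rfl) (fun _ => rfl) u,
    pullback_brylinskiWeinsteinForm_apply hb (hF 2) (f := nerveCoord E (0 : Fin 3))
      (h := fun y => nerveCoord E (1 : Fin 3) y * nerveCoord E (2 : Fin 3) y)
      (fun _ => rfl) (fun _ => rfl) u,
    pullback_brylinskiWeinsteinForm_apply hb (hF 3) (f := nerveCoord E (0 : Fin 3))
      (h := nerveCoord E (1 : Fin 3)) (fun _ => rfl) (fun _ => rfl) u]
  have h0 := mdifferentiableAt_nerveCoord (0 : Fin 3) x
  have h1 := mdifferentiableAt_nerveCoord (1 : Fin 3) x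
  have h2 := mdifferentiableAt_nerveCoord (2 : Fin 3) x
  simp only [thetaRight_mul_apply h1 h2 (mdifferentiableAt_nerveCoord_mul _ _ x),
    thetaLeft_mul_apply h0 h1 (mdifferentiableAt_nerveCoord_mul _ _ x),
    add_apply, map_add, modelAd_inv_thetaRight h1]
  -- With `Ad_{g₂⁻¹} θ^r_{g₂} = θ^l_{g₂}` already substituted, moving `Ad_{g₂⁻¹}` across the pairing
  -- turns `⟨Ad_{g₂⁻¹} θ^l_{g₁}, θ^r_{g₃}⟩` into `⟨θ^l_{g₁}, Ad_{g₂} θ^r_{g₃}⟩`, and the four faces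
  -- cancel.
  have h3 : ∀ v w, b (modelAd E (nerveCoord E 1 x)⁻¹ v) w = b v (modelAd E (nerveCoord E 1 x) w) :=
    fun v w => by rw [← hAd (nerveCoord E 1 x), modelAd_apply_inv]
  simp only [h3]
  change _ = (0 : ℝ)
  norm_num
  ring

end NerveForms

/-! ### `Ω_•` is a closed normalized shifted form -/

section ShiftedForm

variable {E : Type v} [NormedAddCommGroup E] [NormedSpace ℝ E] [FiniteDimensional ℝ E]
  {G : Type u} [TopologicalSpace G] [ChartedSpace E G] [Group G] [LieGroup 𝓘(ℝ, E) ∞ G]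
  {B : LinearMap.BilinForm ℝ (GroupLieAlgebra 𝓘(ℝ, E) G)}

/-- The relation `dΩ = δΘ`. -/
theorem d_brylinskiWeinsteinForm (hB : IsQuadratic B)
    (hAd : ∀ (g : G) (v w : E), B (modelAd E g v) (modelAd E g w) = B v w) :
    (brylinskiWeinsteinForm B).d = (nerve E G).δ (nerveCartanForm B) := by
  have : CompleteSpace E := FiniteDimensional.complete ℝ E
  obtain ⟨b, hb⟩ := exists_continuous_bilinear B
  obtain ⟨br, hbr⟩ := exists_continuous_bracket E G
  refine DForm.ext_apply fun x u => ?_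
  refine Eq.trans ?_ ((nerve E G).δ_apply _ x u).symm
  have hF := fun i => (nerve E G).mdifferentiableAt_face 1 i x
  rw [Fin.sum_univ_three,
    pullback_nerveCartanForm_apply hB hb (hF 0) (f := nerveCoord E (1 : Fin 2)) (fun _ => rfl) u,
    pullback_nerveCartanForm_apply hB hb (hF 1)
      (f := fun y => nerveCoord E (0 : Fin 2) y * nerveCoord E (1 : Fin 2) y) (fun _ => rfl) u,
    pullback_nerveCartanForm_apply hB hb (hF 2) (f := nerveCoord E (0 : Fin 2)) (fun _ => rfl) u,
    d_wedge_apply b (contMDiff_nerveCoord 0) (contMDiff_nerveCoord 1)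
      (brylinskiWeinsteinForm_apply hb)]
  have h0 := mdifferentiableAt_nerveCoord (0 : Fin 2) x
  have h1 := mdifferentiableAt_nerveCoord (1 : Fin 2) x
  have hAd' : ∀ (g : G) (v w z : E), b (modelAd E g v) (modelBracket E G (modelAd E g w)
      (modelAd E g z)) = b v (modelBracket E G w z) := fun g v w z => by
    rw [← modelAd_bracket, hb, hb, hAd]
  -- For `g₂` and `g₁g₂` the form `θ^l` becomes `Ad_{g₂⁻¹}` of `r = θ^r_{g₂}` and of `a + r` with `a
  -- = θ^l_{g₁}`. As `T(x) = ⟨x, [x, x]⟩` is `Ad`-invariant, `δΘ` becomes `T(r) - T(a + r) + T(a)`,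
  -- which contains only mixed terms.
  simp only [thetaLeft_mul_apply h0 h1 (mdifferentiableAt_nerveCoord_mul _ _ x),
    ← modelAd_inv_thetaRight h1, hAd']
  have hcyc : ∀ v w z, b (br v w) z = b v (br w z) := fun v w z => by
    rw [hb, hb, hbr, hbr]
    exact (hB.cyclic v w z).symm
  have hskew : ∀ v w, br v w = - br w v := fun v w => by
    rw [hbr, hbr]
    exact (lie_skew (L := GroupLieAlgebra 𝓘(ℝ, E) G) v w).symm
  have hsymm : ∀ v w, b v w = b w v := fun v w => by rw [hb, hb]; exact hB.symm v w
  simp only [← hbr, map_add, add_apply]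
  generalize thetaLeft E (nerveCoord E (0 : Fin 2)) x (u 0) = a0
  generalize thetaLeft E (nerveCoord E (0 : Fin 2)) x (u 1) = a1
  generalize thetaLeft E (nerveCoord E (0 : Fin 2)) x (u 2) = a2
  generalize thetaRight E (nerveCoord E (1 : Fin 2)) x (u 0) = r0
  generalize thetaRight E (nerveCoord E (1 : Fin 2)) x (u 1) = r1
  generalize thetaRight E (nerveCoord E (1 : Fin 2)) x (u 2) = r2
  -- Skewness, symmetry and cyclicity bring equal mixed terms of `dΩ` and `δΘ` to the same form.
  have e1 : b a0 (br r1 a2) = - b a0 (br a2 r1) := by rw [hskew, map_neg]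
  have e2 : b r0 (br a1 r2) = - b a1 (br r0 r2) := by
    rw [hskew, map_neg, ← hcyc, hsymm]
  have e3 : b r0 (br r1 a2) = b a2 (br r0 r1) := by rw [← hcyc, hsymm]
  have e4 : b a1 (br a2 r0) = b r0 (br a1 a2) := by rw [← hcyc, hsymm]
  simp only [hcyc, e1, e2, e3, e4]
  norm_num
  ring

theorem SimplicialManifold.δ_neg (K : SimplicialManifold.{u, v}) {p q : ℕ}
    (η : DForm (K.E p) (K.X p) q) : K.δ (-η) = -K.δ η := by
  refine DForm.ext_apply fun x u => ?_
  refine (K.δ_apply (-η) x u).trans ?_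
  change _ = -(K.δ η x u)
  rw [K.δ_apply η x u, ← Finset.sum_neg_distrib]
  exact Finset.sum_congr rfl fun i _ => mul_neg _ _

theorem nerveForm_eq_zero {p q : ℕ} (h : ¬ (p = 2 ∧ q = 2)) (h' : ¬ (p = 1 ∧ q = 3)) :
    nerveForm B p q = 0 := by
  unfold nerveForm
  split
  · exact absurd ⟨rfl, rfl⟩ h
  · exact absurd ⟨rfl, rfl⟩ h'
  · rfl

/-- Only the bidegrees `(3, 2)`, `(2, 3)` and `(1, 4)` can contribute: they give `δΩ`, `dΩ - δΘ`
and, up to sign, `dΘ`. -/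
theorem D_nerveForm (hB : IsQuadratic B)
    (hAd : ∀ (g : G) (v w : E), B (modelAd E g v) (modelAd E g w) = B v w) :
    (nerve E G).D (nerveForm B) = 0 := by
  have hδ : ∀ p q, (p = 2 ∧ q = 2 → False) → (p = 1 ∧ q = 3 → False) →
      (nerve E G).δ (nerveForm B p q) = 0 := fun p q h h' => by
    rw [nerveForm_eq_zero h h', SimplicialManifold.δ_zero]
  have hd : ∀ p q, (p = 2 ∧ q = 2 → False) → (nerveForm B p q).d = 0 := fun p q h => by
    by_cases h' : p = 1 ∧ q = 3
    · obtain ⟨rfl, rfl⟩ := h'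
      change DForm.d (-nerveCartanForm B) = 0
      rw [DForm.d_neg, d_nerveCartanForm hB, neg_zero]
    · rw [nerveForm_eq_zero h h', DForm.d_zero]
  funext p q
  match p, q with
  | 0, 0 => rfl
  | 0, q + 1 => exact hd 0 q (by omega)
  | p + 1, 0 => exact hδ p 0 (by omega) (by omega)
  | p + 1, q + 1 =>
    change (nerve E G).δ (nerveForm B p (q + 1)) +
      (-1 : ℝ) ^ (p + 1) • DForm.d (nerveForm B (p + 1) q) = 0
    by_cases h : p + 1 = 2 ∧ q = 2
    · obtain ⟨hp, rfl⟩ := h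
      obtain rfl : p = 1 := by omega
      change (nerve E G).δ (-nerveCartanForm B) +
        (-1 : ℝ) ^ 2 • DForm.d (brylinskiWeinsteinForm B) = 0
      rw [SimplicialManifold.δ_neg, d_brylinskiWeinsteinForm hB hAd, neg_one_sq]
      refine DForm.ext_apply fun x u => ?_
      change -((nerve E G).δ (nerveCartanForm B) x u) +
        1 * ((nerve E G).δ (nerveCartanForm B) x u) = 0
      ring
    · rw [hd _ _ h]
      have h2 : (nerve E G).δ (nerveForm B p (q + 1)) = 0 := by
        by_cases h' : p = 2 ∧ q + 1 = 2
        · obtain ⟨rfl, hq⟩ := h'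
          obtain rfl : q = 1 := by omega
          exact δ_brylinskiWeinsteinForm hAd
        · exact hδ p (q + 1) h' (by omega)
      rw [h2]
      refine DForm.ext_apply fun x u => ?_
      change (0 : ℝ) + (-1) ^ (p + 1) * 0 = 0
      ring

/-- A degeneracy into `NG_2` or `NG_1` makes one coordinate constant, and the Maurer–Cartan form of
a constant map vanishes; it is a factor of `Ω` or `Θ`. -/
theorem isNormalized_nerveForm (hB : IsQuadratic B) :
    (nerve E G).IsNormalized (nerveForm B) := by
  obtain ⟨b, hb⟩ := exists_continuous_bilinear B
  intro p q i
  by_cases h : p + 1 = 2 ∧ q = 2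
  · obtain ⟨hp, rfl⟩ := h
    obtain rfl : p = 1 := by omega
    refine DForm.ext_apply fun x u => ?_
    have hF := (nerve E G).mdifferentiableAt_degen 1 i x
    change DForm.pullback (E := (nerve E G).E 1) _ (brylinskiWeinsteinForm B) x u = 0
    have h2 : ∀ j : Fin 2, j = 0 ∨ j = 1 := by decide
    obtain rfl | rfl := h2 i
    · rw [pullback_brylinskiWeinsteinForm_apply hb hF (f := fun _ => 1)
        (h := nerveCoord E (0 : Fin 1))
        (fun _ => rfl) (fun _ => rfl) u, thetaLeft_const]
      simp
    · rw [pullback_brylinskiWeinsteinForm_apply hb hF (h := fun _ => 1)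
        (f := nerveCoord E (0 : Fin 1))
        (fun _ => rfl) (fun _ => rfl) u, thetaRight_const]
      simp
  · by_cases h' : p + 1 = 1 ∧ q = 3
    · obtain ⟨hp, rfl⟩ := h'
      obtain rfl : p = 0 := by omega
      refine DForm.ext_apply fun x u => ?_
      have hF := (nerve E G).mdifferentiableAt_degen 0 i x
      change -DForm.pullback (E := (nerve E G).E 0) _ (nerveCartanForm B) x u = 0
      obtain rfl : i = 0 := by omega
      rw [pullback_nerveCartanForm_apply hB hb hF (f := fun _ => 1) (fun _ => rfl) u,
        thetaLeft_const]
      simp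
    · rw [nerveForm_eq_zero h h']
      rfl

theorem isShiftedForm_nerveForm (hB : IsQuadratic B) :
    (nerve E G).IsShiftedForm 2 2 (nerveForm B) where
  eq_zero p q h := nerveForm_eq_zero (by omega) (by omega)
  isSmooth p q := by
    by_cases h : p = 2 ∧ q = 2
    · obtain ⟨rfl, rfl⟩ := h
      exact isSmooth_brylinskiWeinsteinForm
    · by_cases h' : p = 1 ∧ q = 3
      · obtain ⟨rfl, rfl⟩ := h'
        exact (isSmooth_nerveCartanForm hB).neg
      · rw [nerveForm_eq_zero h h']
        exact DForm.isSmooth_zero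
  isNormalized := isNormalized_nerveForm hB

end ShiftedForm

/-! ### Transport of manifold structures along homeomorphisms -/

section Transport

variable {E : Type*} [NormedAddCommGroup E] [NormedSpace ℝ E]
  {X Y : Type*} [TopologicalSpace X] [ChartedSpace E X] [TopologicalSpace Y]

/-- The charts of `X` transported to `Y` along a homeomorphism. -/
abbrev transportedChartedSpace (e : X ≃ₜ Y) : ChartedSpace E Y where
  atlas := (fun φ => e.symm.toOpenPartialHomeomorph.trans φ) '' atlas E X
  chartAt y := e.symm.toOpenPartialHomeomorph.trans (chartAt E (e.symm y))
  mem_chart_source y := by simp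
  chart_mem_atlas y := ⟨_, chart_mem_atlas E _, rfl⟩

variable (e : X ≃ₜ Y) [IsManifold 𝓘(ℝ, E) ∞ X]

theorem isManifold_transported :
    let _ := transportedChartedSpace (E := E) e
    IsManifold 𝓘(ℝ, E) ∞ Y := by
  intro _
  apply isManifold_of_contDiffOn
  rintro _ _ ⟨φ, hφ, rfl⟩ ⟨φ', hφ', rfl⟩
  have h := (contDiffGroupoid ∞ 𝓘(ℝ, E)).compatible hφ hφ'
  rw [contDiffGroupoid, mem_groupoid_of_pregroupoid] at h
  have h1 : ContDiffOn ℝ ∞ (φ.symm ≫ₕ φ') (φ.symm ≫ₕ φ').source := by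
    simpa [contDiffPregroupoid] using h.1
  refine (h1.mono ?_).congr ?_
  · intro y hy
    simpa using hy
  · intro y hy
    simp

omit [IsManifold 𝓘(ℝ, E) ∞ X] in
theorem contMDiff_transported :
    let _ := transportedChartedSpace (E := E) e
    ContMDiff 𝓘(ℝ, E) 𝓘(ℝ, E) ∞ e := by
  intro _ x
  rw [contMDiffAt_iff]
  refine ⟨e.continuous.continuousAt, ?_⟩
  have hm := extChartAt_target_mem_nhdsWithin (I := 𝓘(ℝ, E)) x
  have h : ∀ y ∈ (extChartAt 𝓘(ℝ, E) x).target,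
      (extChartAt 𝓘(ℝ, E) (e x) ∘ e ∘ (extChartAt 𝓘(ℝ, E) x).symm) y = y := by
    intro y hy
    have hy' : y ∈ (chartAt E x).target := by simpa using hy
    change chartAt E (e.symm (e x)) (e.symm (e ((chartAt E x).symm y))) = y
    rw [e.symm_apply_apply, e.symm_apply_apply, (chartAt E x).right_inv hy']
  refine contDiffWithinAt_id.congr_of_eventuallyEq ?_ (h _ (mem_extChartAt_target x))
  filter_upwards [hm] with y hy using h y hy

omit [IsManifold 𝓘(ℝ, E) ∞ X] in
theorem contMDiff_transported_symm :
    let _ := transportedChartedSpace (E := E) e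
    ContMDiff 𝓘(ℝ, E) 𝓘(ℝ, E) ∞ e.symm := by
  intro _ x
  rw [contMDiffAt_iff]
  refine ⟨e.symm.continuous.continuousAt, ?_⟩
  have hm := extChartAt_target_mem_nhdsWithin (I := 𝓘(ℝ, E)) x
  have h : ∀ y ∈ (extChartAt 𝓘(ℝ, E) x).target,
      (extChartAt 𝓘(ℝ, E) (e.symm x) ∘ e.symm ∘ (extChartAt 𝓘(ℝ, E) x).symm) y = y := by
    intro y hy
    have hy1 : y ∈ (chartAt E x).target := by simpa using hy
    have hy' : y ∈ (chartAt E (e.symm x)).target := hy1.1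
    change chartAt E (e.symm x) (e.symm (e ((chartAt E (e.symm x)).symm y))) = y
    rw [e.symm_apply_apply, (chartAt E _).right_inv hy']
  refine contDiffWithinAt_id.congr_of_eventuallyEq ?_ (h _ (mem_extChartAt_target x))
  filter_upwards [hm] with y hy using h y hy

end Transport

/-! ### Horn spaces with smooth unique fillers -/

namespace SimplicialManifold

variable (K : SimplicialManifold.{u, v})

/-- The condition on the horn space and the horn projection `p_{l+1, j}` of a Lie `n`-groupoid. -/
def IsLieHorn (n l : ℕ) (j : Fin (l + 2)) : Prop :=
  ∃ S : K.HornManifold l j,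
    letI := S.chartedSpace
    Function.Surjective (K.hornProj l j) ∧
    (∀ x, Manifold.IsSubmersionAt 𝓘(ℝ, K.E (l + 1)) 𝓘(ℝ, S.F) ∞ (K.hornProj l j) x) ∧
    (n < l + 1 → ∃ Φ : K.X (l + 1) ≃ₘ^∞⟮𝓘(ℝ, K.E (l + 1)), 𝓘(ℝ, S.F)⟯ K.Horn l j,
      ⇑Φ = K.hornProj l j)

theorem continuous_hornProj (l : ℕ) (j : Fin (l + 2)) : Continuous (K.hornProj l j) :=
  continuous_induced_rng.2 (continuous_pi fun i => (K.contMDiff_face l i).continuous)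

/-- If the horn projection has an inverse which is continuous and maps smooth families to smooth
families, then it is a diffeomorphism onto the manifold of horns. -/
theorem isLieHorn_of_inverse (l : ℕ) (j : Fin (l + 2)) (n : ℕ)
    (r : K.Horn l j → K.X (l + 1)) (hr : Continuous r) (hrp : ∀ x, r (K.hornProj l j x) = x)
    (hpr : ∀ y, K.hornProj l j (r y) = y)
    (hsmooth : ∀ (V : Type v) [NormedAddCommGroup V] [NormedSpace ℝ V] [CompleteSpace V]
      (M : Type u) [TopologicalSpace M] [ChartedSpace V M] [IsManifold 𝓘(ℝ, V) ∞ M]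
      (f : M → K.Horn l j),
      (∀ i : {i : Fin (l + 2) // i ≠ j},
        ContMDiff 𝓘(ℝ, V) 𝓘(ℝ, K.E l) ∞ (fun x => (f x).1 i)) →
      ContMDiff 𝓘(ℝ, V) 𝓘(ℝ, K.E (l + 1)) ∞ (fun x => r (f x))) :
    K.IsLieHorn n l j := by
  let e : K.X (l + 1) ≃ₜ K.Horn l j :=
    { toFun := K.hornProj l j
      invFun := r
      left_inv := hrp
      right_inv := hpr
      continuous_toFun := K.continuous_hornProj l j
      continuous_invFun := hr }
  let cs : ChartedSpace (K.E (l + 1)) (K.Horn l j) := transportedChartedSpace e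
  have hm : IsManifold 𝓘(ℝ, K.E (l + 1)) ∞ (K.Horn l j) := isManifold_transported e
  have he : ContMDiff 𝓘(ℝ, K.E (l + 1)) 𝓘(ℝ, K.E (l + 1)) ∞ e := contMDiff_transported e
  have he' : ContMDiff 𝓘(ℝ, K.E (l + 1)) 𝓘(ℝ, K.E (l + 1)) ∞ e.symm :=
    contMDiff_transported_symm e
  refine ⟨{ F := K.E (l + 1)
            chartedSpace := cs
            isManifold := hm
            contMDiff_component := fun i => ?_
            contMDiff_lift := ?_ }, ?_, ?_, ?_⟩
  · have h : (fun y : K.Horn l j => y.1 i) = fun y => K.face l i (e.symm y) := by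
      funext y
      exact congrFun (congrArg Subtype.val (hpr y)).symm i
    rw [h]
    exact (K.contMDiff_face l i).comp he'
  · intro V _ _ _ M _ _ _ f hf
    have h : f = fun x => e (r (f x)) := funext fun x => (hpr (f x)).symm
    rw [h]
    exact he.comp (hsmooth V M f hf)
  · exact e.surjective
  · intro x
    -- In a chart and its transported copy the projection is the identity, so the kernel factor is
    -- the zero space.
    refine Manifold.IsSubmersionAt.mk_of_continuousAt (F := PUnit.{1})
      e.continuous.continuousAt (ContinuousLinearEquiv.prodUnique ℝ _ _).symm (chartAt _ x)
      (e.symm.toOpenPartialHomeomorph.trans (chartAt _ x)) (mem_chart_source _ x)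
      ?_ (IsManifold.chart_mem_maximalAtlas x)
      (IsManifold.subset_maximalAtlas ⟨_, chart_mem_atlas _ x, rfl⟩) ?_
    · have : e.symm (e x) = x := e.symm_apply_apply x
      refine ⟨trivial, ?_⟩
      change e.symm (e x) ∈ (chartAt (K.E (l + 1)) x).source
      rw [this]
      exact mem_chart_source _ x
    · intro y hy
      have hy' : y ∈ (chartAt (K.E (l + 1)) x).target := by simpa using hy
      change chartAt (K.E (l + 1)) x (e.symm (e ((chartAt _ x).symm y))) = y
      rw [e.symm_apply_apply, (chartAt _ x).right_inv hy']
  · intro _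
    exact ⟨{ toEquiv := e.toEquiv
             contMDiff_toFun := he
             contMDiff_invFun := he' }, rfl⟩

variable {K}

/-- Once a candidate filler `g` has one correct face, the simplicial identities and the horn
relations give `d_i g` and `y_i` a common face. Two such coincidences will force `d_i g = y_i`. -/
theorem face_face_eq_of_mem_hornSet_of_le {m : ℕ} {j : Fin (m + 3)}
    (y : K.Horn (m + 1) j) {g : K.X (m + 2)} {i a : Fin (m + 2)} (hia : i ≤ a)
    (hi : i.castSucc ≠ j) (ha : a.succ ≠ j) (hg : K.face (m + 1) a.succ g = y.1 ⟨a.succ, ha⟩) :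
    K.face m a (K.face (m + 1) i.castSucc g) = K.face m a (y.1 ⟨i.castSucc, hi⟩) := by
  rw [← K.face_face m i a g hia, hg]
  exact y.2 i a hi ha hia

theorem face_face_eq_of_mem_hornSet_of_ge {m : ℕ} {j : Fin (m + 3)}
    (y : K.Horn (m + 1) j) {g : K.X (m + 2)} {i a : Fin (m + 2)} (hia : a ≤ i)
    (hi : i.succ ≠ j) (ha : a.castSucc ≠ j)
    (hg : K.face (m + 1) a.castSucc g = y.1 ⟨a.castSucc, ha⟩) :
    K.face m a (K.face (m + 1) i.succ g) = K.face m a (y.1 ⟨i.succ, hi⟩) := by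
  rw [K.face_face m a i g hia, hg]
  exact (y.2 a i ha hi hia).symm

end SimplicialManifold

/-! ### Simplices of the nerve determined by two faces -/

section NerveHorns

/-- The face `d_0` omits only the first coordinate, which the last face retains. -/
theorem nerveFace_jointly_injective_zero_last {G : Type u} [Group G] {n : ℕ} {x y : Fin (n + 2) → G}
    (h0 : nerveFace G (n + 1) 0 x = nerveFace G (n + 1) 0 y)
    (h1 : nerveFace G (n + 1) (Fin.last _) x = nerveFace G (n + 1) (Fin.last _) y) : x = y := by
  funext k
  refine Fin.cases ?_ (fun k => ?_) k
  · simpa [nerveFace] using congrFun h1 0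
  · simpa [nerveFace] using congrFun h0 k

/-- The face `d_0` omits only `g₁`, and `d_1` provides `g₁g₂` with `g₂` known. -/
theorem nerveFace_jointly_injective_zero_one {G : Type u} [Group G] {n : ℕ} {x y : Fin (n + 2) → G}
    (h0 : nerveFace G (n + 1) 0 x = nerveFace G (n + 1) 0 y)
    (h1 : nerveFace G (n + 1) 1 x = nerveFace G (n + 1) 1 y) : x = y := by
  have h : ∀ k : Fin (n + 1), x k.succ = y k.succ := fun k => by
    simpa [nerveFace] using congrFun h0 k
  funext k
  refine Fin.cases ?_ h k
  have h2 := congrFun h1 0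
  have h3 := h 0
  simp [nerveFace] at h2 h3
  rw [h3] at h2
  exact mul_right_cancel h2

theorem nerveFace_jointly_injective_last {G : Type u} [Group G] {n : ℕ} {x y : Fin (n + 2) → G}
    (h0 : nerveFace G (n + 1) (Fin.last (n + 1)).castSucc x =
      nerveFace G (n + 1) (Fin.last (n + 1)).castSucc y)
    (h1 : nerveFace G (n + 1) (Fin.last (n + 2)) x = nerveFace G (n + 1) (Fin.last (n + 2)) y) :
    x = y := by
  have h : ∀ k : Fin (n + 1), x k.castSucc = y k.castSucc := fun k => by
    simpa [nerveFace, k.is_le] using congrFun h1 k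
  funext k
  refine Fin.lastCases ?_ h k
  have h2 := congrFun h0 (Fin.last n)
  have h3 := h (Fin.last n)
  simp [nerveFace] at h2 h3
  rw [h3] at h2
  exact mul_left_cancel h2

/-- The simplex with given faces `0` and `1`. -/
def nerveFillZeroOne {G : Type u} [Group G] {m : ℕ} (a b : Fin (m + 1) → G) : Fin (m + 2) → G :=
  Fin.cons (b 0 * (a 0)⁻¹) a

/-- The simplex with given first and last faces. -/
def nerveFillZeroLast {G : Type u} {m : ℕ} (a b : Fin (m + 1) → G) : Fin (m + 2) → G :=
  Fin.cons (b 0) a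

/-- The simplex with given last two faces. -/
def nerveFillLast {G : Type u} [Group G] {m : ℕ} (a b : Fin (m + 1) → G) : Fin (m + 2) → G :=
  Fin.snoc b ((b (Fin.last m))⁻¹ * a (Fin.last m))

theorem nerveFace_zero_fillZeroOne {G : Type u} [Group G] {m : ℕ} (a b : Fin (m + 1) → G) :
    nerveFace G (m + 1) 0 (nerveFillZeroOne a b) = a := by
  funext k
  simp [nerveFace, nerveFillZeroOne]

/-- The first coordinate of the filler is chosen to make the first entry of `d_1` correct; the horn
relation takes care of all later entries. -/
theorem nerveFace_one_fillZeroOne {G : Type u} [Group G] {m : ℕ} {a b : Fin (m + 1) → G}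
    (h : nerveFace G m 0 b = nerveFace G m 0 a) :
    nerveFace G (m + 1) 1 (nerveFillZeroOne a b) = b := by
  funext k
  refine Fin.cases ?_ (fun k => ?_) k
  · have h1 : (Fin.cons (b 0 * (a 0)⁻¹) a : Fin (m + 2) → G) 1 = a 0 :=
      Fin.cons_succ (α := fun _ => G) _ a 0
    simp [nerveFace, nerveFillZeroOne, h1]
  · have h1 := congrFun h k
    simp [nerveFace] at h1
    simp [nerveFace, nerveFillZeroOne, h1]

theorem nerveFace_zero_fillZeroLast {G : Type u} [Group G] {m : ℕ} (a b : Fin (m + 1) → G) :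
    nerveFace G (m + 1) 0 (nerveFillZeroLast a b) = a := by
  funext k
  simp [nerveFace, nerveFillZeroLast]

theorem nerveFace_last_fillZeroLast {G : Type u} [Group G] {m : ℕ} {a b : Fin (m + 1) → G}
    (h : nerveFace G m 0 b = nerveFace G m (Fin.last (m + 1)) a) :
    nerveFace G (m + 1) (Fin.last (m + 2)) (nerveFillZeroLast a b) = b := by
  funext k
  refine Fin.cases ?_ (fun k => ?_) k
  · simp [nerveFace, nerveFillZeroLast]
  · have h1 := congrFun h k
    have hk := k.2
    simp [nerveFace] at h1
    rw [h1]
    have h2 : (k.succ.castSucc : Fin (m + 2)) = k.castSucc.succ := rfl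
    simp [nerveFace, nerveFillZeroLast, h2]

theorem nerveFace_last_fillLast {G : Type u} [Group G] {m : ℕ} (a b : Fin (m + 1) → G) :
    nerveFace G (m + 1) (Fin.last (m + 2)) (nerveFillLast a b) = b := by
  funext k
  simp [nerveFace, nerveFillLast, k.is_le]

theorem nerveFace_castSucc_last_fillLast {G : Type u} [Group G] {m : ℕ} {a b : Fin (m + 1) → G}
    (h : nerveFace G m (Fin.last (m + 1)) b = nerveFace G m (Fin.last (m + 1)) a) :
    nerveFace G (m + 1) (Fin.last (m + 1)).castSucc (nerveFillLast a b) = a := by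
  funext k
  refine Fin.lastCases ?_ (fun k => ?_) k
  · simp [nerveFace, nerveFillLast]
  · have h1 := congrFun h k
    simp [nerveFace] at h1
    simp [nerveFace, nerveFillLast, h1]

end NerveHorns

/-! ### The nerve is a Lie `1`-group -/

section NerveFillers

variable {E : Type v} [NormedAddCommGroup E] [NormedSpace ℝ E] [CompleteSpace E]
  {G : Type u} [TopologicalSpace G] [ChartedSpace E G] [Group G] [LieGroup 𝓘(ℝ, E) ∞ G]

/-- The coordinate `k` of the face `i` of a horn in `NG`. -/
def hornCoord (E : Type v) [NormedAddCommGroup E] [NormedSpace ℝ E] [CompleteSpace E]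
    {G : Type u} [TopologicalSpace G] [ChartedSpace E G] [Group G] [LieGroup 𝓘(ℝ, E) ∞ G]
    {l : ℕ} {j : Fin (l + 2)} (i : Fin (l + 2)) (hi : i ≠ j) (k : Fin l)
    (y : (nerve E G).Horn l j) : G := (y.1 ⟨i, hi⟩ : Fin l → G) k

theorem continuous_hornCoord {l : ℕ} {j : Fin (l + 2)} (i : Fin (l + 2)) (hi : i ≠ j) (k : Fin l) :
    Continuous (hornCoord (G := G) E i hi k) :=
  (contMDiff_nerveCoord (E := E) (G := G) k).continuous.comp
    ((continuous_apply (⟨i, hi⟩ : {i : Fin (l + 2) // i ≠ j})).comp continuous_subtype_val)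

/-- Fillers of horns in `NG` which are given by smooth formulas in coordinates. -/
theorem nerve_isLieHorn_of_coord (l : ℕ) (j : Fin (l + 2)) (n : ℕ)
    (r : (nerve E G).Horn l j → Fin (l + 1) → G)
    (hrp : ∀ x, r ((nerve E G).hornProj l j x) = x)
    (hpr : ∀ y, (nerve E G).hornProj l j (r y) = y)
    (hr : ∀ k, (∃ i hi k', ∀ y, r y k = hornCoord E i hi k' y) ∨
      (∃ i hi k' i' hi' k'', ∀ y, r y k = hornCoord E i hi k' y * (hornCoord E i' hi' k'' y)⁻¹) ∨
      (∃ i hi k' i' hi' k'', ∀ y, r y k = (hornCoord E i hi k' y)⁻¹ * hornCoord E i' hi' k'' y)) :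
    (nerve E G).IsLieHorn n l j := by
  have hTG : IsTopologicalGroup G := topologicalGroup_of_lieGroup 𝓘(ℝ, E) ∞
  refine (nerve E G).isLieHorn_of_inverse l j n r (continuous_pi fun k => ?_) hrp hpr ?_
  · obtain ⟨i, hi, k', h⟩ | ⟨i, hi, k', i', hi', k'', h⟩ | ⟨i, hi, k', i', hi', k'', h⟩ := hr k <;>
      simp only [h]
    · exact continuous_hornCoord i hi k'
    · exact (continuous_hornCoord i hi k').mul (continuous_hornCoord i' hi' k'').inv
    · exact (continuous_hornCoord i hi k').inv.mul (continuous_hornCoord i' hi' k'')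
  · intro V _ _ _ M _ _ _ f hf
    let _ := powChartedSpace E G (l + 1)
    refine contMDiff_pow_iff (E := E) (G := G) (fun x => r (f x)) fun k => ?_
    have hc : ∀ i hi k', ContMDiff 𝓘(ℝ, V) 𝓘(ℝ, E) ∞ (fun x => hornCoord E i hi k' (f x)) :=
      fun i hi k' => (contMDiff_nerveCoord (E := E) (G := G) k').comp (hf ⟨i, hi⟩)
    obtain ⟨i, hi, k', h⟩ | ⟨i, hi, k', i', hi', k'', h⟩ | ⟨i, hi, k', i', hi', k'', h⟩ := hr k <;>
      simp only [h]
    · exact hc i hi k'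
    · exact (hc i hi k').mul (hc i' hi' k'').inv
    · exact (hc i hi k').inv.mul (hc i' hi' k'')

/-- Horns in `NG` with the faces `0` and `1`. -/
theorem nerve_isLieHorn_last (m n : ℕ) :
    (nerve E G).IsLieHorn n (m + 1) (Fin.last (m + 2)) := by
  have h0 : (0 : Fin (m + 3)) ≠ Fin.last (m + 2) := by simp [Fin.ext_iff]
  have h1 : (1 : Fin (m + 3)) ≠ Fin.last (m + 2) := by simp [Fin.ext_iff]
  let r : (nerve E G).Horn (m + 1) (Fin.last (m + 2)) → Fin (m + 2) → G := fun y =>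
    nerveFillZeroOne (y.1 ⟨0, h0⟩) (y.1 ⟨1, h1⟩)
  have hr0 : ∀ y, nerveFace G (m + 1) 0 (r y) = y.1 ⟨0, h0⟩ := fun y =>
    nerveFace_zero_fillZeroOne _ _
  have hr1 : ∀ y, nerveFace G (m + 1) 1 (r y) = y.1 ⟨1, h1⟩ := fun y =>
    nerveFace_one_fillZeroOne (y.2 0 0 h0 h1 le_rfl)
  refine nerve_isLieHorn_of_coord (m + 1) _ n r (fun x => ?_) (fun y => ?_) fun k => ?_
  · exact nerveFace_jointly_injective_zero_one (hr0 _) (hr1 _)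
  · refine Subtype.ext (funext fun i => ?_)
    obtain ⟨i, hi⟩ := i
    change nerveFace G (m + 1) i (r y) = y.1 ⟨i, hi⟩
    refine Fin.cases (motive := fun i => ∀ hi, nerveFace G (m + 1) i (r y) = y.1 ⟨i, hi⟩)
      (fun _ => hr0 y) (fun i hi => ?_) i hi
    refine Fin.cases (motive := fun i : Fin (m + 2) => ∀ hi : i.succ ≠ Fin.last (m + 2),
      nerveFace G (m + 1) i.succ (r y) = y.1 ⟨i.succ, hi⟩)
      (fun _ => hr1 y) (fun i hi => ?_) i hi
    -- In `Λ[2, 2]` there are no faces besides `0` and `1`. In higher dimensions the other faces of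
    -- the filler are compared with those of the horn through their own faces `0` and `1`.
    obtain _ | m := m
    · exact absurd (Fin.ext (by simp)) hi
    · refine nerveFace_jointly_injective_zero_one
        (SimplicialManifold.face_face_eq_of_mem_hornSet_of_ge (K := nerve E G) y
          (a := 0) (Fin.zero_le _) hi h0 (hr0 y))
        (SimplicialManifold.face_face_eq_of_mem_hornSet_of_ge (K := nerve E G) y
          (a := 1) (Fin.mk_le_mk.2 (by simp)) hi h1 (hr1 y))
  · refine Fin.cases ?_ (fun k => ?_) k
    · exact Or.inr (Or.inl ⟨1, h1, 0, 0, h0, 0, fun _ => rfl⟩)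
    · exact Or.inl ⟨0, h0, k, fun _ => rfl⟩

/-- Horns in `NG` with the last two faces. -/
theorem nerve_isLieHorn_zero (m n : ℕ) : (nerve E G).IsLieHorn n (m + 1) 0 := by
  have h0 : (Fin.last (m + 1)).castSucc ≠ (0 : Fin (m + 3)) := by simp [Fin.ext_iff]
  have h1 : Fin.last (m + 2) ≠ (0 : Fin (m + 3)) := by simp [Fin.ext_iff]
  let r : (nerve E G).Horn (m + 1) 0 → Fin (m + 2) → G := fun y =>
    nerveFillLast (y.1 ⟨(Fin.last (m + 1)).castSucc, h0⟩) (y.1 ⟨Fin.last (m + 2), h1⟩)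
  have hr1 : ∀ y, nerveFace G (m + 1) (Fin.last (m + 2)) (r y) = y.1 ⟨Fin.last (m + 2), h1⟩ :=
    fun y => nerveFace_last_fillLast _ _
  have hr0 : ∀ y, nerveFace G (m + 1) (Fin.last (m + 1)).castSucc (r y) =
      y.1 ⟨(Fin.last (m + 1)).castSucc, h0⟩ := fun y =>
    nerveFace_castSucc_last_fillLast (y.2 (Fin.last (m + 1)) (Fin.last (m + 1)) h0 h1 le_rfl)
  refine nerve_isLieHorn_of_coord (m + 1) _ n r (fun x => ?_) (fun y => ?_) fun k => ?_
  · exact nerveFace_jointly_injective_last (hr0 _) (hr1 _)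
  · refine Subtype.ext (funext fun i => ?_)
    obtain ⟨i, hi⟩ := i
    change nerveFace G (m + 1) i (r y) = y.1 ⟨i, hi⟩
    refine Fin.lastCases (motive := fun i => ∀ hi, nerveFace G (m + 1) i (r y) = y.1 ⟨i, hi⟩)
      (fun _ => hr1 y) (fun i hi => ?_) i hi
    refine Fin.lastCases (motive := fun i : Fin (m + 2) => ∀ hi : i.castSucc ≠ 0,
      nerveFace G (m + 1) i.castSucc (r y) = y.1 ⟨i.castSucc, hi⟩)
      (fun _ => hr0 y) (fun i hi => ?_) i hi
    -- `Λ[2, 0]` has only the last two faces; otherwise compare the last two faces of each remaining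
    -- face.
    obtain _ | m := m
    · exact absurd (Fin.ext (by simp)) hi
    · refine nerveFace_jointly_injective_last
        (SimplicialManifold.face_face_eq_of_mem_hornSet_of_le (K := nerve E G) y
          (i := i.castSucc) (a := (Fin.last (m + 1)).castSucc) ?_ hi h0 (hr0 y))
        (SimplicialManifold.face_face_eq_of_mem_hornSet_of_le (K := nerve E G) y
          (i := i.castSucc) (a := Fin.last (m + 2)) (Fin.le_last _) hi h1 (hr1 y))
      exact Fin.castSucc_le_castSucc_iff.2 (Fin.le_last _)
  · refine Fin.lastCases ?_ (fun k => ?_) k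
    · exact Or.inr (Or.inr ⟨_, h1, Fin.last m, _, h0, Fin.last m, fun _ => Fin.snoc_last _ _⟩)
    · exact Or.inl ⟨_, h1, k, fun _ => Fin.snoc_castSucc _ _ _⟩

/-- Horns in `NG` with the first and the last face. -/
theorem nerve_isLieHorn_inner (m n : ℕ) (j : Fin (m + 3)) (h0 : 0 ≠ j)
    (h1 : Fin.last (m + 2) ≠ j) : (nerve E G).IsLieHorn n (m + 1) j := by
  let r : (nerve E G).Horn (m + 1) j → Fin (m + 2) → G := fun y =>
    nerveFillZeroLast (y.1 ⟨0, h0⟩) (y.1 ⟨Fin.last (m + 2), h1⟩)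
  have hr0 : ∀ y, nerveFace G (m + 1) 0 (r y) = y.1 ⟨0, h0⟩ :=
    fun y => nerveFace_zero_fillZeroLast _ _
  have hr1 : ∀ y, nerveFace G (m + 1) (Fin.last (m + 2)) (r y) = y.1 ⟨Fin.last (m + 2), h1⟩ :=
    fun y => nerveFace_last_fillZeroLast (y.2 0 (Fin.last (m + 1)) h0 h1 (Fin.zero_le _))
  refine nerve_isLieHorn_of_coord (m + 1) _ n r (fun x => ?_) (fun y => ?_) fun k => ?_
  · exact nerveFace_jointly_injective_zero_last (hr0 _) (hr1 _)
  · refine Subtype.ext (funext fun i => ?_)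
    obtain ⟨i, hi⟩ := i
    change nerveFace G (m + 1) i (r y) = y.1 ⟨i, hi⟩
    refine Fin.lastCases (motive := fun i => ∀ hi, nerveFace G (m + 1) i (r y) = y.1 ⟨i, hi⟩)
      (fun _ => hr1 y) (fun i hi => ?_) i hi
    refine Fin.cases (motive := fun i : Fin (m + 2) => ∀ hi : i.castSucc ≠ j,
      nerveFace G (m + 1) i.castSucc (r y) = y.1 ⟨i.castSucc, hi⟩)
      (fun _ => hr0 y) (fun i hi => ?_) i hi
    -- For `m = 0` the horn is `Λ[2, 1]`, whose middle face is the missing one.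
    obtain _ | m := m
    · refine absurd (Fin.ext ?_) hi
      have h0' := Fin.val_ne_of_ne h0
      have h1' := Fin.val_ne_of_ne h1
      have hi' := i.2
      have hj := j.2
      simp only [Fin.val_zero, Fin.val_last, Fin.val_castSucc, Fin.val_succ] at h0' h1' ⊢
      omega
    · exact nerveFace_jointly_injective_zero_last
        (SimplicialManifold.face_face_eq_of_mem_hornSet_of_ge (K := nerve E G) y
          (i := i.castSucc) (a := 0) (Fin.zero_le _) hi h0 (hr0 y))
        (SimplicialManifold.face_face_eq_of_mem_hornSet_of_le (K := nerve E G) y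
          (i := i.succ) (a := Fin.last (m + 2)) (Fin.le_last _) hi h1 (hr1 y))
  · refine Fin.cases ?_ (fun k => ?_) k
    · exact Or.inl ⟨_, h1, 0, fun _ => rfl⟩
    · exact Or.inl ⟨_, h0, k, fun _ => rfl⟩

instance : Unique ((nerve E G).X 0) := inferInstanceAs (Unique (Fin 0 → G))

instance : Unique ((nerve E G).E 0) := inferInstanceAs (Unique (Fin 0 → E))

instance uniqueHorn (j : Fin 2) : Unique ((nerve E G).Horn 0 j) where
  default := ⟨fun _ => default, trivial⟩
  uniq _ := Subtype.ext (funext fun _ => Subsingleton.elim _ _)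

/-- The horns `Λ[1, j]`. -/
theorem nerve_isLieHorn_one (j : Fin 2) (n : ℕ) (hn : 1 ≤ n) : (nerve E G).IsLieHorn n 0 j := by
  let e : (nerve E G).X 0 ≃ₜ (nerve E G).Horn 0 j := Homeomorph.homeomorphOfUnique _ _
  let cs : ChartedSpace ((nerve E G).E 0) ((nerve E G).Horn 0 j) := transportedChartedSpace e
  have hm : IsManifold 𝓘(ℝ, (nerve E G).E 0) ∞ ((nerve E G).Horn 0 j) := isManifold_transported e
  refine ⟨{ F := (nerve E G).E 0
            chartedSpace := cs
            isManifold := hm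
            contMDiff_component := fun i => ?_
            contMDiff_lift := ?_ }, ?_, ?_, ?_⟩
  · exact contMDiff_const (c := default).congr fun _ => Subsingleton.elim _ _
  · intro V _ _ _ M _ _ _ f hf
    exact contMDiff_const (c := default).congr fun _ => Subsingleton.elim _ _
  · exact fun y => ⟨fun _ => 1, Subsingleton.elim _ _⟩
  -- The horn space is a point, so the kernel factor of the submersion is the whole model space of
  -- `NG_1`.
  · intro x
    refine Manifold.IsSubmersionAt.mk_of_continuousAt (F := (nerve E G).E 1)
      ((nerve E G).continuous_hornProj 0 j).continuousAt
      (ContinuousLinearEquiv.uniqueProd ℝ _ _).symm (chartAt _ x)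
      (chartAt _ _) (mem_chart_source _ x)
      (mem_chart_source _ _) (IsManifold.chart_mem_maximalAtlas x)
      (IsManifold.chart_mem_maximalAtlas _) fun y hy => Subsingleton.elim _ _
  · intro h
    omega

theorem nerve_isLieGroupoid (n : ℕ) (hn : 1 ≤ n) : (nerve E G).IsLieGroupoid n := by
  intro l j
  change (nerve E G).IsLieHorn n l j
  obtain _ | m := l
  · exact nerve_isLieHorn_one j n hn
  · by_cases h0 : 0 = j
    · exact h0 ▸ nerve_isLieHorn_zero m n
    · by_cases h1 : Fin.last (m + 2) = j
      · exact h1 ▸ nerve_isLieHorn_last m n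
      · exact nerve_isLieHorn_inner m n j h0 h1

theorem nerve_isLieGroup (n : ℕ) (hn : 1 ≤ n) : (nerve E G).IsLieGroup n :=
  ⟨nerve_isLieGroupoid n hn, ⟨default⟩, inferInstance⟩

end NerveFillers

/-! ### Tangent maps of faces and degeneracies; trivial values of the IM-form -/

namespace SimplicialManifold

variable (K : SimplicialManifold.{u, v})

theorem hasTangentMap_tangentFace (l : ℕ) (i : Fin (l + 2)) (x : K.X 0) :
    HasTangentMap (K.face l i) (K.base (l + 1) x) (K.base l x) (K.tangentFace l i x) :=
  (K.mdifferentiableAt_face l i _).hasTangentMap (K.face_base l i x)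

theorem contMDiff_iterDegen (a : ℕ → ℕ) {l m : ℕ} (h : l ≤ m) :
    ContMDiff 𝓘(ℝ, K.E l) 𝓘(ℝ, K.E m) ∞ (K.iterDegen a h) := by
  induction m, h using Nat.le_induction with
  | base =>
    have : K.iterDegen a (Nat.le_refl l) = id := by simp [iterDegen]
    rw [this]
    exact contMDiff_id
  | succ m h ih =>
    have h1 : K.iterDegen a (Nat.le_succ_of_le h) =
        fun x => K.degen m (Fin.ofNat (m + 1) (a m)) (K.iterDegen a h x) :=
      funext fun x => K.iterDegen_succ a h x
    rw [h1]
    exact (K.contMDiff_degen m _).comp ih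

theorem hasTangentMap_tangentDegen (a : ℕ → ℕ) {l m : ℕ} (h : l ≤ m) (x : K.X 0) :
    HasTangentMap (K.iterDegen a h) (K.base l x) (K.base m x) (K.tangentDegen a h x) :=
  ((K.contMDiff_iterDegen a h _).mdifferentiableAt (by simp)).hasTangentMap (K.iterDegen_base a h x)

theorem imForm_zero_left {m : ℕ} (η : DForm (K.E m) (K.X m) 2) {l r : ℕ} (h : l + r = m)
    (x : K.X 0) (w : K.E r) : K.imForm η h x 0 w = 0 := by
  refine Finset.sum_eq_zero fun σ _ => ?_
  rw [map_zero]
  exact mul_eq_zero_of_right _ ((η (K.base m x)).map_coord_zero 0 rfl)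

theorem imForm_zero_right {m : ℕ} (η : DForm (K.E m) (K.X m) 2) {l r : ℕ} (h : l + r = m)
    (x : K.X 0) (v : K.E l) : K.imForm η h x v 0 = 0 := by
  refine Finset.sum_eq_zero fun σ _ => ?_
  rw [map_zero]
  exact mul_eq_zero_of_right _ ((η (K.base m x)).map_coord_zero 1 rfl)

end SimplicialManifold

/-! ### The tangent complex of the nerve and its IM-form -/

section NerveTangentComplex

variable {E : Type v} [NormedAddCommGroup E] [NormedSpace ℝ E]
  {G : Type u} [TopologicalSpace G] [ChartedSpace E G] [Group G] [LieGroup 𝓘(ℝ, E) ∞ G]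

theorem nerveCoord_base [CompleteSpace E] (n : ℕ) (k : Fin n) (pt : (nerve E G).X 0) :
    nerveCoord E k ((nerve E G).base n pt) = 1 := by
  induction n with
  | zero => exact k.elim0
  | succ n ih =>
    rw [(nerve E G).base_succ]
    refine Fin.cases ?_ (fun k => ?_) k
    · rfl
    · exact ih k

/-- A tangent vector of `G^n`, in the product chart, has the expected coordinates. -/
theorem hasTangentMap_nerveCoord [CompleteSpace E] {n : ℕ} (k : Fin n) (x : (nerve E G).X n) {g : G}
    (hg : nerveCoord E k x = g) :
    HasTangentMap (E₁ := (nerve E G).E n) (E₂ := E) (nerveCoord E k) x g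
      (ContinuousLinearMap.proj (R := ℝ) (φ := fun _ : Fin n => E) k) := by
  subst hg
  obtain ⟨L, h⟩ : ∃ L : (nerve E G).E n →L[ℝ] E,
      HasTangentMap (nerveCoord E k) x (nerveCoord E k x) L :=
    ⟨_, (mdifferentiableAt_nerveCoord (E := E) (G := G) k x).hasTangentMap rfl⟩
  -- Precomposing with the inverse product chart does not change `L`, while the composite is the
  -- projection followed by the inverse chart of the factor.
  have h1 := h.comp (hasTangentMap_chartAt_symm (E₂ := (nerve E G).E n) x)
  have h2 : HasTangentMap (E₁ := (nerve E G).E n) (E₂ := E)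
      (fun y : (nerve E G).E n => (y : Fin n → E) k)
      (chartAt ((nerve E G).E n) x x) (chartAt E (nerveCoord E k x) (nerveCoord E k x))
      (ContinuousLinearMap.proj (R := ℝ) (φ := fun _ : Fin n => E) k) :=
    HasFDerivAt.hasTangentMap (E₁ := Fin n → E)
      (ContinuousLinearMap.proj (R := ℝ) (φ := fun _ : Fin n => E) k).hasFDerivAt rfl
  have h3 := (hasTangentMap_chartAt_symm (E₂ := E) (nerveCoord E k x)).comp h2
  have h4 := h1.unique h3
  have h5 : L = ContinuousLinearMap.proj (R := ℝ) (φ := fun _ : Fin n => E) k :=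
    ContinuousLinearMap.ext fun v => DFunLike.congr_fun h4 v
  exact h5 ▸ h

/-- All coordinates are smooth functions of the faces `d_0` and `d_1`: the later ones are those of
`d_0`, and `g₁ = (g₁g₂) g₂⁻¹`. Differentiating at the unit expresses `v` through its images under
`Td_0` and `Td_1`. -/
theorem tangentFace_coord_eq_zero [CompleteSpace E] {l : ℕ} (pt : (nerve E G).X 0)
    {v : Fin (l + 2) → E} (h0 : (nerve E G).tangentFace (l + 1) 0 pt v = 0)
    (h1 : (nerve E G).tangentFace (l + 1) 1 pt v = 0) : v = 0 := by
  let L : Fin (l + 3) → Fin (l + 1) → (nerve E G).E (l + 2) →L[ℝ] E := fun i k =>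
    (ContinuousLinearMap.proj (R := ℝ) (φ := fun _ : Fin (l + 1) => E) k).comp
      ((nerve E G).tangentFace (l + 1) i pt)
  have hL : ∀ i k, HasTangentMap (fun x => nerveCoord E k ((nerve E G).face (l + 1) i x))
      ((nerve E G).base (l + 2) pt) 1 (L i k) := fun i k =>
    (hasTangentMap_nerveCoord k _ (nerveCoord_base (l + 1) k pt)).comp
      ((nerve E G).hasTangentMap_tangentFace (l + 1) i pt)
  have hL0 : ∀ i k, (nerve E G).tangentFace (l + 1) i pt v = 0 → L i k v = 0 := fun i k h =>
    (congrArg (ContinuousLinearMap.proj (R := ℝ) (φ := fun _ : Fin (l + 1) => E) k) h).trans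
      (map_zero _)
  funext k
  refine Fin.cases ?_ (fun k => ?_) k
  -- The differential `C` of the inversion need not be identified, since it is applied to zero.
  · obtain ⟨C, hC⟩ : ∃ C : E →L[ℝ] E,
        HasTangentMap (E₁ := E) (E₂ := E) (fun g : G => g⁻¹) 1 1 C :=
      ⟨_, MDifferentiableAt.hasTangentMap ((contMDiff_inv 𝓘(ℝ, E) ∞).mdifferentiable (by simp) 1)
        inv_one⟩
    have h3 := (hasTangentMap_nerveCoord (0 : Fin (l + 2)) _ (nerveCoord_base (l + 2) 0 pt)).unique
      (((hL 1 0).mul_one (hC.comp (hL 0 0))).congr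
        (.of_forall fun x => eq_mul_inv_of_mul_eq rfl))
    refine (DFunLike.congr_fun h3 v).trans ?_
    change L 1 0 v + C (L 0 0 v) = 0
    rw [hL0 _ _ h0, hL0 _ _ h1, map_zero, add_zero]
  · have h3 := (hasTangentMap_nerveCoord k.succ _
      (nerveCoord_base (l + 2) k.succ pt)).unique ((hL 0 k).congr (.of_forall fun x => rfl))
    exact (DFunLike.congr_fun h3 v).trans (hL0 _ _ h0)

theorem nerve_tangentComplex_one [CompleteSpace E] (pt : (nerve E G).X 0) :
    (nerve E G).tangentComplex pt 1 = ⊤ := by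
  refine eq_top_iff.2 fun v _ => ?_
  refine Submodule.mem_iInf _ |>.2 fun i => ?_
  exact Subsingleton.elim (α := (nerve E G).E 0) _ _

/-- In degree at least two both `Td_0` and `Td_1` occur in the defining intersection. -/
theorem nerve_tangentComplex_add_two [CompleteSpace E] (pt : (nerve E G).X 0) (l : ℕ) :
    (nerve E G).tangentComplex pt (l + 2) = ⊥ := by
  refine eq_bot_iff.2 fun v hv => ?_
  have h := Submodule.mem_iInf _ |>.1 hv
  exact tangentFace_coord_eq_zero pt (h 0) (h 1)

theorem nerve_cycles_add_two_eq_zero [CompleteSpace E] (pt : (nerve E G).X 0) (l : ℕ)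
    (v : (nerve E G).cycles pt (l + 2)) : v.1 = 0 := by
  have h := v.2.1
  rwa [nerve_tangentComplex_add_two] at h

theorem subsingleton_nerve_homology [CompleteSpace E] (pt : (nerve E G).X 0) {l : ℕ} (hl : l ≠ 1) :
    Subsingleton ((nerve E G).homology pt l) := by
  have h : Subsingleton ((nerve E G).cycles pt l) := by
    obtain _ | _ | l := l
    · exact ⟨fun v w => Subtype.ext (Subsingleton.elim (α := (nerve E G).E 0) _ _)⟩
    · exact absurd rfl hl
    · exact ⟨fun v w => Subtype.ext ((nerve_cycles_add_two_eq_zero pt l v).trans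
        (nerve_cycles_add_two_eq_zero pt l w).symm)⟩
  exact (Submodule.Quotient.mk_surjective _).subsingleton

theorem nerve_cycles_one [CompleteSpace E] (pt : (nerve E G).X 0) :
    (nerve E G).cycles pt 1 = ⊤ := by
  refine eq_top_iff.2 fun v _ => ⟨by rw [nerve_tangentComplex_one]; trivial, ?_⟩
  exact Subsingleton.elim (α := (nerve E G).E 0) _ _

theorem nerve_boundaries_one [CompleteSpace E] (pt : (nerve E G).X 0) :
    (nerve E G).boundaries pt 1 = ⊥ := by
  rw [SimplicialManifold.boundaries, nerve_tangentComplex_add_two, Submodule.map_bot]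

variable [FiniteDimensional ℝ E]

theorem nerveTangent_apply (pt : (nerve E G).X 0) (v : (nerve E G).E 1) :
    nerveTangent E G pt v = (v : Fin 1 → E) 0 :=
  DFunLike.congr_fun (hasTangentMap_nerveCoord (0 : Fin 1) _ (nerveCoord_base 1 0 pt)).mfderiv v

theorem nerveTangent_bijective (pt : (nerve E G).X 0) :
    Function.Bijective (nerveTangent E G pt) := by
  refine ⟨fun v w h => ?_, fun a => ⟨fun _ => a, nerveTangent_apply pt _⟩⟩
  rw [nerveTangent_apply, nerveTangent_apply] at h
  funext k
  rw [Subsingleton.elim k 0]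
  exact h

variable {B : LinearMap.BilinForm ℝ (GroupLieAlgebra 𝓘(ℝ, E) G)}

/-- At the unit both Maurer–Cartan forms are the identity. -/
theorem brylinskiWeinsteinForm_base (pt : (nerve E G).X 0) (u : Fin 2 → (nerve E G).E 2) :
    brylinskiWeinsteinForm B ((nerve E G).base 2 pt) u =
      B ((u 0 : Fin 2 → E) 0) ((u 1 : Fin 2 → E) 1) -
        B ((u 1 : Fin 2 → E) 0) ((u 0 : Fin 2 → E) 1) := by
  obtain ⟨b, hb⟩ := exists_continuous_bilinear B
  have hL : ∀ v : (nerve E G).E 2, thetaLeft E (nerveCoord (G := G) E (0 : Fin 2))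
      ((nerve E G).base 2 pt) v = (v : Fin 2 → E) 0 := fun v => by
    rw [thetaLeft, (hasTangentMap_nerveCoord _ _ rfl).mfderiv, nerveCoord_base, leftMC_one]
    rfl
  have hR : ∀ v : (nerve E G).E 2, thetaRight E (nerveCoord (G := G) E (1 : Fin 2))
      ((nerve E G).base 2 pt) v = (v : Fin 2 → E) 1 := fun v => by
    rw [thetaRight, (hasTangentMap_nerveCoord _ _ rfl).mfderiv, nerveCoord_base, rightMC_one]
    rfl
  refine (brylinskiWeinsteinForm_apply hb _ u).trans ?_
  simp only [hL, hR, hb]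

omit [FiniteDimensional ℝ E] in
-- From level `1` to level `2` the iterated degeneracy is the single map with index `a 1`; the other
-- values of `a` play no role.
theorem nerve_tangentDegen_coord [CompleteSpace E] (a : ℕ → ℕ) (pt : (nerve E G).X 0)
    (v : Fin 1 → E) (k : Fin 2) {L : (Fin 1 → E) →L[ℝ] E}
    (hL : HasTangentMap (E₁ := (nerve E G).E 1) (E₂ := E)
      (fun x => nerveCoord E k ((nerve E G).degen 1 (Fin.ofNat 2 (a 1)) x))
      ((nerve E G).base 1 pt) 1 L) :
    ((nerve E G).tangentDegen a (show 1 ≤ 2 by omega) pt v : Fin 2 → E) k = L v := by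
  have h := (hasTangentMap_nerveCoord k _ (nerveCoord_base 2 k pt)).comp
    ((nerve E G).hasTangentMap_tangentDegen a (show 1 ≤ 2 by omega) pt)
  refine DFunLike.congr_fun (h.unique (y' := 1) (hL.congr (.of_forall fun x => ?_))) v
  exact congrArg (nerveCoord E k) ((nerve E G).iterDegen_succ a (Nat.le_refl 1) x)

omit [FiniteDimensional ℝ E] in
/-- The differential of the degeneracies `NG_1 → NG_2`. -/
theorem nerve_tangentDegen [CompleteSpace E] (a : ℕ → ℕ) (pt : (nerve E G).X 0)
    (v : Fin 1 → E) :
    (a 1 = 0 → (nerve E G).tangentDegen a (show 1 ≤ 2 by omega) pt v = ![(0 : E), v 0]) ∧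
    (a 1 = 1 → (nerve E G).tangentDegen a (show 1 ≤ 2 by omega) pt v = ![v 0, (0 : E)]) := by
  have h0 := hasTangentMap_nerveCoord (E := E) (G := G) (0 : Fin 1) _ (nerveCoord_base 1 0 pt)
  have h1 := HasTangentMap.const (E₁ := (nerve E G).E 1) (E₂ := E) ((nerve E G).base 1 pt) (1 : G)
  constructor <;> intro ha <;> funext k <;> have h2 : ∀ j : Fin 2, j = 0 ∨ j = 1 := by decide
  all_goals
    obtain rfl | rfl := h2 k
  · exact nerve_tangentDegen_coord a pt v 0 (h1.congr (.of_forall fun x => by rw [ha]; rfl))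
  · exact nerve_tangentDegen_coord a pt v 1 (h0.congr (.of_forall fun x => by rw [ha]; rfl))
  · exact nerve_tangentDegen_coord a pt v 0 (h0.congr (.of_forall fun x => by rw [ha]; rfl))
  · exact nerve_tangentDegen_coord a pt v 1 (h1.congr (.of_forall fun x => by rw [ha]; rfl))

/-- Both permutations of `{0, 1}` are `(1, 1)`-shuffles. The identity gives `Ω((v, 0), (0, w)) = ⟨v,
w⟩`, the transposition gives `-Ω((0, v), (w, 0)) = ⟨w, v⟩`. -/
theorem imForm_brylinskiWeinsteinForm (hB : IsQuadratic B) (pt : (nerve E G).X 0)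
    (v w : (nerve E G).E 1) :
    (nerve E G).imForm (brylinskiWeinsteinForm B) (l := 1) (r := 1) rfl pt v w =
      2 * B (nerveTangent E G pt v) (nerveTangent E G pt w) := by
  classical
  rw [SimplicialManifold.imForm, Finset.filter_true_of_mem (by
    refine fun σ _ => ⟨fun i j h1 h2 => ?_, fun i j h1 h2 => ?_⟩ <;> omega)]
  rw [show (Finset.univ : Finset (Equiv.Perm (Fin 2))) = {1, Equiv.swap 0 1} from by decide,
    Finset.sum_pair (by decide), Equiv.Perm.sign_one, Equiv.Perm.sign_swap (by decide)]
  have hΩ : ∀ p q p' q' : (nerve E G).E 2, p = p' → q = q' →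
      brylinskiWeinsteinForm B ((nerve E G).base 2 pt) ![p, q] =
        B ((p' : Fin 2 → E) 0) ((q' : Fin 2 → E) 1) -
          B ((q' : Fin 2 → E) 0) ((p' : Fin 2 → E) 1) := by
    rintro p q _ _ rfl rfl
    exact brylinskiWeinsteinForm_base pt ![p, q]
  -- Only the value at `1` matters. It is `σ 1` for the degeneracy applied to `v` and, because of
  -- the shift by `r = 1`, `σ 0` for the one applied to `w`.
  let a : Equiv.Perm (Fin 2) → ℕ → ℕ := fun σ k => if hk : k < 2 then (σ ⟨k, hk⟩ : ℕ) else 0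
  let c : Equiv.Perm (Fin 2) → ℕ → ℕ := fun σ k =>
    if hk : k - 1 < 2 then (σ ⟨k - 1, hk⟩ : ℕ) else 0
  have e1 := hΩ _ _ _ _ ((nerve_tangentDegen (G := G) (a 1) pt v).2 rfl)
    ((nerve_tangentDegen (G := G) (c 1) pt w).1 rfl)
  have e2 := hΩ _ _ _ _ ((nerve_tangentDegen (G := G) (a (Equiv.swap 0 1)) pt v).1 rfl)
    ((nerve_tangentDegen (G := G) (c (Equiv.swap 0 1)) pt w).2 rfl)
  refine (congrArg₂ (fun s t : ℝ => (((1 : ℤˣ) : ℤ) : ℝ) * s + (((-1 : ℤˣ) : ℤ) : ℝ) * t)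
    e1 e2).trans ?_
  rw [nerveTangent_apply, nerveTangent_apply]
  have hz : B (0 : E) (0 : E) = 0 := (B (0 : E)).map_zero
  have h := hB.symm ((v : Fin 1 → E) 0) ((w : Fin 1 → E) 0)
  change (((1 : ℤˣ) : ℤ) : ℝ) * (B ((v : Fin 1 → E) 0) ((w : Fin 1 → E) 0) - B (0 : E) (0 : E)) +
    (((-1 : ℤˣ) : ℤ) : ℝ) * (B (0 : E) (0 : E) - B ((w : Fin 1 → E) 0) ((v : Fin 1 → E) 0)) = _
  rw [hz, ← h]
  push_cast
  ring

/-- Homology lives only in degree one, where it is `𝔤` and the pairing is twice the given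
non-degenerate form. -/
theorem isNondegenerate_brylinskiWeinsteinForm (hB : IsQuadratic B) :
    (nerve E G).IsNondegenerate (brylinskiWeinsteinForm B) := by
  intro pt
  refine ⟨fun l r h => ?_, fun l hl => subsingleton_nerve_homology pt (by omega)⟩
  by_cases hl : l = 1
  · obtain rfl : r = 1 := by omega
    subst hl
    -- The identification of the first homology with `𝔤`: every tangent vector is a cycle and only
    -- zero is a boundary.
    let q : (nerve E G).homology pt 1 →ₗ[ℝ] GroupLieAlgebra 𝓘(ℝ, E) G :=
      Submodule.liftQ _ ((nerveTangent E G pt).toLinearMap ∘ₗ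
        ((nerve E G).cycles pt 1).subtype) fun v hv => by
          have hv' : v.1 ∈ (nerve E G).boundaries pt 1 := hv
          rw [nerve_boundaries_one, Submodule.mem_bot] at hv'
          change nerveTangent E G pt v.1 = 0
          rw [hv', map_zero]
    have hq : ∀ v : (nerve E G).cycles pt 1,
        q (Submodule.Quotient.mk v) = nerveTangent E G pt v := fun v => rfl
    have hq1 : ∀ x, q x = 0 → x = 0 := fun x hx => by
      obtain ⟨v, rfl⟩ := Submodule.Quotient.mk_surjective _ x
      have hv : v = 0 := Subtype.ext ((nerveTangent_bijective pt).1 (hx.trans (map_zero _).symm))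
      rw [hv, Submodule.Quotient.mk_zero]
    have hq2 : Function.Surjective q := fun a => by
      obtain ⟨v, hv⟩ := (nerveTangent_bijective pt).2 a
      exact ⟨Submodule.Quotient.mk ⟨v, by rw [nerve_cycles_one]; trivial⟩, hv⟩
    refine ⟨((2 : ℝ) • B).compl₁₂ q q, fun v w => ?_, fun x hx => hq1 x ?_, fun x hx => hq1 x ?_⟩
    · rw [imForm_brylinskiWeinsteinForm hB]
      rfl
    · refine hB.nondegenerate.1 _ fun a => ?_
      obtain ⟨y, rfl⟩ := hq2 a
      have h1 : 2 * B (q x) (q y) = 0 := hx y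
      linarith
    · refine hB.nondegenerate.2 _ fun a => ?_
      obtain ⟨y, rfl⟩ := hq2 a
      have h1 : 2 * B (q y) (q x) = 0 := hx y
      linarith
  · have h1 := subsingleton_nerve_homology (G := G) (E := E) pt hl
    have h2 := subsingleton_nerve_homology (G := G) (E := E) pt (l := r) (by omega)
    refine ⟨0, fun v w => ?_, fun x _ => Subsingleton.elim _ _, fun x _ => Subsingleton.elim _ _⟩
    -- As `l + r = 2` and `l ≠ 1`, one of the arguments lives over the point `NG_0` and is zero.
    obtain rfl | rfl : l = 0 ∨ r = 0 := by omega
    · have hv : v.1 = 0 := Subsingleton.elim (α := (nerve E G).E 0) _ _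
      rw [hv, SimplicialManifold.imForm_zero_left]
      rfl
    · have hw : w.1 = 0 := Subsingleton.elim (α := (nerve E G).E 0) _ _
      rw [hw, SimplicialManifold.imForm_zero_right]
      rfl

end NerveTangentComplex

end

theorem mainTheorem4 {E : Type v} [NormedAddCommGroup E] [NormedSpace ℝ E] [FiniteDimensional ℝ E]
    {G : Type u} [TopologicalSpace G] [ChartedSpace E G] [Group G] [LieGroup 𝓘(ℝ, E) ∞ G]
    (B : LinearMap.BilinForm ℝ (GroupLieAlgebra 𝓘(ℝ, E) G)) (hB : IsQuadratic B)
    (hAd : PreconnectedSpace G ∨ ∀ (g : G) (a b : GroupLieAlgebra 𝓘(ℝ, E) G),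
      B (adjointAction E g a) (adjointAction E g b) = B a b) :
    (nerve E G).IsLieGroup 1 ∧
    (nerve E G).IsShiftedSymplectic 2 1 (nerveForm B) ∧
    ∀ pt : (nerve E G).X 0,
      Set.BijOn (nerveTangent E G pt) ((nerve E G).tangentComplex pt 1) Set.univ ∧
      ∀ v ∈ (nerve E G).tangentComplex pt 1, ∀ w ∈ (nerve E G).tangentComplex pt 1,
        (nerve E G).imForm (nerveForm B 2 2) (l := 1) (r := 1) rfl pt v w =
          2 * B (nerveTangent E G pt v) (nerveTangent E G pt w) := by
  have hinv : ∀ (g : G) (v w : E), B (modelAd E g v) (modelAd E g w) = B v w := by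
    obtain h | h := hAd
    · exact hB.modelAd_invariant
    · exact h
  refine ⟨nerve_isLieGroup 1 le_rfl, ⟨nerve_isLieGroupoid 1 le_rfl, isShiftedForm_nerveForm hB,
    D_nerveForm hB hinv, isNondegenerate_brylinskiWeinsteinForm hB⟩, fun pt => ⟨?_, ?_⟩⟩
  · rw [nerve_tangentComplex_one, Submodule.top_coe]
    exact Set.bijOn_univ.2 (nerveTangent_bijective pt)
  · exact fun v _ w _ => imForm_brylinskiWeinsteinForm hB pt v w
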